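/- **Gaussian means.** For $N\ge 1$ let $\langle\,\cdot\,\rangle$ be the normalized average over Hermitian $N\times N$ matrices $H$ with weight $e^{-\frac N2\operatorname{tr}H^2}DH$. For $s\ge1$ and $k\in\mathbb Z_{\ge0}^s$ the connected means $\langle\prod_{i\in I}\operatorname{tr}H^{k_i}\rangle^{\rm conn}$ ($\emptyset\ne I\subseteq\{1,\dots,s\}$) are defined recursively by $$\Bigl\langle\prod_{i\in I}\operatorname{tr}H^{k_i}\Bigr\rangle=\sum_{I=I_1\sqcup\cdots\sqcup I_p}\ \prod_{j=1}^p\Bigl\langle\prod_{i\in I_j}\operatorname{tr}H^{k_i}\Bigr\rangle^{\rm conn}$$ (sum over set partitions of $I$ into non-empty blocks), and their genus-$g$ parts by the expansion, a polynomial in $N^{-2}$ valid for all $N\ge1$, $$N^{s-2}\Bigl\langle\prod_{i=1}^s\operatorname{tr}H^{k_i}\Bigr\rangle^{\rm conn}=\sum_{g\ge0}N^{-2g}\Bigl\langle\prod_{i=1}^s\operatorname{tr}H^{k_i}\Bigr\rangle^{\rm conn}_g .$$ The genus-$g$ mean of $\prod_i\operatorname{tr}\log(x_i-H)$ is defined by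 expanding multilinearly $\operatorname{tr}\log(x-H)=\log x\,\operatorname{tr}H^0-\sum_{k\ge1}\frac{x^{-k}}{k}\operatorname{tr}H^k$ into genus-$g$ connected means. **Shapes.** For $s\ge 1$ let $\Gamma_{g,s}$ be the set of isomorphism classes of connected fatgraphs of genus $g$ with $s$ faces labelled $1,\dots,s$, all of whose vertices have valence at least $3$; isomorphisms and automorphisms preserve the face labels. Put $$F^{(g)}_s(\lambda_1,\dots,\lambda_s)=\sum_{\gamma\in\Gamma_{g,s}}\frac1{|\operatorname{Aut}\gamma|}\prod_{e\ \text{edge of}\ \gamma}\frac1{e^{\lambda_e^{(+)}+\lambda_e^{(-)}}-1},$$ where $\lambda_e^{(\pm)}$ are the variables of the (possibly coinciding) faces on the two sides of $e$. **Theorem.** The polynomial genus expansion above exists and is unique for every $s\ge1$ and every $k\in\mathbb Z_{\ge0}^s$. Moreover: (a) Let $g\ge0$, $s\ge1$ and $2g+s>2$. Then $\Gamma_{g,s}$ is finite, and for all complex $\lambda_i$ with $\operatorname{Re}\lambda_i>0$ and $|e^{\lambda_i}+e^{-\lambda_i}|>2$ the series defining the genus-$g$ mean converges absolutely and $$\Bigl\langle\prod_{i=1}^s\operatorname{tr}\log(e^{\lambda_i}+e^{-\lambda_i}-H)\Bigr\rangle^{\rm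 conn}_g=(-1)^sF_s^{(g)}(\lambda_1,\dots,\lambda_s).$$ (b) Let $N\ge1$, $\lambda_1,\dots,\lambda_N>0$ and $\Lambda=\operatorname{diag}(e^{\lambda_1},\dots,e^{\lambda_N})$. Then, as formal power series in $\alpha^{-1/2}$, $$\frac{\int DX\,e^{-\alpha N\operatorname{tr}[\frac14\Lambda X\Lambda X+\frac12\log(1-X)+\frac12X]}}{\int DX\,e^{-\alpha N\operatorname{tr}[\frac14\Lambda X\Lambda X-\frac14X^2]}}=\exp\Bigl(\sum_{g\ge0,\ s\ge1,\ 2g+s>2}N^{2-2g}\bigl(\tfrac\alpha2\bigr)^{2-2g-s}F_s^{(g)}(\lambda)\Bigr),$$ where $F_s^{(g)}(\lambda)=\frac{1}{N^s\,s!}\sum_{i_1,\dots,i_s=1}^N F_s^{(g)}(\lambda_{i_1},\dots,\lambda_{i_s})$. The left-hand side is the perturbative integral over Hermitian matrices: substitute $X=\alpha^{-1/2}Y$, expand $\exp\bigl(\frac N2\sum_{k\ge3}\alpha^{1-k/2}\frac{\operatorname{tr}Y^k}{k}\bigr)$ in powers of $\alpha^{-1/2}$, and average each coefficient with the normalized Gaussian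 weight $e^{-\frac N4\operatorname{tr}(\Lambda Y\Lambda Y-Y^2)}DY$. -/

import Mathlib

open Equiv MeasureTheory

/-! ### Fatgraphs with labelled faces -/

/-- A nonempty connected fatgraph with at least one edge and with `s` faces, labelled by `Fin s`.
It is given by a rotation system on the set `Fin n` of half-edges: the cycles of `vert` are the
vertices with their cyclic orders, the orbits of the fixed-point-free involution `edge` are the
edges, and the cycles of `vert * edge` are the faces (boundary components). -/
structure Fatgraph (s : ℕ) where
  n : ℕ
  n_pos : 0 < n
  vert : Perm (Fin n)
  edge : Perm (Fin n)
  edge_edge : ∀ x, edge (edge x) = x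
  edge_ne : ∀ x, edge x ≠ x
  connected : ∀ x y, ∃ p ∈ Subgroup.closure {vert, edge}, p x = y
  /-- the label of the face to which a half-edge belongs -/
  face : Fin n → Fin s
  face_surjective : Function.Surjective face
  face_eq_iff : ∀ x y, face x = face y ↔ (vert * edge).SameCycle x y

namespace Fatgraph

variable {s : ℕ}

/-- Isomorphisms of fatgraphs; they preserve the labels of the faces. -/
structure Iso (G H : Fatgraph s) where
  toEquiv : Fin G.n ≃ Fin H.n
  map_vert : ∀ x, toEquiv (G.vert x) = H.vert (toEquiv x)
  map_edge : ∀ x, toEquiv (G.edge x) = H.edge (toEquiv x)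
  map_face : ∀ x, H.face (toEquiv x) = G.face x

theorem Iso.ext' {G H : Fatgraph s} {f h : Iso G H} (e : ∀ x, f.toEquiv x = h.toEquiv x) :
    f = h := by
  cases f; cases h
  congr
  exact Equiv.ext e

def Iso.refl (G : Fatgraph s) : Iso G G :=
  ⟨Equiv.refl _, fun _ => rfl, fun _ => rfl, fun _ => rfl⟩

def Iso.symm {G H : Fatgraph s} (f : Iso G H) : Iso H G where
  toEquiv := f.toEquiv.symm
  map_vert x := by rw [Equiv.symm_apply_eq, f.map_vert, Equiv.apply_symm_apply]
  map_edge x := by rw [Equiv.symm_apply_eq, f.map_edge, Equiv.apply_symm_apply]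
  map_face x := by rw [← f.map_face, Equiv.apply_symm_apply]

def Iso.trans {G H K : Fatgraph s} (f : Iso G H) (h : Iso H K) : Iso G K where
  toEquiv := f.toEquiv.trans h.toEquiv
  map_vert x := by simp [f.map_vert, h.map_vert]
  map_edge x := by simp [f.map_edge, h.map_edge]
  map_face x := by simp [f.map_face, h.map_face]

/-- The order of the automorphism group. -/
noncomputable def autCard (G : Fatgraph s) : ℕ := Nat.card (Iso G G)

noncomputable def numVertices (G : Fatgraph s) : ℕ := Nat.card (Quotient (Perm.SameCycle.setoid G.vert))

/-- The set of edges, an edge being the unordered pair of its two half-edges. -/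
def edges (G : Fatgraph s) : Finset (Sym2 (Fin G.n)) :=
  Finset.univ.image fun x => s(x, G.edge x)

/-- The Euler characteristic `V - E + s` is `2 - 2 g`. -/
def HasGenus (G : Fatgraph s) (g : ℕ) : Prop := G.numVertices + s + 2 * g = G.edges.card + 2

/-- The valence of the vertex at which the half-edge `x` is attached. -/
noncomputable def valence (G : Fatgraph s) (x : Fin G.n) : ℕ := Nat.card {y // G.vert.SameCycle x y}

/-- The factor `1 / (e ^ (λ₊ + λ₋) - 1)` of an edge, where `λ₊`, `λ₋` are the variables of the
faces on the two sides of the edge. -/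
noncomputable def edgeWeight (G : Fatgraph s) (l : Fin s → ℂ) (e : Sym2 (Fin G.n)) : ℂ :=
  Sym2.lift ⟨fun x y => 1 / (Complex.exp (l (G.face x) + l (G.face y)) - 1),
    fun x y => by simp only [add_comm]⟩ e

/-- The contribution of a fatgraph: `1 / |Aut|` times the product over all edges. -/
noncomputable def weight (G : Fatgraph s) (l : Fin s → ℂ) : ℂ :=
  1 / (G.autCard : ℂ) * ∏ e ∈ G.edges, G.edgeWeight l e

theorem autCard_eq {G H : Fatgraph s} (f : Iso G H) : G.autCard = H.autCard := by
  refine Nat.card_congr ⟨fun a => (f.symm.trans a).trans f, fun a => (f.trans a).trans f.symm,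
    fun a => ?_, fun a => ?_⟩ <;>
  · apply Iso.ext'
    intro x
    simp [Iso.trans, Iso.symm]

theorem weight_eq {G H : Fatgraph s} (f : Iso G H) (l : Fin s → ℂ) : G.weight l = H.weight l := by
  unfold weight
  rw [autCard_eq f]
  congr 1
  refine Finset.prod_bij (fun e _ => e.map f.toEquiv) ?_ ?_ ?_ ?_
  · intro e he
    obtain ⟨x, -, rfl⟩ := Finset.mem_image.1 he
    exact Finset.mem_image.2 ⟨f.toEquiv x, Finset.mem_univ _, by simp [f.map_edge]⟩
  · intro a _ b _ h
    exact Sym2.map.injective f.toEquiv.injective h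
  · intro e he
    obtain ⟨y, -, rfl⟩ := Finset.mem_image.1 he
    exact ⟨s(f.toEquiv.symm y, G.edge (f.toEquiv.symm y)),
      Finset.mem_image.2 ⟨_, Finset.mem_univ _, rfl⟩, by simp [f.map_edge]⟩
  · intro e _
    induction e using Sym2.ind with
    | _ x y => simp [edgeWeight, f.map_face]

/-- The shapes of genus `g`: all vertices have valence at least three. -/
def IsShape (G : Fatgraph s) (g : ℕ) : Prop := G.HasGenus g ∧ ∀ x, 3 ≤ G.valence x

/-- Isomorphism of shapes. -/
def shapeSetoid (g s : ℕ) : Setoid {G : Fatgraph s // G.IsShape g} where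
  r G H := Nonempty (Iso G.1 H.1)
  iseqv := ⟨fun G => ⟨Iso.refl G.1⟩, fun ⟨f⟩ => ⟨f.symm⟩, fun ⟨f⟩ ⟨h⟩ => ⟨f.trans h⟩⟩

end Fatgraph

/-- The set `Γ_{g,s}` of isomorphism classes of shapes of genus `g` with `s` labelled faces. -/
def Shape (g s : ℕ) : Type := Quotient (Fatgraph.shapeSetoid g s)

noncomputable def Shape.weight {g s : ℕ} (γ : Shape g s) (l : Fin s → ℂ) : ℂ :=
  Quotient.lift (s := Fatgraph.shapeSetoid g s)
    (fun G : {G : Fatgraph s // G.IsShape g} => G.1.weight l)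
    (fun _ _ ⟨f⟩ => Fatgraph.weight_eq f l) γ

/-- `F_s^{(g)}(λ_1, …, λ_s)`. -/
noncomputable def shapeSum (g s : ℕ) (l : Fin s → ℂ) : ℂ := ∑ᶠ γ : Shape g s, γ.weight l

/-! ### Gaussian averages over Hermitian matrices -/

/-- The linear parametrization of Hermitian `N × N` matrices by `N²` real coordinates: the
diagonal entries, and the real (`i < j`, coordinate `(i, j)`) and imaginary (coordinate `(j, i)`)
parts of the entries above the diagonal. Lebesgue measure in these coordinates is `DH`. -/
def hermitianOf {N : ℕ} (x : Fin N × Fin N → ℝ) : Matrix (Fin N) (Fin N) ℂ := fun i j =>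
  if i = j then (x (i, i) : ℂ)
  else if i < j then (x (i, j) : ℂ) + Complex.I * (x (j, i) : ℂ)
  else (x (j, i) : ℂ) - Complex.I * (x (i, j) : ℂ)

theorem hermitianOf_isHermitian {N : ℕ} (x : Fin N × Fin N → ℝ) : (hermitianOf x).IsHermitian := by
  ext i j
  rcases lt_trichotomy i j with h | h | h
  · simp [Matrix.conjTranspose_apply, hermitianOf, h.ne, h.ne', h, h.not_gt, sub_eq_add_neg]
  · subst h
    simp [Matrix.conjTranspose_apply, hermitianOf]
  · simp [Matrix.conjTranspose_apply, hermitianOf, h.ne, h.ne', h, h.not_gt, sub_eq_add_neg]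

theorem exists_hermitianOf {N : ℕ} {H : Matrix (Fin N) (Fin N) ℂ} (hH : H.IsHermitian) :
    ∃ x, hermitianOf x = H := by
  refine ⟨fun p => if p.1 ≤ p.2 then (H p.1 p.2).re else (H p.2 p.1).im, ?_⟩
  ext i j
  have hc := hH.apply i j
  rcases lt_trichotomy i j with h | h | h
  · apply Complex.ext <;> simp [hermitianOf, h.ne, h, h.le, h.not_ge]
  · subst h
    have := congrArg Complex.im hc
    apply Complex.ext <;> simp [hermitianOf] at this ⊢
    linarith
  · rw [← hc]
    apply Complex.ext <;> simp [hermitianOf, h.ne', h.not_gt, h.le, h.not_ge]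

/-- The normalized average `∫ P(H) e^{-Q(H)} DH / ∫ e^{-Q(H)} DH` over Hermitian matrices. -/
noncomputable def hermitianAverage (N : ℕ) (Q P : Matrix (Fin N) (Fin N) ℂ → ℂ) : ℂ :=
  (∫ x : Fin N × Fin N → ℝ, P (hermitianOf x) * Complex.exp (-Q (hermitianOf x))) /
    ∫ x : Fin N × Fin N → ℝ, Complex.exp (-Q (hermitianOf x))

/-- `⟨∏_{i ∈ I} tr H^{k_i}⟩` for the weight `exp (-(N / 2) tr H²)`. -/
noncomputable def traceMean (N : ℕ) {s : ℕ} (k : Fin s → ℕ) (I : Finset (Fin s)) : ℂ :=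
  hermitianAverage N (fun H => (N : ℂ) / 2 * (H ^ 2).trace) fun H => ∏ i ∈ I, (H ^ k i).trace

/-- The connected parts `C` of a family `M` of means, defined by
`M I = ∑_π ∏_{B ∈ π} C B` for nonempty `I`, the sum being over all partitions `π` of `I`. -/
noncomputable def connectedPart {ι : Type} [DecidableEq ι] (M : Finset ι → ℂ) (I : Finset ι) : ℂ :=
  M I - ∑ π ∈ (Finset.univ.filter fun π : Finpartition I => π.parts ≠ {I}).attach,
    ∏ B ∈ π.1.parts.attach, connectedPart M B.1
termination_by I.card
decreasing_by
  refine Finset.card_lt_card ((π.1.le B.2).lt_of_ne fun h => ?_)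
  apply (Finset.mem_filter.1 π.2).2
  have hI : I ∈ π.1.parts := by
    have hB := B.2
    rwa [h] at hB
  refine Finset.eq_singleton_iff_unique_mem.2 ⟨hI, fun A hA => ?_⟩
  by_contra hne
  have hd := π.1.disjoint hA hI hne
  have hA0 : A = ∅ := by
    have hle : A ≤ I := π.1.le hA
    simpa using hd.eq_bot_of_le hle
  exact π.1.bot_notMem (by rw [hA0] at hA; exact hA)

theorem sum_prod_connectedPart {ι : Type} [DecidableEq ι] (M : Finset ι → ℂ) (I : Finset ι)
    (hI : I.Nonempty) :
    M I = ∑ π : Finpartition I, ∏ B ∈ π.parts, connectedPart M B := by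
  rw [← Finset.sum_filter_add_sum_filter_not Finset.univ
    (fun π : Finpartition I => π.parts ≠ {I})]
  have h1 : (Finset.univ.filter fun π : Finpartition I => ¬ π.parts ≠ {I}) =
      {Finpartition.indiscrete hI.ne_empty} := by
    ext π
    simp [Finpartition.ext_iff]
  rw [h1, Finset.sum_singleton, Finpartition.indiscrete_parts, Finset.prod_singleton,
    connectedPart]
  simp only [Finset.prod_attach _ (fun B => connectedPart M B)]
  rw [Finset.sum_attach _ (fun π : Finpartition I => ∏ B ∈ π.parts, connectedPart M B)]
  ring

/-- `⟨∏_i tr H^{k_i}⟩^conn`. -/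
noncomputable def connectedMean (N : ℕ) {s : ℕ} (k : Fin s → ℕ) : ℂ :=
  connectedPart (traceMean N k) Finset.univ

/-- `p` is the genus expansion `N^{s-2} ⟨∏_i tr H^{k_i}⟩^conn = ∑_g p_g N^{-2g}`. -/
def IsGenusExpansion {s : ℕ} (k : Fin s → ℕ) (p : Polynomial ℂ) : Prop :=
  ∀ N : ℕ, 1 ≤ N → (N : ℂ) ^ ((s : ℤ) - 2) * connectedMean N k = p.eval ((N : ℂ) ^ (-2 : ℤ))

open Classical in
/-- `⟨∏_i tr H^{k_i}⟩_g^conn`, the coefficient of `N^{-2g}` in the genus expansion. -/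
noncomputable def genusMean (g : ℕ) {s : ℕ} (k : Fin s → ℕ) : ℂ :=
  if h : ∃ p : Polynomial ℂ, IsGenusExpansion k p then h.choose.coeff g else 0

/-- The coefficients of `tr log (x - H) = ∑_k logCoeff x k * tr H^k`, that is,
`log x` for `k = 0` and `-x^{-k} / k` for `k ≥ 1`. -/
noncomputable def logCoeff (x : ℂ) (k : ℕ) : ℂ :=
  if k = 0 then Complex.log x else -(1 / ((k : ℂ) * x ^ k))

/-! ### The Kontsevich–Penner matrix model -/

/-- The quadratic part `(N / 4) tr (Λ Y Λ Y - Y²)` of the action, with `Λ = diag (e^{λ_i})` and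
`X = α^{-1/2} Y`. -/
noncomputable def kpQuadratic {N : ℕ} (l : Fin N → ℝ) (Y : Matrix (Fin N) (Fin N) ℂ) : ℂ :=
  (N : ℂ) / 4 * (Matrix.diagonal (fun i => Complex.exp (l i)) * Y *
    Matrix.diagonal (fun i => Complex.exp (l i)) * Y - Y ^ 2).trace

/-- The remaining part `-α N tr [log (1 - X) / 2 + X / 2 + X² / 4] = α (N / 2) ∑_{k ≥ 3} tr X^k / k`
of the exponent, at `X = t Y` and `α = t^{-2}`, as the formal power series
`(N / 2) ∑_{k ≥ 3} t^{k-2} tr Y^k / k` in `t`. -/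
noncomputable def kpInteraction {N : ℕ} (Y : Matrix (Fin N) (Fin N) ℂ) : PowerSeries ℂ :=
  PowerSeries.mk fun m => if m = 0 then 0 else (N : ℂ) / 2 * ((Y ^ (m + 2)).trace / ((m + 2 : ℕ) : ℂ))

/-- The normalized integral
`∫ DX exp (-α N tr [Λ X Λ X / 4 + log (1 - X) / 2 + X / 2]) / ∫ DX exp (-α N tr [Λ X Λ X / 4 - X² / 4])`
as a formal matrix integral, i.e. as its diagrammatic expansion in powers of `t = α^{-1/2}`: the
coefficient of each power of `t` in the exponential of the interaction is averaged with the
Gaussian weight. -/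
noncomputable def kpIntegral (N : ℕ) (l : Fin N → ℝ) : PowerSeries ℂ :=
  PowerSeries.mk fun m => hermitianAverage N (kpQuadratic l) fun Y =>
    PowerSeries.coeff m ((PowerSeries.exp ℂ).subst (kpInteraction Y))

/-- The value of the `(g, s)` term on the spectrum of `Λ`: the normalized sum
`N^{-s} / s! ∑_{i_1, …, i_s} F_s^{(g)}(λ_{i_1}, …, λ_{i_s})` over all choices of eigenvalues. -/
noncomputable def kpTerm (N g s : ℕ) (l : Fin N → ℝ) : ℂ :=
  1 / ((N : ℂ) ^ s * (s.factorial : ℂ)) *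
    ∑ i : Fin s → Fin N, shapeSum g s fun j => ((l (i j) : ℝ) : ℂ)

/-- `∑_{g, s} N^{2-2g} (α / 2)^{2-2g-s} F_s^{(g)}(λ)` over `s ≥ 1` and `2 g + s > 2`, as a power
series in `t = α^{-1/2}`; here `α^{2-2g-s} = t^{2(2g+s-2)}`, so that the coefficient of `t^m`
is a finite sum. -/
noncomputable def kpFreeEnergy (N : ℕ) (l : Fin N → ℝ) : PowerSeries ℂ :=
  PowerSeries.mk fun m =>
    ∑ q ∈ (Finset.range (m + 3) ×ˢ Finset.range (m + 3)).filter
        (fun q : ℕ × ℕ => 1 ≤ q.2 ∧ 2 < 2 * q.1 + q.2 ∧ 2 * (2 * q.1 + q.2) = m + 4),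
      (N : ℂ) ^ (2 - 2 * (q.1 : ℤ)) * (1 / 2 : ℂ) ^ (2 - 2 * (q.1 : ℤ) - (q.2 : ℤ)) *
        kpTerm N q.1 q.2 l

/-!
The proof goes through Wick's theorem and the enumeration of maps, i.e. of triples `(σ, e, ℓ)` which
consist of a permutation `σ` of a finite set of half-edges (its cycles are the vertices), of a
fixed-point-free involution `e` (its orbits are the edges) and of a labelling `ℓ` of the cycles of
`σ * e` (the faces).

*The genus expansion.* A Gaussian average of a product of matrix entries is a sum over the pairings of
the entries (`hermitianAverage_sum_prod`). For the product of the traces `tr H ^ k i` the entries are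
the half-edges at `s` vertices of valences `k i`, rotated by `rot k`, and summing over the matrix
indices gives a factor `N` for every cycle of `rot k * e`. The connected part selects the pairings which
connect the vertices (`connectedMean_eq`), and for those Euler's relation (`exists_genus`) shows that the
exponent of `N` is `2 - s - 2 g` with a natural number `g`; this gives `existsUnique_genusExpansion`.
Uniqueness holds because a polynomial is determined by its values at the numbers `N⁻²`.

*Logarithms.* By duality, a genus mean counts maps of genus `g` with `s` faces of prescribed lengths and
with an origin in each face (`genusMean_eq_markedCount`). The factor `1 / k` in the logarithm removes the
origins. Every map arises in a unique way from a map without leaves by attaching plane trees to the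
corners. In enumerative terms: leaves are removed one at a time, inclusion–exclusion over sets of leaves
expresses the leafless maps through all maps, and this relation is inverted by the numbers `treeCount k p`
of ways to extend a face of length `p` by trees to the length `k` (`markedCount_eq_sum_treeCount`).
Their generating series is `∑ₖ treeCount k p * x⁻ᵏ = z ^ p` for `x = z + z⁻¹`, `|x| > 2` and `|z| < 1`
(`hasSum_treeCount`); this is why `x = e ^ λ + e ^ (-λ)` is the natural variable, with `z = e ^ (-λ)`. A
map without leaves is in turn a shape with bivalent vertices inserted in its edges. An edge between the
faces `i` and `j` which is subdivided into `r` edges has the weight `(zᵢ zⱼ) ^ r`, and the geometric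
series over `r ≥ 1` is `1 / (e ^ (λᵢ + λⱼ) - 1)`. The removal of one bivalent vertex identifies the
counts of leafless maps with the Taylor coefficients of such geometric series (`hasSum_coreSum`). All these
sums are taken over labelled objects and divided by `n!`, and the orbit-stabilizer theorem turns them
into sums over isomorphism classes weighted with `1 / |Aut|` (`shapeSum_eq_sum`). There are only finitely
many shapes, since vertices of valence at least three bound the number of edges in terms of the Euler
characteristic. The convergent expansion is the combination of `hasSum_genusMean` and
`shapeGen_eq_shapeSum`.

*The matrix integral.* The exponential formula `mk_pairSum_eq_exp` holds for every weight of pairs of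
permutations which is multiplicative under disjoint unions: marking a half-edge and removing its
component yields the differential equation `Z' = U' Z` for the generating series. It is applied twice.
With `e = 1` it expands the exponential of the interaction as a sum over collections of vertices of
valence at least three (`exp_kpInteraction`). Wick's theorem then turns the average into a sum over
fatgraphs which need not be connected, with the propagator `2 / (N (e ^ (λᵢ + λⱼ) - 1))`
(`kpIntegral_eq`), and the second application identifies the integral with the exponential of the sum
over connected fatgraphs, which by Euler's relation is the free energy (`coeff_kpFreeEnergy`).
-/

/-! ### Wick's theorem for diagonal Gaussian weights -/

theorem integrable_pow_mul_cexp_neg_mul_sq {a : ℝ} (ha : 0 < a) (m : ℕ) :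
    Integrable fun x : ℝ => (x : ℂ) ^ m * Complex.exp (-(a * x ^ 2)) := by
  have h := integrable_rpow_mul_exp_neg_mul_sq ha (s := m) (by linarith [m.cast_nonneg (α := ℝ)])
  refine h.ofReal.congr (Filter.Eventually.of_forall fun x => ?_)
  simp

theorem integral_pow_succ_mul_cexp {a : ℝ} (ha : 0 < a) (m : ℕ) :
    ∫ x : ℝ, (x : ℂ) ^ (m + 1) * Complex.exp (-(a * x ^ 2)) =
      1 / (2 * a) * (m * ∫ x : ℝ, (x : ℂ) ^ (m - 1) * Complex.exp (-(a * x ^ 2))) := by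
  have hi := fun m => integrable_pow_mul_cexp_neg_mul_sq ha m
  have hd : ∀ x : ℝ, HasDerivAt (fun x : ℝ => Complex.exp (-(a * x ^ 2)))
      (-(2 * a) * x * Complex.exp (-(a * x ^ 2))) x := by
    intro x
    have h1 : HasDerivAt (fun z : ℂ => Complex.exp (-(a * z ^ 2)))
        (-(2 * a) * x * Complex.exp (-(a * x ^ 2))) (x : ℂ) := by
      have h2 := ((((hasDerivAt_id (x : ℂ)).pow 2).const_mul (a : ℂ)).neg).cexp
      refine h2.congr_deriv ?_
      simp
      ring
    exact h1.comp_ofReal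
  have hp : ∀ x : ℝ, HasDerivAt (fun x : ℝ => (x : ℂ) ^ m) (m * (x : ℂ) ^ (m - 1)) x := by
    intro x
    exact (hasDerivAt_pow m (x : ℂ)).comp_ofReal
  have h := integral_mul_deriv_eq_deriv_mul_of_integrable (u := fun x : ℝ => (x : ℂ) ^ m)
    (v := fun x : ℝ => Complex.exp (-(a * x ^ 2)))
    (fun x _ => hp x) (fun x _ => hd x)
    (((hi (m + 1)).const_mul (-(2 * a : ℂ))).congr
      (Filter.Eventually.of_forall fun x => by simp only [Pi.mul_apply]; ring))
    (((hi (m - 1)).const_mul (m : ℂ)).congr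
      (Filter.Eventually.of_forall fun x => by simp only [Pi.mul_apply]; ring))
    (hi m)
  have e1 : ∀ x : ℝ, (x : ℂ) ^ m * (-(2 * a) * x * Complex.exp (-(a * x ^ 2))) =
      (-(2 * a)) * ((x : ℂ) ^ (m + 1) * Complex.exp (-(a * x ^ 2))) := fun x => by ring
  have e2 : ∀ x : ℝ, (m : ℂ) * (x : ℂ) ^ (m - 1) * Complex.exp (-(a * x ^ 2)) =
      m * ((x : ℂ) ^ (m - 1) * Complex.exp (-(a * x ^ 2))) := fun x => by ring
  simp only [e1, e2, integral_const_mul] at h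
  have ha' : (a : ℂ) ≠ 0 := by exact_mod_cast ha.ne'
  field_simp
  linear_combination -h

section
variable {ι : Type} [Fintype ι]

/-- The integral of a polynomial against the Gaussian weight `exp (-∑ p, a p * x p ^ 2)`. -/
noncomputable def gaussInt (a : ι → ℝ) (P : MvPolynomial ι ℂ) : ℂ :=
  ∫ x : ι → ℝ, P.eval (fun p => (x p : ℂ)) * Complex.exp (-∑ p, a p * (x p : ℂ) ^ 2)

theorem eval_monomial_mul_cexp (a : ι → ℝ) (m : ι →₀ ℕ) (c : ℂ) (x : ι → ℝ) :
    (MvPolynomial.monomial m c).eval (fun p => (x p : ℂ)) *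
      Complex.exp (-∑ p, a p * (x p : ℂ) ^ 2) =
      c * ∏ p, ((x p : ℂ) ^ m p * Complex.exp (-(a p * (x p : ℂ) ^ 2))) := by
  rw [MvPolynomial.eval_monomial, Finset.prod_mul_distrib, ← Complex.exp_sum,
    Finset.sum_neg_distrib, Finsupp.prod_fintype _ _ (fun _ => pow_zero _)]
  ring

theorem integrable_eval_mul_cexp {a : ι → ℝ} (ha : ∀ p, 0 < a p) (P : MvPolynomial ι ℂ) :
    Integrable fun x : ι → ℝ =>
      P.eval (fun p => (x p : ℂ)) * Complex.exp (-∑ p, a p * (x p : ℂ) ^ 2) := by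
  induction P using MvPolynomial.monomial_add_induction_on with
  | C c => 
    have := fun x => eval_monomial_mul_cexp a 0 c x
    rw [MvPolynomial.C_apply]
    simp only [this]
    exact (Integrable.fintype_prod fun p => integrable_pow_mul_cexp_neg_mul_sq (ha p) _).const_mul _
  | monomial_add m c Q _ _ ih =>
    simp only [map_add, add_mul]
    refine Integrable.add ?_ ih
    simp only [eval_monomial_mul_cexp]
    exact (Integrable.fintype_prod fun p => integrable_pow_mul_cexp_neg_mul_sq (ha p) _).const_mul _

theorem gaussInt_add {a : ι → ℝ} (ha : ∀ p, 0 < a p) (P Q : MvPolynomial ι ℂ) :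
    gaussInt a (P + Q) = gaussInt a P + gaussInt a Q := by
  unfold gaussInt
  rw [← integral_add (integrable_eval_mul_cexp ha P) (integrable_eval_mul_cexp ha Q)]
  simp only [map_add, add_mul]

theorem gaussInt_C_mul (a : ι → ℝ) (c : ℂ) (P : MvPolynomial ι ℂ) :
    gaussInt a (MvPolynomial.C c * P) = c * gaussInt a P := by
  unfold gaussInt
  rw [← integral_const_mul]
  simp only [map_mul, MvPolynomial.eval_C, mul_assoc]

theorem gaussInt_sum {a : ι → ℝ} (ha : ∀ p, 0 < a p) {κ : Type*} (s : Finset κ)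
    (P : κ → MvPolynomial ι ℂ) : gaussInt a (∑ k ∈ s, P k) = ∑ k ∈ s, gaussInt a (P k) := by
  classical
  induction s using Finset.induction_on with
  | empty => simp [gaussInt]
  | insert k s hk ih => rw [Finset.sum_insert hk, Finset.sum_insert hk, gaussInt_add ha, ih]

theorem gaussInt_monomial (a : ι → ℝ) (m : ι →₀ ℕ) (c : ℂ) :
    gaussInt a (MvPolynomial.monomial m c) =
      c * ∏ p, ∫ x : ℝ, (x : ℂ) ^ m p * Complex.exp (-(a p * (x : ℂ) ^ 2)) := by
  unfold gaussInt
  simp only [eval_monomial_mul_cexp]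
  rw [integral_const_mul, integral_fintype_prod_volume_eq_prod
    (f := fun p (x : ℝ) => (x : ℂ) ^ m p * Complex.exp (-(a p * (x : ℂ) ^ 2)))]

theorem gaussInt_one_ne_zero {a : ι → ℝ} (ha : ∀ p, 0 < a p) : gaussInt a 1 ≠ 0 := by
  rw [MvPolynomial.one_def, gaussInt_monomial, one_mul]
  refine Finset.prod_ne_zero_iff.2 fun p _ => ?_
  have h := integral_gaussian_complex (b := a p) (by simpa using ha p)
  have e : ∀ x : ℝ, (x : ℂ) ^ (0 : ι →₀ ℕ) p * Complex.exp (-(a p * (x : ℂ) ^ 2)) =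
      Complex.exp (-(a p : ℂ) * x ^ 2) := fun x => by simp
  simp only [e, h]
  have : (Real.pi / a p : ℂ) ≠ 0 :=
    div_ne_zero (by exact_mod_cast Real.pi_ne_zero) (by exact_mod_cast (ha p).ne')
  simpa [Complex.cpow_eq_zero_iff] using this

/-- Gaussian integration by parts. -/
theorem gaussInt_X_mul [DecidableEq ι] {a : ι → ℝ} (ha : ∀ p, 0 < a p) (q : ι) (P : MvPolynomial ι ℂ) :
    gaussInt a (MvPolynomial.X q * P) =
      1 / (2 * a q) * gaussInt a (MvPolynomial.pderiv q P) := by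
  have key : ∀ (m : ι →₀ ℕ) (c : ℂ), gaussInt a (MvPolynomial.X q * MvPolynomial.monomial m c) =
      1 / (2 * a q) * gaussInt a (MvPolynomial.pderiv q (MvPolynomial.monomial m c)) := by
    intro m c
    rw [MvPolynomial.pderiv_monomial, MvPolynomial.X, MvPolynomial.monomial_mul,
      gaussInt_monomial, gaussInt_monomial,
      ← Finset.mul_prod_erase _ _ (Finset.mem_univ q), ← Finset.mul_prod_erase _ _ (Finset.mem_univ q)]
    have e1 : ((Finsupp.single q 1 + m : ι →₀ ℕ) q) = m q + 1 := by simp [add_comm]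
    have e2 : ((m - Finsupp.single q 1 : ι →₀ ℕ) q) = m q - 1 := by simp
    rw [e1, e2, integral_pow_succ_mul_cexp (ha q)]
    have e3 : ∀ p ∈ Finset.univ.erase q, ((Finsupp.single q 1 + m : ι →₀ ℕ) p) =
        (m - Finsupp.single q 1 : ι →₀ ℕ) p := by
      intro p hp
      have : q ≠ p := (Finset.ne_of_mem_erase hp).symm
      simp [this]
    rw [Finset.prod_congr rfl fun p hp => by rw [e3 p hp]]
    ring
  induction P using MvPolynomial.monomial_add_induction_on with
  | C c => rw [MvPolynomial.C_apply, key]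
  | monomial_add m c Q _ _ ih =>
    rw [mul_add, gaussInt_add ha, map_add, gaussInt_add ha, ih, key, mul_add]

/-- The linear form with coefficients `u`. -/
noncomputable def linForm (u : ι → ℂ) : MvPolynomial ι ℂ :=
  ∑ p, MvPolynomial.C (u p) * MvPolynomial.X p

theorem pderiv_linForm [DecidableEq ι] (u : ι → ℂ) (q : ι) :
    MvPolynomial.pderiv q (linForm u) = MvPolynomial.C (u q) := by
  simp [linForm, MvPolynomial.pderiv_X, Pi.single_apply]

theorem pderiv_prod {ι : Type} {D : Type*} [DecidableEq D] (A : Finset D) (f : D → MvPolynomial ι ℂ) (q : ι) :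
    MvPolynomial.pderiv q (∏ d ∈ A, f d) =
      ∑ d ∈ A, (∏ d' ∈ A.erase d, f d') * MvPolynomial.pderiv q (f d) := by
  induction A using Finset.induction_on with
  | empty => simp
  | insert x A hx ih =>
    rw [Finset.prod_insert hx, Derivation.leibniz, Finset.sum_insert hx, Finset.erase_insert hx, ih,
      smul_eq_mul, smul_eq_mul, add_comm, Finset.mul_sum]
    congr 1
    refine Finset.sum_congr rfl fun d hd => ?_
    have hxd : x ≠ d := fun h => hx (h ▸ hd)
    rw [Finset.erase_insert_of_ne hxd, Finset.prod_insert (by simp [hx])]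
    ring

/-- The first step of Wick's theorem: contract one linear form with each of the others. -/
theorem gaussInt_linForm_mul_prod [DecidableEq ι] {a : ι → ℝ} (ha : ∀ p, 0 < a p) {D : Type*} [DecidableEq D]
    (A : Finset D) (u : ι → ℂ) (f : D → ι → ℂ) :
    gaussInt a (linForm u * ∏ d ∈ A, linForm (f d)) =
      ∑ d ∈ A, (∑ p, u p * f d p / (2 * a p)) * gaussInt a (∏ d' ∈ A.erase d, linForm (f d')) := by
  conv_lhs => rw [linForm, Finset.sum_mul, gaussInt_sum ha]
  have h : ∀ p, gaussInt a (MvPolynomial.C (u p) * MvPolynomial.X p * ∏ d ∈ A, linForm (f d)) =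
      ∑ d ∈ A, u p * f d p / (2 * a p) * gaussInt a (∏ d' ∈ A.erase d, linForm (f d')) := by
    intro p
    rw [mul_assoc, gaussInt_C_mul, gaussInt_X_mul ha, pderiv_prod, gaussInt_sum ha, Finset.mul_sum,
      Finset.mul_sum]
    refine Finset.sum_congr rfl fun d _ => ?_
    rw [pderiv_linForm, mul_comm (∏ _ ∈ _, _), gaussInt_C_mul]
    ring
  rw [Finset.sum_congr rfl fun p _ => h p, Finset.sum_comm]
  exact Finset.sum_congr rfl fun d _ => by rw [Finset.sum_mul]

end

/-- The coefficients of the entry `(i, j)` of `hermitianOf x` as a linear form in `x`. -/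
noncomputable def entryCoeff {N : ℕ} (i j : Fin N) : Fin N × Fin N → ℂ :=
  if i = j then Pi.single (i, i) 1
  else if i < j then Pi.single (i, j) 1 + Pi.single (j, i) Complex.I
  else Pi.single (j, i) 1 - Pi.single (i, j) Complex.I

theorem eval_linForm {ι : Type} [Fintype ι] (u : ι → ℂ) (x : ι → ℂ) :
    (linForm u).eval x = ∑ p, u p * x p := by
  simp [linForm]

theorem eval_entryCoeff {N : ℕ} (x : Fin N × Fin N → ℝ) (i j : Fin N) :
    (linForm (entryCoeff i j)).eval (fun p => (x p : ℂ)) = hermitianOf x i j := by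
  rw [eval_linForm, entryCoeff, hermitianOf]
  split_ifs <;>
    simp [add_mul, sub_mul, Finset.sum_add_distrib, Finset.sum_sub_distrib, Pi.single_apply]

/-- The coefficients of the quadratic form `∑ i j, c i j * H i j * H j i` in the real coordinates
of the Hermitian matrix `H`. -/
noncomputable def quadCoeff {N : ℕ} (c : Sym2 (Fin N) → ℝ) (p : Fin N × Fin N) : ℝ :=
  if p.1 = p.2 then c s(p.1, p.2) else 2 * c s(p.1, p.2)

theorem quadForm_hermitianOf {N : ℕ} (c : Sym2 (Fin N) → ℝ) (x : Fin N × Fin N → ℝ) :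
    ∑ i, ∑ j, (c s(i, j) : ℂ) * hermitianOf x i j * hermitianOf x j i =
      ∑ p, quadCoeff c p * (x p : ℂ) ^ 2 := by
  have h1 : ∀ i j : Fin N, (c s(i, j) : ℂ) * hermitianOf x i j * hermitianOf x j i =
      1 / 2 * (quadCoeff c (i, j) * (x (i, j) : ℂ) ^ 2) +
      1 / 2 * (quadCoeff c (j, i) * (x (j, i) : ℂ) ^ 2) := by
    intro i j
    have hI := Complex.I_sq
    rcases lt_trichotomy i j with h | h | h
    · simp only [hermitianOf, quadCoeff, h.ne, h.ne', h, h.not_gt, if_true, if_false,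
        Sym2.eq_swap (a := j) (b := i)]
      push_cast
      linear_combination (-(c s(i, j) : ℂ) * (x (j, i) : ℂ) ^ 2) * hI
    · subst h
      simp only [hermitianOf, quadCoeff, if_true]
      ring
    · simp only [hermitianOf, quadCoeff, h.ne, h.ne', h, h.not_gt, if_true, if_false,
        Sym2.eq_swap (a := j) (b := i)]
      push_cast
      linear_combination (-(c s(i, j) : ℂ) * (x (i, j) : ℂ) ^ 2) * hI
  simp only [h1, Finset.sum_add_distrib]
  rw [Finset.sum_comm (f := fun i j => 1 / 2 * ((quadCoeff c (j, i) : ℂ) * (x (j, i) : ℂ) ^ 2)),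
    Fintype.sum_prod_type, ← Finset.sum_add_distrib]
  refine Finset.sum_congr rfl fun i _ => ?_
  rw [← Finset.sum_add_distrib]
  exact Finset.sum_congr rfl fun j _ => by ring

theorem entryCoeff_eq_zero {N : ℕ} {i j : Fin N} {p : Fin N × Fin N} (h : s(p.1, p.2) ≠ s(i, j)) :
    entryCoeff i j p = 0 := by
  have h1 : p ≠ (i, j) := fun e => h (by rw [e])
  have h2 : p ≠ (j, i) := fun e => h (by rw [e, Sym2.eq_swap])
  unfold entryCoeff
  split_ifs with h3
  · subst h3; simp [h1]
  · simp [h1, h2]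
  · simp [h1, h2]

/-- The propagator: an entry `(i, j)` is only correlated with the entry `(j, i)`. -/
theorem covariance_entryCoeff {N : ℕ} {c : Sym2 (Fin N) → ℝ} (i j k l : Fin N) :
    ∑ p, entryCoeff i j p * entryCoeff k l p / (2 * (quadCoeff c p : ℂ)) =
      if i = l ∧ j = k then 1 / (2 * (c s(i, k) : ℂ)) else 0 := by
  by_cases hs : s(i, j) = s(k, l)
  · have hsum : ∀ f : Fin N × Fin N → ℂ, i ≠ j →
        ∑ p, entryCoeff i j p * f p = entryCoeff i j (i, j) * f (i, j) +
          entryCoeff i j (j, i) * f (j, i) := by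
      intro f hij
      rw [← Finset.sum_pair (f := fun p => entryCoeff i j p * f p)
        (show (i, j) ≠ (j, i) by simp [hij])]
      symm
      refine Finset.sum_subset (Finset.subset_univ _) fun p _ hp => ?_
      rw [entryCoeff_eq_zero, zero_mul]
      intro h
      apply hp
      obtain ⟨a, b⟩ := p
      simpa using h
    have hI : Complex.I * Complex.I = -1 := Complex.I_mul_I
    simp only [mul_div_assoc]
    rcases eq_or_ne i j with rfl | hij
    · have h : k = i ∧ l = i := by
        rw [Sym2.eq_iff] at hs
        rcases hs with h | h
        · exact ⟨h.1.symm, h.2.symm⟩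
        · exact ⟨h.2.symm, h.1.symm⟩
      rw [h.1, h.2, Finset.sum_eq_single (i, i)]
      · simp [entryCoeff, quadCoeff]
      · intro p _ hp
        simp [entryCoeff, hp]
      · simp
    · rw [hsum _ hij]
      rw [Sym2.eq_iff] at hs
      rcases hs with ⟨rfl, rfl⟩ | ⟨rfl, rfl⟩ <;> rcases lt_or_gt_of_ne hij with h | h <;>
        simp [entryCoeff, h.ne, h.ne', h, h.not_gt, quadCoeff, Sym2.eq_swap (a := j) (b := i)]
      all_goals
        rw [← mul_div_assoc]
        simp only [hI, mul_neg]
        ring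
  · rw [if_neg, Finset.sum_eq_zero]
    · intro p _
      by_cases hp : s(p.1, p.2) = s(i, j)
      · rw [entryCoeff_eq_zero (i := k) (by rw [hp]; exact hs), mul_zero, zero_div]
      · rw [entryCoeff_eq_zero hp, zero_mul, zero_div]
    · rintro ⟨rfl, rfl⟩
      exact hs Sym2.eq_swap

/-! ### Pairings -/

/-- The pairings of the set `A`, as involutions with support `A`. -/
def pairings {D : Type} [Fintype D] [DecidableEq D] (A : Finset D) : Finset (Perm D) :=
  Finset.univ.filter fun e => e * e = 1 ∧ e.support = A

/-- The product of the weights `W` over the edges `{d, e d}` in `A`; the ends of the edges carry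
the labels `r`. -/
def edgeProd {D K : Type} [DecidableEq D] (A : Finset D) (e : Perm D) (W : Sym2 K → ℂ)
    (r : D → K) : ℂ :=
  ∏ q ∈ A.image fun d => s(d, e d), W (q.map r)

section
variable {D : Type} [Fintype D] [DecidableEq D]

theorem mem_pairings {A : Finset D} {e : Perm D} :
    e ∈ pairings A ↔ (∀ d, e (e d) = d) ∧ ∀ d, e d ≠ d ↔ d ∈ A := by
  simp [pairings, Perm.ext_iff, Finset.ext_iff]

theorem pairings_empty : pairings (∅ : Finset D) = {1} := by
  ext e
  rw [mem_pairings, Finset.mem_singleton]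
  constructor
  · rintro ⟨-, h⟩
    ext d
    by_contra hd
    simpa using (h d).1 hd
  · rintro rfl
    simp

theorem swap_mul_mem_pairings {A : Finset D} {d₀ d₁ : D} (h₀ : d₀ ∈ A) (h₁ : d₁ ∈ A.erase d₀)
    {e : Perm D} (he : e ∈ pairings ((A.erase d₀).erase d₁)) : swap d₀ d₁ * e ∈ pairings A := by
  rw [mem_pairings] at he ⊢
  obtain ⟨h1, h2⟩ := he
  have hne := Finset.ne_of_mem_erase h₁
  have e0 : e d₀ = d₀ := by by_contra h; simpa using (h2 _).1 h
  have e1 : e d₁ = d₁ := by by_contra h; simpa using (h2 _).1 h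
  have hx : ∀ x, x ≠ d₀ → x ≠ d₁ → e x ≠ d₀ ∧ e x ≠ d₁ := fun x a b =>
    ⟨fun h => a (e.injective (h.trans e0.symm)), fun h => b (e.injective (h.trans e1.symm))⟩
  refine ⟨fun d => ?_, fun d => ?_⟩
  · by_cases a : d = d₀
    · subst a; simp [e0, e1]
    by_cases b : d = d₁
    · subst b; simp [e0, e1]
    simp [swap_apply_of_ne_of_ne (hx d a b).1 (hx d a b).2, h1,
      swap_apply_of_ne_of_ne a b]
  · by_cases a : d = d₀
    · subst a; simp [e0, h₀, hne]
    by_cases b : d = d₁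
    · subst b; simp [e1, Finset.mem_of_mem_erase h₁, hne.symm]
    rw [Perm.mul_apply, swap_apply_of_ne_of_ne (hx d a b).1 (hx d a b).2, h2]
    simp [a, b]

theorem sum_pairings {A : Finset D} {d₀ : D} (h₀ : d₀ ∈ A) (F : Perm D → ℂ) :
    ∑ e ∈ pairings A, F e =
      ∑ d₁ ∈ A.erase d₀, ∑ e ∈ pairings ((A.erase d₀).erase d₁), F (swap d₀ d₁ * e) := by
  rw [Finset.sum_sigma']
  symm
  refine Finset.sum_bij' (fun p _ => swap d₀ p.1 * p.2) (fun e _ => ⟨e d₀, swap d₀ (e d₀) * e⟩)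
    ?_ ?_ ?_ ?_ ?_
  · rintro ⟨d₁, e⟩ h
    rw [Finset.mem_sigma] at h
    exact swap_mul_mem_pairings h₀ h.1 h.2
  · intro e he
    rw [mem_pairings] at he
    rw [Finset.mem_sigma, mem_pairings]
    have hne : e d₀ ≠ d₀ := (he.2 _).2 h₀
    refine ⟨Finset.mem_erase.2 ⟨hne, (he.2 _).1 (by rw [he.1]; exact hne.symm)⟩, ?_, ?_⟩
    all_goals
      intro d
      dsimp only
      by_cases a : d = d₀
      · subst a; simp
      by_cases b : d = e d₀
      · subst b; simp [he.1]
      have h1 : e d ≠ d₀ := fun h => b (by rw [← h, he.1])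
      have h2 : e d ≠ e d₀ := fun h => a (e.injective h)
      simp [swap_apply_of_ne_of_ne h1 h2, he.1, swap_apply_of_ne_of_ne a b, a, b, ← he.2 d]
  · rintro ⟨d₁, e⟩ h
    rw [Finset.mem_sigma, mem_pairings] at h
    have e0 : e d₀ = d₀ := by by_contra h'; simpa using (h.2.2 _).1 h'
    simp [e0]
  · intro e he
    simp
  · intro p _
    rfl

theorem edgeProd_swap_mul {K : Type} {A : Finset D} {d₀ d₁ : D} (h₀ : d₀ ∈ A)
    (h₁ : d₁ ∈ A.erase d₀) {e : Perm D} (he : e ∈ pairings ((A.erase d₀).erase d₁))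
    (W : Sym2 K → ℂ) (r : D → K) :
    edgeProd A (swap d₀ d₁ * e) W r =
      W s(r d₀, r d₁) * edgeProd ((A.erase d₀).erase d₁) e W r := by
  have h := swap_mul_mem_pairings h₀ h₁ he
  rw [mem_pairings] at he
  have e0 : e d₀ = d₀ := by by_contra h'; simpa using (he.2 _).1 h'
  have e1 : e d₁ = d₁ := by by_contra h'; simpa using (he.2 _).1 h'
  have hA : A = insert d₀ (insert d₁ ((A.erase d₀).erase d₁)) := by
    rw [Finset.insert_erase h₁, Finset.insert_erase h₀]
  have him : A.image (fun d => s(d, (swap d₀ d₁ * e) d)) =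
      insert s(d₀, d₁) (((A.erase d₀).erase d₁).image fun d => s(d, e d)) := by
    conv_lhs => rw [hA]
    rw [Finset.image_insert, Finset.image_insert]
    simp only [Perm.mul_apply, e0, e1, swap_apply_left, swap_apply_right]
    rw [Sym2.eq_swap (a := d₁), Finset.insert_idem]
    congr 1
    refine Finset.image_congr fun d hd => ?_
    have hd' : d ≠ d₁ ∧ d ≠ d₀ ∧ d ∈ A := by
      simpa only [Finset.mem_coe, Finset.mem_erase] using hd
    have h1 : e d ≠ d₀ := fun h => hd'.2.1 (e.injective (h.trans e0.symm))
    have h2 : e d ≠ d₁ := fun h => hd'.1 (e.injective (h.trans e1.symm))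
    simp [swap_apply_of_ne_of_ne h1 h2]
  unfold edgeProd
  rw [him, Finset.prod_insert]
  · rfl
  · intro hm
    obtain ⟨d, hd, hd'⟩ := Finset.mem_image.1 hm
    rw [Sym2.eq_iff] at hd'
    have hd2 : d ≠ d₁ ∧ d ≠ d₀ ∧ d ∈ A := by simpa using hd
    rcases hd' with h | h
    · exact hd2.2.1 h.1
    · exact hd2.1 h.1

/-- **Wick's theorem** for the entries of a Hermitian matrix. -/
theorem gaussInt_prod_entries {N : ℕ} {c : Sym2 (Fin N) → ℝ} (hc : ∀ q, 0 < c q)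
    (r t : D → Fin N) (A : Finset D) :
    gaussInt (quadCoeff c) (∏ d ∈ A, linForm (entryCoeff (r d) (t d))) =
      (∑ e ∈ pairings A, (∏ d ∈ A, if r d = t (e d) then 1 else 0) *
        edgeProd A e (fun q => 1 / (2 * (c q : ℂ))) r) * gaussInt (quadCoeff c) 1 := by
  have ha : ∀ p, 0 < quadCoeff c p := fun p => by
    unfold quadCoeff
    split_ifs
    · exact hc _
    · linarith [hc s(p.1, p.2)]
  induction hn : A.card using Nat.strong_induction_on generalizing A with
  | _ n ih =>
  rcases A.eq_empty_or_nonempty with rfl | ⟨d₀, h₀⟩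
  · simp [pairings_empty, edgeProd]
  · rw [← Finset.mul_prod_erase _ _ h₀, gaussInt_linForm_mul_prod ha, sum_pairings h₀, Finset.sum_mul]
    refine Finset.sum_congr rfl fun d₁ h₁ => ?_
    rw [ih _ _ _ rfl, ← mul_assoc, covariance_entryCoeff, Finset.mul_sum]
    · congr 1
      refine Finset.sum_congr rfl fun e he => ?_
      rw [edgeProd_swap_mul h₀ h₁ he, ← Finset.mul_prod_erase _ _ h₀, ← Finset.mul_prod_erase _ _ h₁]
      have he' := mem_pairings.1 he
      have e0 : e d₀ = d₀ := by by_contra h'; simpa using (he'.2 _).1 h'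
      have e1 : e d₁ = d₁ := by by_contra h'; simpa using (he'.2 _).1 h'
      have hp : ∏ d ∈ (A.erase d₀).erase d₁, (if r d = t ((swap d₀ d₁ * e) d) then (1 : ℂ) else 0) =
          ∏ d ∈ (A.erase d₀).erase d₁, if r d = t (e d) then (1 : ℂ) else 0 := by
        refine Finset.prod_congr rfl fun d hd => ?_
        have hd' : d ≠ d₁ ∧ d ≠ d₀ ∧ d ∈ A := by simpa using hd
        have h1 : e d ≠ d₀ := fun h => hd'.2.1 (e.injective (h.trans e0.symm))
        have h2 : e d ≠ d₁ := fun h => hd'.1 (e.injective (h.trans e1.symm))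
        simp [swap_apply_of_ne_of_ne h1 h2]
      rw [hp]
      simp only [Perm.mul_apply, e0, e1, swap_apply_left, swap_apply_right]
      by_cases a : r d₀ = t d₁ <;> by_cases b : r d₁ = t d₀ <;> simp [a, b, eq_comm]
      ring
    · rw [← hn]
      exact (Finset.card_erase_lt_of_mem h₁).trans (Finset.card_erase_lt_of_mem h₀)

/-- **Wick's theorem** for averages over Hermitian matrices of polynomials in the entries. -/
theorem hermitianAverage_sum_prod {N : ℕ} {c : Sym2 (Fin N) → ℝ} (hc : ∀ q, 0 < c q)
    (Q P : Matrix (Fin N) (Fin N) ℂ → ℂ)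
    (hQ : ∀ H, Q H = ∑ i, ∑ j, (c s(i, j) : ℂ) * H i j * H j i)
    {κ : Type} (S : Finset κ) (b : κ → ℂ) (r t : κ → D → Fin N) (A : Finset D)
    (hP : ∀ H, P H = ∑ k ∈ S, b k * ∏ d ∈ A, H (r k d) (t k d)) :
    hermitianAverage N Q P = ∑ k ∈ S, b k * ∑ e ∈ pairings A,
      (∏ d ∈ A, if r k d = t k (e d) then 1 else 0) *
        edgeProd A e (fun q => 1 / (2 * (c q : ℂ))) (r k) := by
  have ha : ∀ p, 0 < quadCoeff c p := fun p => by
    unfold quadCoeff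
    split_ifs
    · exact hc _
    · linarith [hc s(p.1, p.2)]
  have h1 : (∫ x : Fin N × Fin N → ℝ, Complex.exp (-Q (hermitianOf x))) =
      gaussInt (quadCoeff c) 1 := by
    unfold gaussInt
    simp only [hQ, quadForm_hermitianOf, map_one, one_mul]
  have h2 : (∫ x : Fin N × Fin N → ℝ, P (hermitianOf x) * Complex.exp (-Q (hermitianOf x))) =
      gaussInt (quadCoeff c) (∑ k ∈ S, MvPolynomial.C (b k) *
        ∏ d ∈ A, linForm (entryCoeff (r k d) (t k d))) := by
    unfold gaussInt
    simp only [hQ, quadForm_hermitianOf, hP, map_sum, map_mul, map_prod, eval_entryCoeff,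
      MvPolynomial.eval_C]
  unfold hermitianAverage
  rw [h1, h2, gaussInt_sum ha, div_eq_iff (gaussInt_one_ne_zero ha), Finset.sum_mul]
  refine Finset.sum_congr rfl fun k _ => ?_
  rw [gaussInt_C_mul, gaussInt_prod_entries hc, mul_assoc]

end

/-! ### Cycles and invariant functions -/

section
variable {D D' : Type}

/-- The number of cycles of a permutation, fixed points included. -/
noncomputable def cyc (σ : Perm D) : ℕ := Nat.card (Quotient (Perm.SameCycle.setoid σ))

theorem apply_eq_of_sameCycle {K : Type*} {σ : Perm D} {f : D → K} (hf : ∀ x, f (σ x) = f x)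
    {x y : D} (h : σ.SameCycle x y) : f x = f y := by
  obtain ⟨n, rfl⟩ := h
  have h1 : ∀ (n : ℕ) x, f ((σ ^ n) x) = f x := by
    intro n
    induction n with
    | zero => simp
    | succ n ih => intro x; rw [pow_succ, Perm.mul_apply, ih, hf]
  rcases n with n | n
  · rw [Int.ofNat_eq_natCast, zpow_natCast, h1]
  · rw [zpow_negSucc]
    conv_lhs => rw [← show (σ ^ (n + 1)) ((σ ^ (n + 1))⁻¹ x) = x from (σ ^ (n + 1)).apply_symm_apply x, h1]

/-- Two points are in the same cycle as soon as they are not separated by an invariant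
predicate. -/
theorem sameCycle_of_forall_invariant {σ : Perm D} {x y : D}
    (h : ∀ f : D → Prop, (∀ z, f (σ z) = f z) → f x = f y) : σ.SameCycle x y := by
  have := h (fun z => σ.SameCycle x z) (fun z => by simp)
  rw [← this]

/-- Functions invariant under `σ` are functions on the set of cycles of `σ`. -/
def invariantEquiv (σ : Perm D) (K : Type*) :
    {f : D → K // ∀ x, f (σ x) = f x} ≃ (Quotient (Perm.SameCycle.setoid σ) → K) where
  toFun f := Quotient.lift f.1 fun _ _ h => apply_eq_of_sameCycle f.2 h
  invFun g := ⟨fun x => g (Quotient.mk _ x), fun x => by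
    exact congrArg g (Quotient.sound (s := Perm.SameCycle.setoid σ)
      (show σ.SameCycle (σ x) x by rw [Perm.sameCycle_apply_left]))⟩
  left_inv f := rfl
  right_inv g := by
    funext q
    induction q using Quotient.ind
    rfl

theorem natCard_invariant [Finite D] (σ : Perm D) (K : Type*) [Finite K] :
    Nat.card {f : D → K // ∀ x, f (σ x) = f x} = Nat.card K ^ cyc σ := by
  rw [Nat.card_congr (invariantEquiv σ K), Nat.card_fun]
  rfl

theorem cyc_eq_of_invariant [Finite D] [Finite D'] {σ : Perm D} {σ' : Perm D'} {n : ℕ}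
    (h : Nat.card {f : D → Bool // ∀ x, f (σ x) = f x} =
      2 ^ n * Nat.card {f : D' → Bool // ∀ x, f (σ' x) = f x}) : cyc σ = n + cyc σ' := by
  rw [natCard_invariant, natCard_invariant, Nat.card_eq_fintype_card, Fintype.card_bool,
    ← pow_add] at h
  exact Nat.pow_right_injective le_rfl h

theorem cyc_congr [Finite D] [Finite D'] {σ : Perm D} {σ' : Perm D'} (π : D ≃ D')
    (h : ∀ x, π (σ x) = σ' (π x)) : cyc σ = cyc σ' := by
  rw [← zero_add (cyc σ')]
  refine cyc_eq_of_invariant ?_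
  rw [pow_zero, one_mul]
  refine Nat.card_congr ((π.arrowCongr (Equiv.refl _)).subtypeEquiv fun f => ?_)
  constructor
  · intro hf x
    obtain ⟨x, rfl⟩ := π.surjective x
    simp [← h, hf]
  · intro hf x
    have := hf (π x)
    simpa [← h] using this

theorem card_filter_invariant [Fintype D] [DecidableEq D] (σ : Perm D) (N : ℕ) :
    (∑ f : D → Fin N, if ∀ x, f (σ x) = f x then (1 : ℂ) else 0) = (N : ℂ) ^ cyc σ := by
  rw [Finset.sum_boole, ← Fintype.card_subtype, ← Nat.card_eq_fintype_card, natCard_invariant]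
  simp

/-- A pairing of `A` has half as many edges as `A` has elements. -/
theorem two_mul_card_edges [Fintype D] [DecidableEq D] {A : Finset D} {e : Perm D}
    (he : e ∈ pairings A) : (A.image fun d => s(d, e d)).card * 2 = A.card := by
  rw [mem_pairings] at he
  rw [Finset.card_eq_sum_card_image (fun d => s(d, e d)) A, Finset.sum_const_nat]
  intro q hq
  obtain ⟨d, hd, rfl⟩ := Finset.mem_image.1 hq
  have hed : e d ≠ d := (he.2 d).2 hd
  have : A.filter (fun x => s(x, e x) = s(d, e d)) = {d, e d} := by
    ext x
    simp only [Finset.mem_filter, Finset.mem_insert, Finset.mem_singleton, Sym2.eq_iff]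
    constructor
    · rintro ⟨-, h | h⟩
      · exact Or.inl h.1
      · exact Or.inr h.1
    · rintro (rfl | rfl)
      · exact ⟨hd, Or.inl ⟨rfl, rfl⟩⟩
      · exact ⟨(he.2 _).1 (by rw [he.1]; exact hed.symm), Or.inr ⟨rfl, he.1 _⟩⟩
  rw [this, Finset.card_pair hed.symm]

end

/-! ### Traces of powers as sums over index functions -/

theorem sum_prod_mul_eq_trace {N : ℕ} (G : Matrix (Fin N) (Fin N) ℂ) (n : ℕ)
    (M : Matrix (Fin N) (Fin N) ℂ) :
    ∑ f : Fin (n + 1) → Fin N, (∏ j : Fin n, G (f j.castSucc) (f j.succ)) *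
      M (f (Fin.last n)) (f 0) = (G ^ n * M).trace := by
  induction n generalizing M with
  | zero =>
    rw [← (Equiv.funUnique (Fin 1) (Fin N)).symm.sum_comp]
    simp [Matrix.trace]
  | succ n ih =>
    rw [← (Fin.consEquiv fun _ => Fin N).sum_comp, Fintype.sum_prod_type, Finset.sum_comm]
    have h := ih (M * G)
    rw [← mul_assoc, Matrix.trace_mul_comm, ← mul_assoc, ← pow_succ'] at h
    rw [← h]
    refine Finset.sum_congr rfl fun f _ => ?_
    rw [Matrix.mul_apply, Finset.mul_sum]
    refine Finset.sum_congr rfl fun a _ => ?_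
    rw [Fin.prod_univ_succ]
    simp only [Fin.consEquiv_apply, Fin.castSucc_zero, Fin.cons_zero, Fin.cons_succ,
      ← Fin.succ_castSucc, ← Fin.succ_last]
    ring

theorem sum_prod_finRotate {N : ℕ} (G : Matrix (Fin N) (Fin N) ℂ) {n : ℕ} (hn : n ≠ 0) :
    ∑ f : Fin n → Fin N, ∏ j, G (f j) (f (finRotate n j)) = (G ^ n).trace := by
  obtain ⟨n, rfl⟩ := Nat.exists_eq_succ_of_ne_zero hn
  rw [Nat.succ_eq_add_one, pow_succ, ← sum_prod_mul_eq_trace]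
  refine Finset.sum_congr rfl fun f _ => ?_
  rw [Fin.prod_univ_castSucc, finRotate_last]
  congr 1
  exact Finset.prod_congr rfl fun j _ => by rw [finRotate_apply, Fin.coeSucc_eq_succ]

section
variable {s : ℕ}

/-- The half-edges at `s` vertices of valences `k i`. -/
abbrev HalfEdge (k : Fin s → ℕ) : Type := Σ i, Fin (k i)

/-- The cyclic rotation of the half-edges around each vertex. -/
def rot (k : Fin s → ℕ) : Perm (HalfEdge k) := Perm.sigmaCongrRight fun i => finRotate (k i)

theorem rot_fst (k : Fin s → ℕ) (d : HalfEdge k) : (rot k d).1 = d.1 := rfl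

/-- The half-edges at the vertices in `I`. -/
def blockSet (k : Fin s → ℕ) (I : Finset (Fin s)) : Finset (HalfEdge k) :=
  Finset.univ.filter fun d => d.1 ∈ I

theorem mem_blockSet {k : Fin s → ℕ} {I : Finset (Fin s)} {d : HalfEdge k} :
    d ∈ blockSet k I ↔ d.1 ∈ I := by simp [blockSet]

theorem card_blockSet (k : Fin s → ℕ) (I : Finset (Fin s)) :
    (blockSet k I).card = ∑ i ∈ I, k i := by
  have : blockSet k I = I.sigma fun _ => Finset.univ := by
    ext d; simp [blockSet]
  rw [this, Finset.card_sigma]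
  simp

theorem sameCycle_finRotate {n : ℕ} (x y : Fin n) : (finRotate n).SameCycle x y := by
  rcases n with _ | _ | n
  · exact x.elim0
  · rw [show x = y by omega]
  · refine (isCycle_finRotate (n := n)).sameCycle ?_ ?_ <;>
    · rw [← Perm.mem_support, support_finRotate]
      exact Finset.mem_univ _

theorem sameCycle_rot_iff {k : Fin s → ℕ} {x y : HalfEdge k} :
    (rot k).SameCycle x y ↔ x.1 = y.1 := by
  constructor
  · exact apply_eq_of_sameCycle (f := Sigma.fst) fun d => rot_fst k d
  · obtain ⟨i, x⟩ := x
    obtain ⟨j, y⟩ := y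
    rintro (rfl : i = j)
    refine sameCycle_of_forall_invariant fun f hf => ?_
    exact apply_eq_of_sameCycle (f := fun x => f ⟨i, x⟩) (σ := finRotate (k i))
      (fun z => hf ⟨i, z⟩) (sameCycle_finRotate x y)

theorem cyc_rot (k : Fin s → ℕ) : cyc (rot k) = (Finset.univ.filter fun i => k i ≠ 0).card := by
  rw [cyc, ← Fintype.card_subtype, ← Nat.card_eq_fintype_card]
  refine Nat.card_congr (Equiv.ofBijective (Quotient.lift
    (fun d : HalfEdge k => (⟨d.1, fun h => (Fin.cast h d.2).elim0⟩ : {i // k i ≠ 0}))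
    fun x y h => Subtype.ext (sameCycle_rot_iff.1 h)) ⟨fun a b => ?_, fun i => ?_⟩)
  · induction a using Quotient.ind
    induction b using Quotient.ind
    intro h
    exact Quotient.sound (sameCycle_rot_iff.2 (congrArg Subtype.val h))
  · exact ⟨Quotient.mk _ ⟨i.1, ⟨0, Nat.pos_of_ne_zero i.2⟩⟩, rfl⟩

theorem sum_prod_rot {N : ℕ} (k : Fin s → ℕ) (G : Fin s → Matrix (Fin N) (Fin N) ℂ) :
    ∑ f : HalfEdge k → Fin N, ∏ d, G d.1 (f d) (f (rot k d)) =
      ∏ i, if k i = 0 then 1 else (G i ^ k i).trace := by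
  rw [← (Equiv.piCurry fun (i : Fin s) (_ : Fin (k i)) => Fin N).symm.sum_comp]
  simp only [Fintype.prod_sigma]
  have h : ∀ i, (if k i = 0 then 1 else (G i ^ k i).trace) =
      ∑ f : Fin (k i) → Fin N, ∏ j, G i (f j) (f (finRotate (k i) j)) := by
    intro i
    split_ifs with h0
    · have : IsEmpty (Fin (k i)) := by rw [h0]; infer_instance
      simp
    · rw [sum_prod_finRotate _ h0]
  rw [Finset.prod_congr rfl fun i _ => h i, Finset.prod_univ_sum, Fintype.piFinset_univ]
  rfl

/-- A product of traces as a sum over index functions on all half-edges; the indices at the vertices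
outside `I` are forced to be constant along the rotation, which is compensated by a power of `N`. -/
theorem prod_trace_eq {N : ℕ} (hN : 1 ≤ N) (k : Fin s → ℕ) (I : Finset (Fin s))
    (H : Matrix (Fin N) (Fin N) ℂ) :
    ∏ i ∈ I, (H ^ k i).trace = (N : ℂ) ^ ((I.card : ℤ) - cyc (rot k)) *
      ∑ f : HalfEdge k → Fin N, (∏ d ∈ (blockSet k I)ᶜ, if f d = f (rot k d) then 1 else 0) *
        ∏ d ∈ blockSet k I, H (f d) (f (rot k d)) := by
  have hN' : (N : ℂ) ≠ 0 := by exact_mod_cast (by omega : N ≠ 0)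
  have h := sum_prod_rot k (fun i => if i ∈ I then H else 1)
  have h1 : ∀ f : HalfEdge k → Fin N,
      ∏ d, (if d.1 ∈ I then H else 1) (f d) (f (rot k d)) =
      (∏ d ∈ (blockSet k I)ᶜ, if f d = f (rot k d) then 1 else 0) *
        ∏ d ∈ blockSet k I, H (f d) (f (rot k d)) := by
    intro f
    rw [← Finset.prod_compl_mul_prod (blockSet k I)]
    congr 1
    · refine Finset.prod_congr rfl fun d hd => ?_
      rw [Finset.mem_compl, mem_blockSet] at hd
      rw [if_neg hd, Matrix.one_apply]
    · refine Finset.prod_congr rfl fun d hd => ?_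
      rw [mem_blockSet] at hd
      rw [if_pos hd]
  simp only [h1] at h
  rw [h, ← Finset.prod_compl_mul_prod I]
  have h2 : ∏ i ∈ Iᶜ, (if k i = 0 then (1 : ℂ) else ((if i ∈ I then H else 1) ^ k i).trace) =
      (N : ℂ) ^ (Iᶜ.filter fun i => k i ≠ 0).card := by
    rw [Finset.card_filter, ← Finset.prod_pow_eq_pow_sum]
    refine Finset.prod_congr rfl fun i hi => ?_
    rw [Finset.mem_compl] at hi
    by_cases h0 : k i = 0 <;> simp [h0, hi]
  have h3 : ∏ i ∈ I, (H ^ k i).trace = (∏ i ∈ I, (if k i = 0 then (1 : ℂ) else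
      ((if i ∈ I then H else 1) ^ k i).trace)) * (N : ℂ) ^ (I.filter fun i => k i = 0).card := by
    rw [Finset.card_filter, ← Finset.prod_pow_eq_pow_sum, ← Finset.prod_mul_distrib]
    refine Finset.prod_congr rfl fun i hi => ?_
    by_cases h0 : k i = 0 <;> simp [h0, hi]
  have h4 : (I.card : ℤ) - cyc (rot k) + (Iᶜ.filter fun i => k i ≠ 0).card =
      (I.filter fun i => k i = 0).card := by
    have a1 := Finset.card_filter_add_card_filter_not (s := I) (fun i => k i = 0)
    have a2 : cyc (rot k) = (Iᶜ.filter fun i => k i ≠ 0).card + (I.filter fun i => k i ≠ 0).card := by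
      rw [cyc_rot, ← Finset.card_union_of_disjoint, ← Finset.filter_union]
      · rw [Finset.union_comm, Finset.union_compl]
      · exact Finset.disjoint_filter_filter (disjoint_compl_left)
    simp only [ne_eq] at a2 ⊢
    omega
  rw [h3, h2, ← mul_assoc, ← zpow_natCast, ← zpow_natCast, ← zpow_add₀ hN', h4]
  ring

/-- The mean of a product of traces is a sum over the pairings of the half-edges. -/
theorem traceMean_eq {N : ℕ} (hN : 1 ≤ N) (k : Fin s → ℕ) (I : Finset (Fin s)) :
    traceMean N k I = ∑ e ∈ pairings (blockSet k I),
      (N : ℂ) ^ ((I.card : ℤ) - cyc (rot k) + cyc (rot k * e) - ((blockSet k I).card / 2 : ℕ)) := by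
  have hN' : (N : ℂ) ≠ 0 := by exact_mod_cast (by omega : N ≠ 0)
  have hNr : (0 : ℝ) < N := by exact_mod_cast hN
  unfold traceMean
  rw [hermitianAverage_sum_prod (c := fun _ => (N : ℝ) / 2) (fun _ => by positivity) _ _ ?_
    Finset.univ (fun f : HalfEdge k → Fin N => (N : ℂ) ^ ((I.card : ℤ) - cyc (rot k)) *
      ∏ d ∈ (blockSet k I)ᶜ, if f d = f (rot k d) then 1 else 0)
    (fun f d => f d) (fun f d => f (rot k d)) (blockSet k I)]
  · simp only [Finset.mul_sum]
    rw [Finset.sum_comm]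
    refine Finset.sum_congr rfl fun e he => ?_
    have hc := two_mul_card_edges he
    have hE : ∀ f : HalfEdge k → Fin N,
        edgeProd (blockSet k I) e (fun _ => 1 / (2 * (((N : ℝ) / 2 : ℝ) : ℂ))) f =
        (N : ℂ) ^ (-(((blockSet k I).card / 2 : ℕ) : ℤ)) := by
      intro f
      rw [edgeProd, Finset.prod_const, ← hc, Nat.mul_div_cancel _ two_pos, zpow_neg, zpow_natCast,
        ← inv_pow]
      congr 1
      push_cast
      field_simp
    simp only [hE]
    rw [mem_pairings] at he
    rw [sub_eq_add_neg _ (((blockSet k I).card / 2 : ℕ) : ℤ), zpow_add₀ hN', zpow_add₀ hN',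
      zpow_natCast _ (cyc (rot k * e)), ← card_filter_invariant, Finset.mul_sum, Finset.sum_mul]
    refine Finset.sum_congr rfl fun f _ => ?_
    rw [← mul_assoc, mul_assoc (_ ^ _)]
    congr 2
    have h1 : ∏ d ∈ (blockSet k I)ᶜ, (if f d = f (rot k d) then (1 : ℂ) else 0) =
        ∏ d ∈ (blockSet k I)ᶜ, (if f d = f (rot k (e d)) then (1 : ℂ) else 0) := by
      refine Finset.prod_congr rfl fun d hd => ?_
      have : e d = d := by
        by_contra h
        exact Finset.mem_compl.1 hd ((he.2 d).1 h)
      rw [this]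
    rw [h1, Finset.prod_compl_mul_prod, Finset.prod_boole]
    simp [eq_comm]
  · intro H
    rw [prod_trace_eq hN, Finset.mul_sum]
    exact Finset.sum_congr rfl fun f _ => by rw [mul_assoc]
  · intro H
    simp only [pow_two, Matrix.trace, Matrix.diag, Matrix.mul_apply, Finset.mul_sum]
    refine Finset.sum_congr rfl fun i _ => Finset.sum_congr rfl fun j _ => ?_
    push_cast
    ring

end

/-! ### Connected parts from a recursion on one component -/

section
variable {ι : Type} [DecidableEq ι]

/-- Sorting the partitions of `I` by the block of a given element. -/
theorem sum_finpartition (C : Finset ι → ℂ) {I : Finset ι} {i₀ : ι} (h₀ : i₀ ∈ I) :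
    ∑ π : Finpartition I, ∏ B ∈ π.parts, C B =
      ∑ B ∈ I.powerset.filter (i₀ ∈ ·), C B * ∑ π : Finpartition (I \ B), ∏ A ∈ π.parts, C A := by
  simp only [Finset.mul_sum]
  rw [Finset.sum_sigma']
  symm
  have hB : ∀ B : Finset ι, B ∈ I.powerset.filter (i₀ ∈ ·) → B ≠ ⊥ ∧ I \ B ⊔ B = I := by
    intro B h
    rw [Finset.mem_filter, Finset.mem_powerset] at h
    exact ⟨Finset.ne_empty_of_mem h.2, Finset.sdiff_union_of_subset h.1⟩
  have hnot : ∀ (B : Finset ι) (π : Finpartition (I \ B)), i₀ ∈ B → ∀ A ∈ π.parts, i₀ ∉ A := by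
    intro B π h A hA hi
    exact (Finset.mem_sdiff.1 (π.le hA hi)).2 h
  refine Finset.sum_bij (fun p hp => p.2.extend (hB p.1 (Finset.mem_sigma.1 hp).1).1
    Finset.sdiff_disjoint (hB p.1 (Finset.mem_sigma.1 hp).1).2) ?_ ?_ ?_ ?_
  · intro _ _
    exact Finset.mem_univ _
  · rintro ⟨B, π⟩ h ⟨B', π'⟩ h' he
    have hi : i₀ ∈ B := (Finset.mem_filter.1 (Finset.mem_sigma.1 h).1).2
    have hi' : i₀ ∈ B' := (Finset.mem_filter.1 (Finset.mem_sigma.1 h').1).2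
    have he' : insert B π.parts = insert B' π'.parts := congrArg Finpartition.parts he
    have hBB : B = B' := by
      have : B ∈ insert B' π'.parts := he' ▸ Finset.mem_insert_self _ _
      rcases Finset.mem_insert.1 this with h | h
      · exact h
      · exact absurd hi (hnot _ _ hi' _ h)
    subst hBB
    have : π = π' := by
      ext1
      rw [← Finset.erase_insert (s := π.parts) (fun h => hnot _ _ hi _ h hi),
        ← Finset.erase_insert (s := π'.parts) (fun h => hnot _ _ hi _ h hi), he']
    rw [this]
  · intro π _
    obtain ⟨B, hBp, hi⟩ := π.exists_mem h₀
    have hsup : (π.parts.erase B).sup id = I \ B := by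
      ext x
      rw [Finset.mem_sup, Finset.mem_sdiff]
      constructor
      · rintro ⟨A, hA, hx⟩
        have hA' := Finset.mem_erase.1 hA
        exact ⟨π.le hA'.2 hx, fun hxB =>
          hA'.1 (π.eq_of_mem_parts hA'.2 hBp hx hxB)⟩
      · rintro ⟨hx, hxB⟩
        obtain ⟨A, hA, hxA⟩ := π.exists_mem hx
        exact ⟨A, Finset.mem_erase.2 ⟨fun h => hxB (h ▸ hxA), hA⟩, hxA⟩
    refine ⟨⟨B, π.ofSubset (Finset.erase_subset B π.parts) hsup⟩, ?_, ?_⟩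
    · simp only [Finset.mem_sigma, Finset.mem_filter, Finset.mem_powerset, Finset.mem_univ, and_true]
      exact ⟨π.le hBp, hi⟩
    · ext1
      exact Finset.insert_erase hBp
  · rintro ⟨B, π⟩ h
    have hi : i₀ ∈ B := (Finset.mem_filter.1 (Finset.mem_sigma.1 h).1).2
    exact (Finset.prod_insert (fun h => hnot _ _ hi _ h hi)).symm

/-- A family `C` satisfying the recursion on the component of an element is the family of
connected parts. -/
theorem connectedPart_eq_of_recursion (M C : Finset ι → ℂ) (h0 : M ∅ = 1)
    (h : ∀ (I : Finset ι) (i₀ : ι), i₀ ∈ I →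
      M I = ∑ B ∈ I.powerset.filter (i₀ ∈ ·), C B * M (I \ B)) (I : Finset ι) (hI : I.Nonempty) :
    connectedPart M I = C I := by
  have h1 : ∀ I : Finset ι, M I = ∑ π : Finpartition I, ∏ B ∈ π.parts, C B := by
    intro I
    induction I using Finset.strongInduction with
    | _ I ih =>
    rcases I.eq_empty_or_nonempty with rfl | ⟨i₀, h₀⟩
    · have : ∀ π : Finpartition (∅ : Finset ι), π.parts = ∅ := fun π =>
        (Finpartition.parts_eq_empty_iff).2 rfl
      rw [h0, Finset.sum_congr rfl fun π _ => by rw [this π, Finset.prod_empty]]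
      have hc : Fintype.card (Finpartition (∅ : Finset ι)) = 1 := by
        rw [Fintype.card_eq_one_iff]
        exact ⟨⊥, fun π => by ext1; rw [this, this]⟩
      simp [hc]
    · rw [sum_finpartition C h₀, h I i₀ h₀]
      refine Finset.sum_congr rfl fun B hB => ?_
      rw [Finset.mem_filter, Finset.mem_powerset] at hB
      rw [ih (I \ B) (Finset.sdiff_ssubset hB.1 ⟨_, hB.2⟩)]
  induction I using Finset.strongInduction with
  | _ I ih =>
  have h2 := sum_prod_connectedPart M I hI
  rw [h1] at h2
  rw [← Finset.add_sum_erase _ _ (Finset.mem_univ (Finpartition.indiscrete hI.ne_empty)),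
    ← Finset.add_sum_erase _ _ (Finset.mem_univ (Finpartition.indiscrete hI.ne_empty))] at h2
  simp only [Finpartition.indiscrete_parts, Finset.prod_singleton] at h2
  have h3 : ∑ π ∈ Finset.univ.erase (Finpartition.indiscrete hI.ne_empty), ∏ B ∈ π.parts, C B =
      ∑ π ∈ Finset.univ.erase (Finpartition.indiscrete hI.ne_empty),
        ∏ B ∈ π.parts, connectedPart M B := by
    refine Finset.sum_congr rfl fun π hπ => Finset.prod_congr rfl fun B hB => ?_
    refine (ih B ((π.le hB).ssubset_of_ne fun hBI => Finset.ne_of_mem_erase hπ ?_)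
      (π.nonempty_of_mem_parts hB)).symm
    subst hBI
    ext1
    refine Finset.eq_singleton_iff_unique_mem.2 ⟨hB, fun A hA => ?_⟩
    obtain ⟨x, hx⟩ := π.nonempty_of_mem_parts hA
    exact π.eq_of_mem_parts hA hB hx (π.le hA hx)
  rw [h3] at h2
  linear_combination -h2

end

/-! ### Multiplicativity of the number of faces -/

section
variable {D : Type}

/-- Exchange of the values of two functions outside `p`. -/
theorem mix_invariant {K : Type} {p : D → Prop} [DecidablePred p] {τ τ' τ'' : Perm D} {f g : D → K}
    (hf : ∀ x, f (τ x) = f x) (hg : ∀ x, g (τ' x) = g x) (hp : ∀ x, p (τ'' x) ↔ p x)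
    (h : ∀ x, p x → τ'' x = τ x) (h' : ∀ x, ¬ p x → τ'' x = τ' x) (x : D) :
    (if p (τ'' x) then f (τ'' x) else g (τ'' x)) = if p x then f x else g x := by
  simp only [hp]
  split_ifs with hx
  · rw [h x hx, hf]
  · rw [h' x hx, hg]

/-- The faces of a disjoint union: `e₁` is supported on the part `p`, and `e₂` on its complement. The
invariant functions with two values are counted on both sides. -/
theorem cyc_mul_add [Finite D] (p : D → Prop) {σ e₁ e₂ : Perm D} (hσ : ∀ x, p (σ x) ↔ p x)
    (h₁ : ∀ x, p (e₁ x) ↔ p x) (h₂ : ∀ x, p (e₂ x) ↔ p x) (h₁' : ∀ x, ¬ p x → e₁ x = x)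
    (h₂' : ∀ x, p x → e₂ x = x) :
    cyc (σ * (e₁ * e₂)) + cyc σ = cyc (σ * e₁) + cyc (σ * e₂) := by
  classical
  have key : Nat.card ({f : D → Bool // ∀ x, f ((σ * (e₁ * e₂)) x) = f x} ×
        {f : D → Bool // ∀ x, f (σ x) = f x}) =
      Nat.card ({f : D → Bool // ∀ x, f ((σ * e₁) x) = f x} ×
        {f : D → Bool // ∀ x, f ((σ * e₂) x) = f x}) := by
    have a1 : ∀ x, p x → (σ * (e₁ * e₂)) x = (σ * e₁) x := fun x hx => by simp [h₂' x hx]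
    have a2 : ∀ x, ¬ p x → (σ * (e₁ * e₂)) x = (σ * e₂) x := fun x hx => by
      simp [h₁' (e₂ x) (fun h => hx ((h₂ x).1 h))]
    have a3 : ∀ x, p x → σ x = (σ * e₂) x := fun x hx => by simp [h₂' x hx]
    have a4 : ∀ x, ¬ p x → σ x = (σ * e₁) x := fun x hx => by simp [h₁' x hx]
    have b1 : ∀ x, p ((σ * e₁) x) ↔ p x := fun x => by simp [hσ, h₁]
    have b2 : ∀ x, p ((σ * e₂) x) ↔ p x := fun x => by simp [hσ, h₂]
    have b3 : ∀ x, p ((σ * (e₁ * e₂)) x) ↔ p x := fun x => by simp [hσ, h₁, h₂]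
    refine Nat.card_congr ⟨fun q => (⟨fun x => if p x then q.1.1 x else q.2.1 x, ?_⟩,
      ⟨fun x => if p x then q.2.1 x else q.1.1 x, ?_⟩),
      fun q => (⟨fun x => if p x then q.1.1 x else q.2.1 x, ?_⟩,
      ⟨fun x => if p x then q.2.1 x else q.1.1 x, ?_⟩), fun q => ?_, fun q => ?_⟩
    · exact mix_invariant q.1.2 q.2.2 b1 (fun x hx => (a1 x hx).symm) (fun x hx => (a4 x hx).symm)
    · exact mix_invariant q.2.2 q.1.2 b2 (fun x hx => (a3 x hx).symm) (fun x hx => (a2 x hx).symm)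
    · exact mix_invariant q.1.2 q.2.2 b3 a1 a2
    · exact mix_invariant q.2.2 q.1.2 hσ a3 a4
    · ext x <;> simp only <;> split_ifs <;> rfl
    · ext x <;> simp only <;> split_ifs <;> rfl
  rw [Nat.card_prod, Nat.card_prod] at key
  simp only [natCard_invariant, ← pow_add] at key
  exact Nat.pow_right_injective (by simp) key

end

/-! ### Connected means as sums over connected pairings -/

section
variable {s : ℕ}

/-- The set `J` of vertices is a union of connected components of the pairing `e`. -/
def IsClosedBlock (k : Fin s → ℕ) (e : Perm (HalfEdge k)) (J : Finset (Fin s)) : Prop :=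
  ∀ d, (e d).1 ∈ J ↔ d.1 ∈ J

/-- The pairing `e` connects the vertices in `I`. -/
def BlockConnected (k : Fin s → ℕ) (I : Finset (Fin s)) (e : Perm (HalfEdge k)) : Prop :=
  ∀ J ⊆ I, J.Nonempty → IsClosedBlock k e J → J = I

/-- The weight of a pairing in the mean of a product of traces. -/
noncomputable def pairingWeight (N : ℕ) (k : Fin s → ℕ) (I : Finset (Fin s))
    (e : Perm (HalfEdge k)) : ℂ :=
  (N : ℂ) ^ ((I.card : ℤ) - cyc (rot k) + cyc (rot k * e) - ((blockSet k I).card / 2 : ℕ))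

theorem IsClosedBlock.inter {k : Fin s → ℕ} {e : Perm (HalfEdge k)} {J J' : Finset (Fin s)}
    (h : IsClosedBlock k e J) (h' : IsClosedBlock k e J') : IsClosedBlock k e (J ∩ J') := fun d => by
  rw [Finset.mem_inter, Finset.mem_inter, h d, h' d]

theorem IsClosedBlock.sdiff {k : Fin s → ℕ} {e : Perm (HalfEdge k)} {J J' : Finset (Fin s)}
    (h : IsClosedBlock k e J) (h' : IsClosedBlock k e J') : IsClosedBlock k e (J \ J') := fun d => by
  rw [Finset.mem_sdiff, Finset.mem_sdiff, h d, h' d]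

theorem isClosedBlock_of_mem_pairings {k : Fin s → ℕ} {I : Finset (Fin s)} {e : Perm (HalfEdge k)}
    (he : e ∈ pairings (blockSet k I)) : IsClosedBlock k e I := by
  intro d
  rw [mem_pairings] at he
  rw [← mem_blockSet, ← mem_blockSet, ← he.2, ← he.2, he.1]
  exact ne_comm

/-- Restriction of a pairing to a union of components. -/
theorem exists_restrict_pairing {k : Fin s → ℕ} {I J : Finset (Fin s)} {e : Perm (HalfEdge k)}
    (he : e ∈ pairings (blockSet k I)) (hJI : J ⊆ I) (hJ : IsClosedBlock k e J) :
    ∃ e' ∈ pairings (blockSet k J), ∀ d, e' d = if d.1 ∈ J then e d else d := by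
  rw [mem_pairings] at he
  have hinv : Function.Involutive fun d : HalfEdge k => if d.1 ∈ J then e d else d := by
    intro d
    dsimp only
    by_cases hd : d.1 ∈ J
    · rw [if_pos hd, if_pos ((hJ d).2 hd), he.1]
    · rw [if_neg hd, if_neg hd]
  refine ⟨hinv.toPerm, mem_pairings.2 ⟨hinv, fun d => ?_⟩, fun d => rfl⟩
  simp only [Function.Involutive.coe_toPerm, mem_blockSet]
  by_cases hd : d.1 ∈ J
  · simp only [hd, if_true, iff_true]
    exact (he.2 d).2 (mem_blockSet.2 (hJI hd))
  · simp [hd]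

theorem mul_mem_pairings_blockSet {k : Fin s → ℕ} {I J : Finset (Fin s)} (hJI : J ⊆ I)
    {e₁ e₂ : Perm (HalfEdge k)} (h₁ : e₁ ∈ pairings (blockSet k J))
    (h₂ : e₂ ∈ pairings (blockSet k (I \ J))) :
    (∀ d, (e₁ * e₂) d = if d.1 ∈ J then e₁ d else e₂ d) ∧ e₁ * e₂ ∈ pairings (blockSet k I) := by
  have c₁ := isClosedBlock_of_mem_pairings h₁
  have c₂ := isClosedBlock_of_mem_pairings h₂
  rw [mem_pairings] at h₁ h₂
  have f1 : ∀ d, d.1 ∉ J → e₁ d = d := fun d hd => by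
    by_contra h; exact hd (mem_blockSet.1 ((h₁.2 d).1 h))
  have f2 : ∀ d, d.1 ∉ I \ J → e₂ d = d := fun d hd => by
    by_contra h; exact hd (mem_blockSet.1 ((h₂.2 d).1 h))
  have h : ∀ d, (e₁ * e₂) d = if d.1 ∈ J then e₁ d else e₂ d := by
    intro d
    rw [Perm.mul_apply]
    split_ifs with hd
    · rw [f2 d (fun h => (Finset.mem_sdiff.1 h).2 hd)]
    · by_cases hd' : d.1 ∈ I \ J
      · exact f1 _ (Finset.mem_sdiff.1 ((c₂ d).2 hd')).2
      · rw [f2 d hd', f1 d hd]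
  refine ⟨h, mem_pairings.2 ⟨fun d => ?_, fun d => ?_⟩⟩
  · rw [h d]
    split_ifs with hd
    · rw [h, if_pos ((c₁ d).2 hd), h₁.1]
    · rw [h, if_neg, h₂.1]
      by_cases hd' : d.1 ∈ I \ J
      · exact (Finset.mem_sdiff.1 ((c₂ d).2 hd')).2
      · rwa [f2 d hd']
  · rw [h d, mem_blockSet]
    split_ifs with hd
    · rw [h₁.2, mem_blockSet]
      exact ⟨fun h => hJI h, fun _ => hd⟩
    · rw [h₂.2, mem_blockSet, Finset.mem_sdiff]
      simp [hd]

theorem pairingWeight_mul {N : ℕ} (hN : 1 ≤ N) {k : Fin s → ℕ} {I J : Finset (Fin s)} (hJI : J ⊆ I)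
    {e₁ e₂ : Perm (HalfEdge k)} (h₁ : e₁ ∈ pairings (blockSet k J))
    (h₂ : e₂ ∈ pairings (blockSet k (I \ J))) :
    pairingWeight N k I (e₁ * e₂) = pairingWeight N k J e₁ * pairingWeight N k (I \ J) e₂ := by
  have hN' : (N : ℂ) ≠ 0 := by exact_mod_cast (by omega : N ≠ 0)
  have hc : cyc (rot k * (e₁ * e₂)) + cyc (rot k) = cyc (rot k * e₁) + cyc (rot k * e₂) := by
    refine cyc_mul_add (fun d : HalfEdge k => d.1 ∈ J) (fun d => Iff.rfl) (isClosedBlock_of_mem_pairings h₁)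
      (fun d => ?_) (fun d hd => ?_) (fun d hd => ?_)
    · by_cases hd : d.1 ∈ I \ J
      · have := (isClosedBlock_of_mem_pairings h₂ d).2 hd
        exact iff_of_false (Finset.mem_sdiff.1 this).2 (Finset.mem_sdiff.1 hd).2
      · rw [show e₂ d = d by
          by_contra h; exact hd (mem_blockSet.1 (((mem_pairings.1 h₂).2 d).1 h))]
    · by_contra h; exact hd (mem_blockSet.1 (((mem_pairings.1 h₁).2 d).1 h))
    · by_contra h
      exact (Finset.mem_sdiff.1 (mem_blockSet.1 (((mem_pairings.1 h₂).2 d).1 h))).2 hd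
  have hb : (blockSet k I).card = (blockSet k J).card + (blockSet k (I \ J)).card := by
    rw [card_blockSet, card_blockSet, card_blockSet, add_comm, Finset.sum_sdiff hJI]
  have e1 := two_mul_card_edges h₁
  have e2 := two_mul_card_edges h₂
  have hI : I.card = J.card + (I \ J).card := by
    rw [Finset.card_sdiff_of_subset hJI]
    have := Finset.card_le_card hJI
    omega
  unfold pairingWeight
  rw [← zpow_add₀ hN']
  congr 1
  omega

open Classical in
/-- The pairings of the half-edges at `I` are sorted by the connected component `B` of the vertex `i₀`. -/
theorem traceMean_recursion {N : ℕ} (hN : 1 ≤ N) (k : Fin s → ℕ) {I : Finset (Fin s)} {i₀ : Fin s}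
    (h₀ : i₀ ∈ I) :
    traceMean N k I = ∑ B ∈ I.powerset.filter (i₀ ∈ ·),
      (∑ e ∈ (pairings (blockSet k B)).filter (BlockConnected k B), pairingWeight N k B e) *
        traceMean N k (I \ B) := by
  simp only [traceMean_eq hN, Finset.sum_mul_sum, Finset.sum_sigma']
  symm
  refine Finset.sum_bij (fun p _ => p.2.1 * p.2.2) ?_ ?_ ?_ ?_
  · rintro ⟨B, e₁, e₂⟩ h
    simp only [Finset.mem_sigma, Finset.mem_filter, Finset.mem_powerset] at h
    exact (mul_mem_pairings_blockSet h.1.1 h.2.1.1 h.2.2).2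
  · rintro ⟨B, e₁, e₂⟩ h ⟨B', e₁', e₂'⟩ h' heq
    simp only [Finset.mem_sigma, Finset.mem_filter, Finset.mem_powerset] at h h' heq
    obtain ⟨⟨hBI, hi⟩, ⟨h1, hconn⟩, h2⟩ := h
    obtain ⟨⟨hBI', hi'⟩, ⟨h1', hconn'⟩, h2'⟩ := h'
    obtain ⟨f, -⟩ := mul_mem_pairings_blockSet hBI h1 h2
    obtain ⟨f', -⟩ := mul_mem_pairings_blockSet hBI' h1' h2'
    -- the component of `i₀` is determined by the product
    have hcl : ∀ {B : Finset (Fin s)} {e₁ e₂ : Perm (HalfEdge k)}, B ⊆ I →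
        e₁ ∈ pairings (blockSet k B) → e₂ ∈ pairings (blockSet k (I \ B)) →
        IsClosedBlock k (e₁ * e₂) B := by
      intro B e₁ e₂ hBI h1 h2 d
      rw [(mul_mem_pairings_blockSet hBI h1 h2).1 d]
      split_ifs with hd
      · exact isClosedBlock_of_mem_pairings h1 d
      · by_cases hd' : d.1 ∈ I \ B
        · have := (isClosedBlock_of_mem_pairings h2 d).2 hd'
          exact iff_of_false (Finset.mem_sdiff.1 this).2 (Finset.mem_sdiff.1 hd').2
        · rw [show e₂ d = d by
            by_contra h; exact hd' (mem_blockSet.1 (((mem_pairings.1 h2).2 d).1 h))]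
    have hmin : ∀ {B B' : Finset (Fin s)} {e₁ e₂ : Perm (HalfEdge k)}, B ⊆ I →
        e₁ ∈ pairings (blockSet k B) → e₂ ∈ pairings (blockSet k (I \ B)) →
        BlockConnected k B e₁ → IsClosedBlock k (e₁ * e₂) B' → i₀ ∈ B → i₀ ∈ B' → B ⊆ B' := by
      intro B B' e₁ e₂ hBI h1 h2 hconn hB' hi hi'
      have hh := mul_mem_pairings_blockSet hBI h1 h2
      have := hconn (B ∩ B') Finset.inter_subset_left ⟨i₀, Finset.mem_inter.2 ⟨hi, hi'⟩⟩ ?_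
      · rw [← this]; exact Finset.inter_subset_right
      · intro d
        by_cases hd : d.1 ∈ B
        · have := (hcl hBI h1 h2).inter hB' d
          rwa [hh.1 d, if_pos hd] at this
        · rw [show e₁ d = d by
            by_contra h; exact hd (mem_blockSet.1 (((mem_pairings.1 h1).2 d).1 h))]
    have hBB : B = B' := Finset.Subset.antisymm
      (hmin hBI h1 h2 hconn (heq ▸ hcl hBI' h1' h2') hi hi')
      (hmin hBI' h1' h2' hconn' (heq ▸ hcl hBI h1 h2) hi' hi)
    subst hBB
    have e1 : e₁ = e₁' := by
      ext1 d
      by_cases hd : d.1 ∈ B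
      · have a := f d
        have b := f' d
        rw [if_pos hd] at a b
        rw [← a, ← b, heq]
      · rw [show e₁ d = d by
            by_contra h; exact hd (mem_blockSet.1 (((mem_pairings.1 h1).2 d).1 h)),
          show e₁' d = d by
            by_contra h; exact hd (mem_blockSet.1 (((mem_pairings.1 h1').2 d).1 h))]
    subst e1
    rw [mul_left_cancel heq]
  · intro e he
    set B := I.filter fun i => ∀ J ⊆ I, IsClosedBlock k e J → i₀ ∈ J → i ∈ J with hBdef
    have hBI : B ⊆ I := Finset.filter_subset _ _
    have hi : i₀ ∈ B := Finset.mem_filter.2 ⟨h₀, fun J _ _ h => h⟩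
    have hIc := isClosedBlock_of_mem_pairings he
    have hBc : IsClosedBlock k e B := by
      intro d
      simp only [hBdef, Finset.mem_filter, hIc d]
      refine and_congr_right fun _ => forall_congr' fun J => forall_congr' fun _ =>
        forall_congr' fun hJ => forall_congr' fun _ => hJ d
    obtain ⟨e₁, h1, f1⟩ := exists_restrict_pairing he hBI hBc
    obtain ⟨e₂, h2, f2⟩ := exists_restrict_pairing he Finset.sdiff_subset (hIc.sdiff hBc)
    refine ⟨⟨B, e₁, e₂⟩, ?_, ?_⟩
    · simp only [Finset.mem_sigma, Finset.mem_filter, Finset.mem_powerset]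
      refine ⟨⟨hBI, hi⟩, ⟨h1, fun J hJB hJ hJc => ?_⟩, h2⟩
      have hJe : IsClosedBlock k e J := by
        intro d
        by_cases hd : d.1 ∈ B
        · have := hJc d
          rwa [f1, if_pos hd] at this
        · exact iff_of_false (fun h => hd ((hBc d).1 (hJB h))) (fun h => hd (hJB h))
      by_cases hiJ : i₀ ∈ J
      · refine Finset.Subset.antisymm hJB fun i hiB => ?_
        exact (Finset.mem_filter.1 hiB).2 J (hJB.trans hBI) hJe hiJ
      · exfalso
        obtain ⟨j, hj⟩ := hJ
        have := (Finset.mem_filter.1 (hJB hj)).2 (I \ J) Finset.sdiff_subset (hIc.sdiff hJe)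
          (Finset.mem_sdiff.2 ⟨h₀, hiJ⟩)
        exact (Finset.mem_sdiff.1 this).2 hj
    · ext1 d
      rw [(mul_mem_pairings_blockSet hBI h1 h2).1 d, f1, f2]
      by_cases hd : d.1 ∈ B
      · simp [hd]
      · by_cases hd' : d.1 ∈ I
        · simp [hd, hd']
        · simp only [hd, hd', if_false, Finset.mem_sdiff, false_and]
          by_contra h
          exact hd' (mem_blockSet.1 (((mem_pairings.1 he).2 d).1 (Ne.symm h)))
  · rintro ⟨B, e₁, e₂⟩ h
    simp only [Finset.mem_sigma, Finset.mem_filter, Finset.mem_powerset] at h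
    exact (pairingWeight_mul hN h.1.1 h.2.1.1 h.2.2).symm

open Classical in
/-- The connected mean is the sum over the connected pairings. -/
theorem connectedMean_eq {N : ℕ} (hN : 1 ≤ N) (hs : 1 ≤ s) (k : Fin s → ℕ) :
    connectedMean N k = ∑ e ∈ (pairings (Finset.univ : Finset (HalfEdge k))).filter
      (BlockConnected k Finset.univ), pairingWeight N k Finset.univ e := by
  have hu : (Finset.univ : Finset (HalfEdge k)) = blockSet k Finset.univ := by
    ext; simp [blockSet]
  rw [hu, connectedMean]
  refine connectedPart_eq_of_recursion (traceMean N k) (fun B =>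
    ∑ e ∈ (pairings (blockSet k B)).filter (BlockConnected k B), pairingWeight N k B e) ?_
    (fun I i₀ h₀ => traceMean_recursion hN k h₀) _ ⟨⟨0, hs⟩, Finset.mem_univ _⟩
  rw [traceMean_eq hN]
  have : blockSet k ∅ = ∅ := by ext; simp [blockSet]
  rw [this, pairings_empty]
  simp

end

/-! ### The genus of a connected pairing -/

section
variable {D : Type}

/-- The group generated by `v` and `e` acts transitively, expressed by the absence of nontrivial
invariant predicates. -/
def PermConnected (v e : Perm D) : Prop :=
  ∀ f : D → Prop, (∀ x, f (v x) = f x) → (∀ x, f (e x) = f x) → ∀ x y, f x = f y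

theorem PermConnected.eq {K : Type*} {v e : Perm D} (h : PermConnected v e) {f : D → K}
    (hv : ∀ x, f (v x) = f x) (he : ∀ x, f (e x) = f x) (x y : D) : f x = f y := by
  have := h (fun z => f x = f z) (fun z => by simp only [hv]) (fun z => by simp only [he]) x y
  exact this.mp rfl

variable [Fintype D] [DecidableEq D]

theorem cyc_one : cyc (1 : Perm D) = Fintype.card D := by
  have := cyc_eq_of_invariant (σ := (1 : Perm D)) (σ' := (1 : Perm (Fin 0))) (n := Fintype.card D) ?_
  · rw [this]
    simp [cyc]
  · simp

theorem cyc_isCycle {σ : Perm D} (h : σ.IsCycle) :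
    cyc σ = 1 + Fintype.card {x // x ∉ σ.support} := by
  obtain ⟨a, ha, hσ⟩ := h
  have hs : ∀ x, x ∈ σ.support ↔ σ.SameCycle a x := by
    intro x
    rw [Perm.mem_support]
    constructor
    · exact fun hx => hσ hx
    · intro hx h
      exact ha (hx.apply_eq_self_iff.2 h)
  have key : Nat.card {f : D → Bool // ∀ x, f (σ x) = f x} =
      Nat.card (Bool × ({x // x ∉ σ.support} → Bool)) := by
    refine Nat.card_congr ⟨fun f => (f.1 a, fun x => f.1 x),
      fun q => ⟨fun x => if h : x ∈ σ.support then q.1 else q.2 ⟨x, h⟩, fun x => ?_⟩,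
      fun f => ?_, fun q => ?_⟩
    · by_cases hx : x ∈ σ.support
      · have hx' : σ x ∈ σ.support := Perm.apply_mem_support.2 hx
        simp only [hx, hx', dite_true]
      · have : σ x = x := by simpa using hx
        simp only [this]
    · ext x
      by_cases hx : x ∈ σ.support
      · simp only [hx, dite_true]
        rw [apply_eq_of_sameCycle f.2 ((hs x).1 hx)]
      · simp only [hx, dite_false]
    · have : a ∈ σ.support := by simpa using ha
      ext x
      · simp only [this, dite_true]
      · simp only [x.2, dite_false]
  rw [natCard_invariant, Nat.card_prod, Nat.card_fun] at key
  simp only [Nat.card_eq_fintype_card, Fintype.card_bool] at key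
  rw [mul_comm, ← pow_succ, add_comm] at key
  exact Nat.pow_right_injective le_rfl key

/-- The sign of a permutation determines the parity of its number of cycles. Hence the Euler
characteristic of a map is even. -/
theorem sign_eq_neg_one_pow_cyc (σ : Perm D) :
    (Perm.sign σ : ℤ) = (-1) ^ (Fintype.card D + cyc σ) := by
  induction σ using Perm.cycle_induction_on with
  | base_one =>
    rw [cyc_one, ← two_mul, pow_mul]
    simp
  | base_cycles σ h =>
    have h1 : Fintype.card D = σ.support.card + Fintype.card {x // x ∉ σ.support} := by
      rw [Fintype.card_subtype_compl, Fintype.card_coe]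
      have := σ.support.card_le_univ
      omega
    have h2 : ∀ c m : ℕ, (-1 : ℤ) ^ (c + m + (1 + m)) = -(-1) ^ c := by
      intro c m
      rw [show c + m + (1 + m) = 2 * m + (c + 1) by ring, pow_add, pow_mul, pow_succ]
      simp [pow_succ]
    rw [h.sign, cyc_isCycle h, h1, h2]
    simp
  | induction_disjoint σ τ hd hc h1 h2 =>
    have h := cyc_mul_add (fun x => x ∈ σ.support) (σ := (1 : Perm D)) (e₁ := σ) (e₂ := τ)
      (fun x => Iff.rfl) (fun x => Perm.apply_mem_support) (fun x => ?_) (fun x hx => by simpa using hx)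
      (fun x hx => ?_)
    · rw [one_mul, one_mul, one_mul, cyc_one] at h
      rw [Perm.sign_mul, Units.val_mul, h1, h2, ← pow_add]
      have : Fintype.card D + cyc σ + (Fintype.card D + cyc τ) =
          2 * Fintype.card D + (Fintype.card D + cyc (σ * τ)) := by omega
      rw [this, pow_add _ (2 * _), pow_mul]
      simp
    · rcases hd x with h | h
      · have : τ x ∉ σ.support := by
          intro hx
          rcases hd (τ x) with h' | h'
          · exact (Perm.mem_support.1 hx) h'
          · have := τ.injective h'
            rw [this] at hx
            exact (Perm.mem_support.1 hx) h
        exact iff_of_false this (by simpa using h)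
      · rw [h]
    · rcases hd x with h | h
      · exact absurd h (Perm.mem_support.1 hx)
      · exact h

theorem cyc_pairing {e : Perm D} (he : e ∈ pairings Finset.univ) :
    cyc e * 2 = Fintype.card D := by
  have h := two_mul_card_edges he
  rw [Finset.card_univ] at h
  rw [← h, ← Fintype.card_coe, ← Nat.card_eq_fintype_card, cyc]
  rw [mem_pairings] at he
  have hiff : ∀ x y, e.SameCycle x y ↔ s(x, e x) = s(y, e y) := by
    intro x y
    constructor
    · exact apply_eq_of_sameCycle (f := fun d => s(d, e d)) fun d => by
        rw [he.1, Sym2.eq_swap]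
    · intro hxy
      rcases Sym2.eq_iff.1 hxy with h | h
      · rw [h.1]
      · rw [h.1, Perm.sameCycle_apply_left]
  congr 1
  refine Nat.card_congr (Equiv.ofBijective (Quotient.lift
    (fun d : D => (⟨s(d, e d), Finset.mem_image_of_mem _ (Finset.mem_univ d)⟩ :
      {q // q ∈ Finset.univ.image fun d => s(d, e d)}))
    fun x y hxy => Subtype.ext ((hiff x y).1 hxy)) ⟨fun a b => ?_, fun q => ?_⟩)
  · induction a using Quotient.ind
    induction b using Quotient.ind
    intro hab
    exact Quotient.sound ((hiff _ _).2 (congrArg Subtype.val hab))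
  · obtain ⟨q, hq⟩ := q
    obtain ⟨d, -, rfl⟩ := Finset.mem_image.1 hq
    exact ⟨Quotient.mk _ d, rfl⟩

/-- The space of real functions invariant under `σ`. -/
def invSpace (σ : Perm D) : Submodule ℝ (D → ℝ) where
  carrier := {f | ∀ x, f (σ x) = f x}
  add_mem' ha hb x := by simp only [Pi.add_apply, ha x, hb x]
  zero_mem' x := rfl
  smul_mem' c f hf x := by simp only [Pi.smul_apply, hf x]

omit [DecidableEq D] in
theorem finrank_invSpace (σ : Perm D) : Module.finrank ℝ (invSpace σ) = cyc σ := by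
  classical
  have : invSpace σ = LinearMap.range (LinearMap.funLeft ℝ ℝ
      (Quotient.mk (Perm.SameCycle.setoid σ))) := by
    ext f
    constructor
    · intro hf
      exact ⟨invariantEquiv σ ℝ ⟨f, hf⟩, rfl⟩
    · rintro ⟨g, rfl⟩
      exact ((invariantEquiv σ ℝ).symm g).2
  rw [this, LinearMap.finrank_range_of_inj
    (LinearMap.funLeft_injective_of_surjective _ _ _ Quotient.mk_surjective),
    Module.finrank_fintype_fun_eq_card, cyc, Nat.card_eq_fintype_card]

omit [Fintype D] [DecidableEq D] in
theorem finrank_le_one_of_const [Nonempty D] (S : Submodule ℝ (D → ℝ))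
    (h : ∀ f ∈ S, ∀ x y, f x = f y) : Module.finrank ℝ S ≤ 1 := by
  obtain ⟨x₀⟩ := ‹Nonempty D›
  have hi : Function.Injective ((LinearMap.proj x₀ : (D → ℝ) →ₗ[ℝ] ℝ).comp S.subtype) := by
    intro f g hfg
    ext x
    rw [h f.1 f.2 x x₀, h g.1 g.2 x x₀]
    exact hfg
  simpa using LinearMap.finrank_le_finrank_of_injective hi

/-- Euler's inequality: the image of the coboundary map on functions of the vertices is orthogonal
to the functions of the faces and to the functions of the edges. -/
theorem cyc_add_cyc_le [Nonempty D] {v e : Perm D} (he : e ∈ pairings Finset.univ)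
    (hc : PermConnected v e) : cyc v + cyc (v * e) ≤ Fintype.card D / 2 + 2 := by
  have hE := cyc_pairing he
  rw [mem_pairings] at he
  -- the coboundary of a function on the half-edges
  let δ : (D → ℝ) →ₗ[ℝ] (D → ℝ) := LinearMap.id - LinearMap.funLeft ℝ ℝ e
  have hδ : ∀ f x, δ f x = f x - f (e x) := fun f x => rfl
  let δv := δ.domRestrict (invSpace v)
  have h1 := LinearMap.finrank_range_add_finrank_ker δv
  -- by connectedness its kernel on functions of the vertices consists of the constants
  have h2 : Module.finrank ℝ (LinearMap.ker δv) ≤ 1 := by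
    have h3 : Module.finrank ℝ ((LinearMap.ker δv).map (invSpace v).subtype) ≤ 1 := by
      refine finrank_le_one_of_const _ ?_
      rintro _ ⟨f, hf, rfl⟩
      refine hc.eq f.2 fun x => ?_
      have := congrFun (show δv f = 0 from hf) x
      have h4 : f.1 x - f.1 (e x) = 0 := this
      show f.1 (e x) = f.1 x
      linarith
    rwa [LinearEquiv.finrank_eq (Submodule.equivMapOfInjective _
      (Submodule.subtype_injective _) (LinearMap.ker δv))]
  have h5 : Module.finrank ℝ ↥(invSpace (v * e) ⊓ invSpace e) ≤ 1 := by
    refine finrank_le_one_of_const _ fun f hf => hc.eq (fun x => ?_) hf.2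
    have a := hf.1 (e x)
    have b := hf.2 x
    rw [Perm.mul_apply, he.1, b] at a
    exact a
  have h6 := Submodule.finrank_sup_add_finrank_inf_eq (invSpace (v * e)) (invSpace e)
  have orth : ∀ f ∈ invSpace v, ∀ g ∈ invSpace (v * e) ⊔ invSpace e, ∑ x, δ f x * g x = 0 := by
    intro f hf g hg
    obtain ⟨g₁, hg₁, g₂, hg₂, rfl⟩ := Submodule.mem_sup.1 hg
    simp only [hδ, Pi.add_apply, mul_add, sub_mul, Finset.sum_add_distrib, Finset.sum_sub_distrib]
    have a1 : ∑ x, f (e x) * g₁ x = ∑ x, f x * g₁ x := by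
      rw [← Equiv.sum_comp (v * e) fun x => f x * g₁ x]
      refine Finset.sum_congr rfl fun x _ => ?_
      rw [hg₁ x, Perm.mul_apply, hf]
    have a2 : ∑ x, f (e x) * g₂ x = ∑ x, f x * g₂ x := by
      rw [← Equiv.sum_comp e fun x => f x * g₂ x]
      exact Finset.sum_congr rfl fun x _ => by rw [hg₂ x]
    rw [a1, a2]
    ring
  -- orthogonal subspaces are disjoint, because the inner product is positive definite
  have hdis : Disjoint (LinearMap.range δv) (invSpace (v * e) ⊔ invSpace e) := by
    rw [Submodule.disjoint_def]
    rintro _ ⟨f, rfl⟩ hg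
    have := orth f.1 f.2 _ hg
    have h0 : ∀ x, δ f.1 x * δ f.1 x = 0 := fun x =>
      (Finset.sum_eq_zero_iff_of_nonneg fun x _ => mul_self_nonneg _).1 this x (Finset.mem_univ x)
    ext x
    exact mul_self_eq_zero.1 (h0 x)
  have h7 := Submodule.finrank_add_finrank_le_of_disjoint hdis
  rw [Module.finrank_fintype_fun_eq_card] at h7
  rw [finrank_invSpace] at h1
  rw [finrank_invSpace, finrank_invSpace] at h6
  omega

/-- The Euler characteristic of a connected map is `2 - 2 g` with `g` a natural number. -/
theorem exists_genus [Nonempty D] {v e : Perm D} (he : e ∈ pairings Finset.univ)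
    (hc : PermConnected v e) : ∃ g, cyc v + cyc (v * e) + 2 * g = Fintype.card D / 2 + 2 := by
  have hle := cyc_add_cyc_le he hc
  have hE := cyc_pairing he
  have h1 := sign_eq_neg_one_pow_cyc (v * e)
  rw [Perm.sign_mul, Units.val_mul, sign_eq_neg_one_pow_cyc v, sign_eq_neg_one_pow_cyc e,
    ← pow_add] at h1
  have h2 : Even (Fintype.card D + cyc v + (Fintype.card D + cyc e) +
      (Fintype.card D + cyc (v * e))) := by
    rw [← neg_one_pow_eq_one_iff_even (R := ℤ) (by norm_num), pow_add, h1, ← mul_pow]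
    simp
  obtain ⟨r, hr⟩ := h2
  exact ⟨(Fintype.card D / 2 + 2 - (cyc v + cyc (v * e))) / 2, by omega⟩

end

section
variable {s : ℕ}

theorem permConnected_rot {k : Fin s → ℕ} (hk : ∀ i, k i ≠ 0) {e : Perm (HalfEdge k)} :
    PermConnected (rot k) e ↔ BlockConnected k Finset.univ e := by
  classical
  constructor
  · intro h J _ hJ hJe
    obtain ⟨i, hi⟩ := hJ
    refine Finset.eq_univ_iff_forall.2 fun j => ?_
    have := h (fun d => d.1 ∈ J) (fun d => rfl) (fun d => propext (hJe d))
      ⟨i, ⟨0, Nat.pos_of_ne_zero (hk i)⟩⟩ ⟨j, ⟨0, Nat.pos_of_ne_zero (hk j)⟩⟩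
    exact this.mp hi
  · intro h f hv he x y
    have hf : ∀ x y : HalfEdge k, x.1 = y.1 → f x = f y := fun x y hxy =>
      apply_eq_of_sameCycle hv (sameCycle_rot_iff.2 hxy)
    have key : ∀ x y, f x → f y := by
      intro x y hx
      have hd : ∀ d : HalfEdge k,
          d.1 ∈ (Finset.univ.filter fun i => f ⟨i, ⟨0, Nat.pos_of_ne_zero (hk i)⟩⟩) ↔ f d := by
        intro d
        rw [Finset.mem_filter, hf ⟨d.1, ⟨0, Nat.pos_of_ne_zero (hk d.1)⟩⟩ d rfl]
        simp
      have := h (Finset.univ.filter fun i => f ⟨i, ⟨0, Nat.pos_of_ne_zero (hk i)⟩⟩)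
        (Finset.subset_univ _) ⟨x.1, (hd x).2 hx⟩ (fun d => by rw [hd, hd, he])
      rw [← hd, this]
      exact Finset.mem_univ _
    exact propext ⟨key x y, key y x⟩

/-- The genus of a connected pairing. -/
noncomputable def pairingGenus (k : Fin s → ℕ) (e : Perm (HalfEdge k)) : ℕ :=
  (Fintype.card (HalfEdge k) / 2 + 2 - (s + cyc (rot k * e))) / 2

theorem cyc_rot_of_ne_zero {k : Fin s → ℕ} (hk : ∀ i, k i ≠ 0) : cyc (rot k) = s := by
  rw [cyc_rot, Finset.filter_true_of_mem fun i _ => hk i]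
  simp

theorem pairingGenus_spec (hs : 1 ≤ s) {k : Fin s → ℕ} (hk : ∀ i, k i ≠ 0) {e : Perm (HalfEdge k)}
    (he : e ∈ pairings Finset.univ) (hc : BlockConnected k Finset.univ e) :
    cyc (rot k * e) + s + 2 * pairingGenus k e = Fintype.card (HalfEdge k) / 2 + 2 := by
  have : Nonempty (HalfEdge k) := ⟨⟨⟨0, hs⟩, ⟨0, Nat.pos_of_ne_zero (hk _)⟩⟩⟩
  obtain ⟨g, hg⟩ := exists_genus he ((permConnected_rot hk).2 hc)
  rw [cyc_rot_of_ne_zero hk] at hg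
  unfold pairingGenus
  omega

/-- A vertex without half-edges is connected to no other vertex. -/
theorem eq_one_of_exists_zero {k : Fin s → ℕ} {i : Fin s} (hi : k i = 0) {e : Perm (HalfEdge k)}
    (hc : BlockConnected k Finset.univ e) : s = 1 := by
  have h := hc {i} (Finset.subset_univ _) ⟨i, Finset.mem_singleton_self _⟩ ?_
  · have := congrArg Finset.card h
    simpa using this.symm
  · have hne : ∀ d : HalfEdge k, d.1 ≠ i := by
      rintro ⟨j, d⟩ (rfl : j = i)
      exact (Fin.cast hi d).elim0
    intro d
    simp [hne]

theorem pairingWeight_univ {N : ℕ} (hN : 1 ≤ N) (hs : 1 ≤ s) {k : Fin s → ℕ}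
    {e : Perm (HalfEdge k)} (he : e ∈ pairings Finset.univ)
    (hc : BlockConnected k Finset.univ e) :
    (N : ℂ) ^ ((s : ℤ) - 2) * pairingWeight N k Finset.univ e =
      ((N : ℂ) ^ (-2 : ℤ)) ^ pairingGenus k e := by
  have hN' : (N : ℂ) ≠ 0 := by exact_mod_cast (by omega : N ≠ 0)
  have hu : blockSet k Finset.univ = (Finset.univ : Finset (HalfEdge k)) := by
    ext; simp [blockSet]
  rw [pairingWeight, hu, Finset.card_univ, Finset.card_univ, Fintype.card_fin, ← zpow_add₀ hN',
    ← zpow_natCast, ← zpow_mul]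
  congr 1
  by_cases hk : ∀ i, k i ≠ 0
  · have h := pairingGenus_spec hs hk he hc
    rw [cyc_rot_of_ne_zero hk]
    omega
  · push Not at hk
    obtain ⟨i, hi⟩ := hk
    obtain rfl := eq_one_of_exists_zero hi hc
    have hem : IsEmpty (HalfEdge k) := ⟨fun ⟨j, d⟩ => by
      rw [Subsingleton.elim j i] at d
      exact (Fin.cast hi d).elim0⟩
    have h0 : ∀ σ : Perm (HalfEdge k), cyc σ = 0 := fun σ => by
      rw [Subsingleton.elim σ 1, cyc_one, Fintype.card_eq_zero]
    rw [pairingGenus, h0, h0, Fintype.card_eq_zero]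
    norm_num

open Classical in
/-- The genus expansion. -/
noncomputable def genusPolynomial (k : Fin s → ℕ) : Polynomial ℂ :=
  ∑ e ∈ (pairings (Finset.univ : Finset (HalfEdge k))).filter (BlockConnected k Finset.univ),
    Polynomial.X ^ pairingGenus k e

theorem isGenusExpansion_genusPolynomial (hs : 1 ≤ s) (k : Fin s → ℕ) :
    IsGenusExpansion k (genusPolynomial k) := by
  classical
  intro N hN
  rw [connectedMean_eq hN hs, genusPolynomial, Polynomial.eval_finsetSum, Finset.mul_sum]
  refine Finset.sum_congr (by congr) fun e he => ?_
  rw [Finset.mem_filter] at he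
  rw [pairingWeight_univ hN hs he.1 he.2, Polynomial.eval_pow, Polynomial.eval_X]

theorem IsGenusExpansion.unique {k : Fin s → ℕ} {p q : Polynomial ℂ} (hp : IsGenusExpansion k p)
    (hq : IsGenusExpansion k q) : p = q := by
  refine Polynomial.eq_of_infinite_eval_eq p q (Set.Infinite.mono (s := Set.range
    fun n : ℕ => ((n + 1 : ℕ) : ℂ) ^ (-2 : ℤ)) ?_ ?_)
  · rintro _ ⟨n, rfl⟩
    show _ = _
    rw [← hp (n + 1) (by omega), ← hq (n + 1) (by omega)]
  · refine Set.infinite_range_of_injective fun m n h => ?_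
    simp only [zpow_neg, inv_inj] at h
    have h' : (m + 1) ^ 2 = (n + 1) ^ 2 := by exact_mod_cast h
    have := Nat.pow_left_injective (n := 2) (by norm_num) h'
    omega

theorem existsUnique_genusExpansion (hs : 1 ≤ s) (k : Fin s → ℕ) :
    ∃! p : Polynomial ℂ, IsGenusExpansion k p :=
  ⟨_, isGenusExpansion_genusPolynomial hs k,
    fun _ h => h.unique (isGenusExpansion_genusPolynomial hs k)⟩

theorem genusMean_eq_coeff (hs : 1 ≤ s) (g : ℕ) (k : Fin s → ℕ) :
    genusMean g k = (genusPolynomial k).coeff g := by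
  have h : ∃ p : Polynomial ℂ, IsGenusExpansion k p := ⟨_, isGenusExpansion_genusPolynomial hs k⟩
  rw [genusMean, dif_pos h, h.choose_spec.unique (isGenusExpansion_genusPolynomial hs k)]

open Classical in
/-- The genus `g` mean counts the connected pairings of genus `g`. -/
theorem genusMean_eq_card (hs : 1 ≤ s) (g : ℕ) {k : Fin s → ℕ} (hk : ∀ i, k i ≠ 0) :
    genusMean g k = (((pairings (Finset.univ : Finset (HalfEdge k))).filter fun e =>
      PermConnected (rot k) e ∧
        cyc (rot k * e) + s + 2 * g = Fintype.card (HalfEdge k) / 2 + 2).card : ℂ) := by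
  rw [genusMean_eq_coeff hs, genusPolynomial, Polynomial.finsetSum_coeff]
  simp only [Polynomial.coeff_X_pow]
  rw [Finset.sum_boole, Finset.filter_filter]
  congr 2
  ext e
  simp only [Finset.mem_filter, permConnected_rot hk]
  refine and_congr_right fun he => and_congr_right fun hc => ?_
  have := pairingGenus_spec hs hk he hc
  omega

theorem genusMean_eq_zero (hs : 1 ≤ s) {g : ℕ} (hg : 2 < 2 * g + s) {k : Fin s → ℕ} {i : Fin s}
    (hi : k i = 0) : genusMean g k = 0 := by
  classical
  rw [genusMean_eq_coeff hs, genusPolynomial, Polynomial.finsetSum_coeff]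
  refine Finset.sum_eq_zero fun e he => ?_
  obtain rfl := eq_one_of_exists_zero hi (Finset.mem_filter.1 he).2
  rw [Polynomial.coeff_X_pow, if_neg]
  have hem : IsEmpty (HalfEdge k) := ⟨fun ⟨j, d⟩ => by
    rw [Subsingleton.elim j i] at d
    exact (Fin.cast hi d).elim0⟩
  rw [pairingGenus, Fintype.card_eq_zero]
  omega

end

/-! ### Labelled maps -/

section
variable {s g : ℕ}

/-- A vertex permutation, an edge permutation and a labelling of the half-edges of `D`. -/
abbrev Triple (s : ℕ) (D : Type) : Type := Perm D × Perm D × (D → Fin s)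

/-- The triple `(v, e, ℓ)` is a connected map of genus `g` whose faces, the cycles of `v * e`, are
labelled bijectively by `ℓ`. -/
structure IsMap (s g : ℕ) {D : Type} [Fintype D] [DecidableEq D] (M : Triple s D) : Prop where
  pairing : M.2.1 ∈ pairings Finset.univ
  conn : PermConnected M.1 M.2.1
  surj : Function.Surjective M.2.2
  inv : ∀ x, M.2.2 (M.1 (M.2.1 x)) = M.2.2 x
  sep : ∀ f : D → Prop, (∀ x, f (M.1 (M.2.1 x)) = f x) → ∀ x y, M.2.2 x = M.2.2 y → f x = f y
  genus : cyc M.1 + s + 2 * g = Fintype.card D / 2 + 2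

/-- Transport of a triple along a bijection. -/
def Triple.map {D D' : Type} (π : D ≃ D') : Triple s D ≃ Triple s D' where
  toFun M := (π.permCongr M.1, π.permCongr M.2.1, M.2.2 ∘ π.symm)
  invFun M := (π.symm.permCongr M.1, π.symm.permCongr M.2.1, M.2.2 ∘ π)
  left_inv M := by
    refine Prod.ext ?_ (Prod.ext ?_ ?_)
    · ext x; simp
    · ext x; simp
    · funext x; simp
  right_inv M := by
    refine Prod.ext ?_ (Prod.ext ?_ ?_)
    · ext x; simp
    · ext x; simp
    · funext x; simp

variable {D D' : Type} [Fintype D] [DecidableEq D] [Fintype D'] [DecidableEq D']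

omit [Fintype D] [DecidableEq D] [Fintype D'] [DecidableEq D'] in
theorem Triple.map_fst (π : D ≃ D') (M : Triple s D) (x : D) :
    (Triple.map π M).1 (π x) = π (M.1 x) := by simp [Triple.map]

omit [Fintype D] [DecidableEq D] [Fintype D'] [DecidableEq D'] in
theorem Triple.map_snd (π : D ≃ D') (M : Triple s D) (x : D) :
    (Triple.map π M).2.1 (π x) = π (M.2.1 x) := by simp [Triple.map]

omit [Fintype D] [DecidableEq D] [Fintype D'] [DecidableEq D'] in
theorem Triple.map_label (π : D ≃ D') (M : Triple s D) (x : D) :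
    (Triple.map π M).2.2 (π x) = M.2.2 x := by simp [Triple.map]

theorem IsMap.map {M : Triple s D} (h : IsMap s g M) (π : D ≃ D') :
    IsMap s g (Triple.map π M) where
  pairing := by
    have := mem_pairings.1 h.pairing
    refine mem_pairings.2 ⟨fun x => ?_, fun x => ?_⟩ <;> obtain ⟨x, rfl⟩ := π.surjective x
    · rw [Triple.map_snd, Triple.map_snd, this.1]
    · rw [Triple.map_snd, Ne, π.injective.eq_iff]
      simpa using this.2 x
  conn := by
    intro f hv he x y
    obtain ⟨x, rfl⟩ := π.surjective x
    obtain ⟨y, rfl⟩ := π.surjective y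
    refine h.conn (fun x => f (π x)) (fun x => ?_) (fun x => ?_) x y
    · rw [← Triple.map_fst, hv]
    · rw [← Triple.map_snd, he]
  surj := by
    intro i
    obtain ⟨x, hx⟩ := h.surj i
    exact ⟨π x, by rw [Triple.map_label, hx]⟩
  inv x := by
    obtain ⟨x, rfl⟩ := π.surjective x
    rw [Triple.map_snd, Triple.map_fst, Triple.map_label, Triple.map_label, h.inv]
  sep := by
    intro f hf x y hxy
    obtain ⟨x, rfl⟩ := π.surjective x
    obtain ⟨y, rfl⟩ := π.surjective y
    rw [Triple.map_label, Triple.map_label] at hxy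
    refine h.sep (fun x => f (π x)) (fun x => ?_) x y hxy
    rw [← hf (π x), Triple.map_snd, Triple.map_fst]
  genus := by
    rw [← cyc_congr π (σ := M.1) (fun x => (Triple.map_fst π M x).symm), ← Fintype.card_congr π]
    exact h.genus

theorem isMap_map_iff {M : Triple s D} (π : D ≃ D') : IsMap s g (Triple.map π M) ↔ IsMap s g M := by
  refine ⟨fun h => ?_, fun h => h.map π⟩
  have := h.map π.symm
  rwa [show Triple.map π.symm (Triple.map π M) = M from (Triple.map π).left_inv M] at this

open Classical in
variable (s g D) in
/-- The finite set of maps on the set `D` of half-edges. -/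
noncomputable def mapSet : Finset (Triple s D) := Finset.univ.filter (IsMap s g)

theorem mem_mapSet {M : Triple s D} : M ∈ mapSet s g D ↔ IsMap s g M := by simp [mapSet]

theorem sum_mapSet_congr (π : D ≃ D') (Ψ : Triple s D → ℂ) (Ψ' : Triple s D' → ℂ)
    (h : ∀ M, Ψ' (Triple.map π M) = Ψ M) :
    ∑ M ∈ mapSet s g D, Ψ M = ∑ M ∈ mapSet s g D', Ψ' M := by
  refine Finset.sum_bij (fun M _ => Triple.map π M) ?_ ?_ ?_ ?_
  · intro M hM
    exact mem_mapSet.2 ((mem_mapSet.1 hM).map π)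
  · intro _ _ _ _ h
    exact (Triple.map π).injective h
  · intro M hM
    refine ⟨(Triple.map π).symm M, ?_, (Triple.map π).right_inv M⟩
    rw [mem_mapSet, ← isMap_map_iff π]
    rw [Equiv.apply_symm_apply]
    exact mem_mapSet.1 hM
  · intro M _
    exact (h M).symm

/-- By symmetry, an ordered pair of half-edges may be taken to be a given one. -/
theorem sum_mapSet_pair (Ψ : Triple s D → D → D → ℂ)
    (h : ∀ (π : Perm D) M a b, Ψ (Triple.map π M) (π a) (π b) = Ψ M a b) {a₀ b₀ : D}
    (h₀ : a₀ ≠ b₀) :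
    ∑ M ∈ mapSet s g D, ∑ a, ∑ b, (if a = b then 0 else Ψ M a b) =
      (Fintype.card D : ℂ) * ((Fintype.card D : ℂ) - 1) * ∑ M ∈ mapSet s g D, Ψ M a₀ b₀ := by
  rw [Finset.sum_comm]
  have h1 : ∀ a b : D, a ≠ b → ∑ M ∈ mapSet s g D, Ψ M a b = ∑ M ∈ mapSet s g D, Ψ M a₀ b₀ := by
    intro a b hab
    -- a permutation moving `(a, b)` to `(a₀, b₀)`
    let π : Perm D := swap b₀ (swap a a₀ b) * swap a a₀
    have hb : swap a a₀ b ≠ a₀ := by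
      intro h
      have := (swap a a₀).injective (h.trans (swap_apply_left a a₀).symm)
      exact hab this.symm
    have ha : π a = a₀ := by
      simp only [π, Perm.mul_apply, swap_apply_left]
      exact swap_apply_of_ne_of_ne h₀ hb.symm
    have hb' : π b = b₀ := by simp [π]
    refine sum_mapSet_congr π _ _ fun M => ?_
    rw [← h π M a b, ha, hb']
  have h2 : ∀ a : D, ∑ M ∈ mapSet s g D, ∑ b, (if a = b then 0 else Ψ M a b) =
      ((Fintype.card D : ℂ) - 1) * ∑ M ∈ mapSet s g D, Ψ M a₀ b₀ := by
    intro a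
    rw [Finset.sum_comm, ← Finset.add_sum_erase _ _ (Finset.mem_univ a)]
    simp only [if_true, Finset.sum_const_zero, zero_add]
    rw [Finset.sum_congr rfl fun b hb => ?_, Finset.sum_const, Finset.card_erase_of_mem
      (Finset.mem_univ a), Finset.card_univ, nsmul_eq_mul, Nat.cast_sub, Nat.cast_one]
    · exact Fintype.card_pos_iff.2 ⟨a⟩
    · have hab : a ≠ b := (Finset.ne_of_mem_erase hb).symm
      simp only [if_neg hab]
      exact h1 a b hab
  rw [Finset.sum_congr rfl fun a _ => h2 a, Finset.sum_const, Finset.card_univ, nsmul_eq_mul,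
    mul_assoc]

/-! ### Adding one edge -/

/-- The extension of a permutation to two more points. -/
def extPerm (τ : Perm D) : Perm (Option (Option D)) := τ.optionCongr.optionCongr

omit [Fintype D] [DecidableEq D] in
@[simp] theorem extPerm_none (τ : Perm D) : extPerm τ none = none := rfl

omit [Fintype D] [DecidableEq D] in
@[simp] theorem extPerm_some_none (τ : Perm D) : extPerm τ (some none) = some none := rfl

omit [Fintype D] [DecidableEq D] in
@[simp] theorem extPerm_some_some (τ : Perm D) (x : D) :
    extPerm τ (some (some x)) = some (some (τ x)) := rfl

omit [Fintype D] in
omit [DecidableEq D] in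
theorem exists_eq_extPerm {σ : Perm (Option (Option D))} (h₁ : σ none = none)
    (h₂ : σ (some none) = some none) : ∃ τ, σ = extPerm τ := by
  have h : ∀ x : D, ∃ y : D, σ (some (some x)) = some (some y) := by
    intro x
    rcases hx : σ (some (some x)) with _ | _ | y
    · exact absurd (σ.injective (hx.trans h₁.symm)) (by simp)
    · exact absurd (σ.injective (hx.trans h₂.symm)) (by simp)
    · exact ⟨y, rfl⟩
  choose f hf using h
  have hbij : Function.Bijective f := by
    constructor
    · intro x y hxy
      have : σ (some (some x)) = σ (some (some y)) := by rw [hf, hf, hxy]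
      simpa using σ.injective this
    · intro y
      obtain ⟨x, hx⟩ := σ.surjective (some (some y))
      rcases x with _ | _ | x
      · rw [h₁] at hx; simp at hx
      · rw [h₂] at hx; simp at hx
      · exact ⟨x, by rw [hf] at hx; simpa using hx⟩
  refine ⟨Equiv.ofBijective f hbij, ?_⟩
  ext1 x
  rcases x with _ | _ | x
  · simp [h₁]
  · simp [h₂]
  · simp [hf]

omit [Fintype D] [DecidableEq D] in
theorem extPerm_injective : Function.Injective (extPerm (D := D)) := by
  intro σ τ h
  ext1 x
  have := Equiv.congr_fun h (some (some x))
  simpa using this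

/-- The extension of a function to two more points, at which it takes the values at `p` and `q`. -/
def extFun {K : Type*} (p q : D) (f : D → K) : Option (Option D) → K
  | none => f p
  | some none => f q
  | some (some x) => f x

/-- The effect on maps of adding an edge, described by the effect on invariant functions. -/
theorem isMap_extFun_iff {v e : Perm (Option (Option D))} {v' e' : Perm D} {p q p' q' : D}
    (he : e ∈ pairings Finset.univ ↔ e' ∈ pairings Finset.univ) (hcyc : cyc v = 1 + cyc v')
    (hφ : ∀ {K : Type} (f : Option (Option D) → K), (∀ x, f (v (e x)) = f x) ↔
      (∀ x, f (some (some (v' (e' x)))) = f (some (some x))) ∧ f none = f (some (some p)) ∧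
        f (some none) = f (some (some q)))
    (hc : ∀ f : Option (Option D) → Prop, ((∀ x, f (v x) = f x) ∧ ∀ x, f (e x) = f x) ↔
      ((∀ x, f (some (some (v' x))) = f (some (some x))) ∧
        ∀ x, f (some (some (e' x))) = f (some (some x))) ∧ f none = f (some (some p')) ∧
        f (some none) = f (some (some q')))
    (ℓ : Option (Option D) → Fin s) :
    IsMap s g (v, e, ℓ) ↔ ∃ ℓ', ℓ = extFun p q ℓ' ∧ IsMap s g (v', e', ℓ') := by
  have hcard : Fintype.card (Option (Option D)) = Fintype.card D + 2 := by simp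
  have hconn : PermConnected v e ↔ PermConnected v' e' := by
    constructor
    · intro h f h1 h2 x y
      obtain ⟨a, b⟩ := (hc (extFun p' q' f)).2 ⟨⟨h1, h2⟩, rfl, rfl⟩
      exact h _ a b (some (some x)) (some (some y))
    · intro h f h1 h2
      obtain ⟨⟨a, b⟩, c, d⟩ := (hc f).1 ⟨h1, h2⟩
      have key : ∀ x, f x = f (some (some p')) := by
        intro x
        have := fun x => h (fun x => f (some (some x))) a b x p'
        rcases x with _ | _ | x
        · exact c
        · rw [d]; exact this q'
        · exact this x
      intro x y
      rw [key x, key y]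
  constructor
  · intro h
    obtain ⟨h1, h2, h3⟩ := (hφ ℓ).1 h.inv
    refine ⟨fun x => ℓ (some (some x)), ?_, ⟨he.1 h.pairing, hconn.1 h.conn, fun i => ?_, h1,
      fun f hf x y hxy => ?_, ?_⟩⟩
    · funext x
      rcases x with _ | _ | x
      · exact h2
      · exact h3
      · rfl
    · obtain ⟨x, rfl⟩ := h.surj i
      rcases x with _ | _ | x
      · exact ⟨p, h2.symm⟩
      · exact ⟨q, h3.symm⟩
      · exact ⟨x, rfl⟩
    · exact h.sep (extFun p q f) ((hφ _).2 ⟨hf, rfl, rfl⟩) (some (some x)) (some (some y)) hxy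
    · have := h.genus
      rw [hcyc, hcard] at this
      show cyc v' + s + 2 * g = _
      omega
  · rintro ⟨ℓ, rfl, h⟩
    refine ⟨he.2 h.pairing, hconn.2 h.conn, fun i => ?_, (hφ _).2 ⟨h.inv, rfl, rfl⟩,
      fun f hf x y hxy => ?_, ?_⟩
    · obtain ⟨x, rfl⟩ := h.surj i
      exact ⟨some (some x), rfl⟩
    · obtain ⟨h1, h2, h3⟩ := (hφ f).1 hf
      -- each point has a representative in `D`
      have key : ∀ x, ∃ x', extFun p q ℓ x = ℓ x' ∧ f x = f (some (some x')) := by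
        intro x
        rcases x with _ | _ | x
        · exact ⟨p, rfl, h2⟩
        · exact ⟨q, rfl, h3⟩
        · exact ⟨x, rfl, rfl⟩
      obtain ⟨x', hx1, hx2⟩ := key x
      obtain ⟨y', hy1, hy2⟩ := key y
      rw [hx2, hy2]
      refine h.sep (fun x => f (some (some x))) h1 x' y' ?_
      show ℓ x' = ℓ y'
      rw [← hx1, ← hy1]
      exact hxy
    · have := h.genus
      show cyc v + s + 2 * g = _
      rw [hcyc, hcard]
      simp only at this
      omega

/-! #### Adding a leaf -/

/-- The map obtained from `M` by attaching an edge ending in a leaf at the corner after `z`. The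
leaf is `some none`, the other half of the new edge is `none`. -/
def addLeaf (M : Triple s D) (z : D) : Triple s (Option (Option D)) :=
  (extPerm M.1 * swap (some (some z)) none, extPerm M.2.1 * swap none (some none),
    extFun (M.1 z) (M.1 z) M.2.2)

theorem extPerm_mul_swap_mem_pairings {e : Perm D} :
    extPerm e * swap none (some none) ∈ pairings Finset.univ ↔ e ∈ pairings Finset.univ := by
  rw [mem_pairings, mem_pairings]
  constructor
  · rintro ⟨h1, h2⟩
    refine ⟨fun x => ?_, fun x => ?_⟩
    · simpa [swap_apply_of_ne_of_ne] using h1 (some (some x))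
    · simpa [swap_apply_of_ne_of_ne] using h2 (some (some x))
  · rintro ⟨h1, h2⟩
    refine ⟨fun x => ?_, fun x => ?_⟩
    · rcases x with _ | _ | x <;> simp [swap_apply_of_ne_of_ne, h1]
    · rcases x with _ | _ | x
      · simp
      · simp
      · simpa [swap_apply_of_ne_of_ne] using h2 x

omit [Fintype D] [DecidableEq D] in
theorem forall_option_option {p : Option (Option D) → Prop} :
    (∀ x, p x) ↔ p none ∧ p (some none) ∧ ∀ x, p (some (some x)) := by
  constructor
  · exact fun h => ⟨h _, h _, fun x => h _⟩
  · rintro ⟨h1, h2, h3⟩ (_ | _ | x)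
    · exact h1
    · exact h2
    · exact h3 x

/-- A triple with a leaf is a map exactly if it is so after the removal of the leaf. Both halves of the
new edge lie in the face of the corner `z`. -/
theorem isMap_leaf_iff {v e : Perm D} (he : ∀ x, e (e x) = x) (z : D)
    (ℓ : Option (Option D) → Fin s) :
    IsMap s g (extPerm v * swap (some (some z)) none, extPerm e * swap none (some none), ℓ) ↔
      ∃ ℓ', ℓ = extFun (v z) (v z) ℓ' ∧ IsMap s g (v, e, ℓ') := by
  have v1 : (extPerm v * swap (some (some z)) none) none = some (some (v z)) := by simp
  have v2 : (extPerm v * swap (some (some z)) none) (some none) = some none := by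
    simp [swap_apply_of_ne_of_ne]
  have v3 : (extPerm v * swap (some (some z)) none) (some (some z)) = none := by simp
  have v4 : ∀ x, x ≠ z → (extPerm v * swap (some (some z)) none) (some (some x)) =
      some (some (v x)) := fun x hx => by simp [swap_apply_of_ne_of_ne, hx]
  have e1 : (extPerm e * swap none (some none) : Perm (Option (Option D))) none = some none := by simp
  have e2 : (extPerm e * swap none (some none) : Perm (Option (Option D))) (some none) = none := by simp
  have e3 : ∀ x, (extPerm e * swap none (some none) : Perm (Option (Option D))) (some (some x)) = some (some (e x)) :=
    fun x => by simp [swap_apply_of_ne_of_ne]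
  generalize extPerm v * swap (some (some z)) none = v'' at *
  have hinvv : ∀ {K : Type} (f : Option (Option D) → K), (∀ x, f (v'' x) = f x) ↔
      (∀ x, f (some (some (v x))) = f (some (some x))) ∧ f none = f (some (some z)) := by
    intro K f
    rw [forall_option_option, v1, v2]
    constructor
    · rintro ⟨h1, -, h3⟩
      have h4 := h3 z
      rw [v3] at h4
      refine ⟨fun x => ?_, h4⟩
      by_cases hx : x = z
      · rw [hx, h1, h4]
      · rw [← v4 x hx, h3]
    · rintro ⟨h1, h2⟩
      refine ⟨by rw [h1, h2], rfl, fun x => ?_⟩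
      by_cases hx : x = z
      · rw [hx, v3, h2]
      · rw [v4 x hx, h1]
  refine isMap_extFun_iff (p' := z) (q' := z) extPerm_mul_swap_mem_pairings ?_ ?_ ?_ ℓ
  · refine cyc_eq_of_invariant ?_
    rw [pow_one, show 2 = Nat.card Bool by simp, ← Nat.card_prod]
    let F : Bool → (D → Bool) → Option (Option D) → Bool := fun b f x =>
      x.elim (f z) fun x => x.elim b f
    refine Nat.card_congr ⟨fun f => (f.1 (some none), ⟨fun x => f.1 (some (some x)),
      ((hinvv f.1).1 f.2).1⟩), fun q => ⟨F q.1 q.2.1, (hinvv (F q.1 q.2.1)).2 ⟨q.2.2, rfl⟩⟩,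
      fun f => ?_, fun q => rfl⟩
    ext x
    rcases x with _ | _ | x
    · exact ((hinvv f.1).1 f.2).2.symm
    · rfl
    · rfl
  · intro K f
    rw [forall_option_option, e1, e2, v2, v1]
    constructor
    · rintro ⟨h1, h2, h3⟩
      have h4 := h3 (e z)
      rw [e3, he, v3] at h4
      refine ⟨fun x => ?_, by rw [h2, h1], h2.symm⟩
      by_cases hx : e x = z
      · rw [hx, h2, h1, h4, ← hx, he]
      · rw [← h3 x, e3, v4 _ hx]
    · rintro ⟨h1, h2, h3⟩
      refine ⟨by rw [h2, h3], h3.symm, fun x => ?_⟩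
      rw [e3]
      by_cases hx : e x = z
      · rw [hx, v3, h2, ← hx, h1]
      · rw [v4 _ hx, h1]
  · intro f
    rw [hinvv f, forall_option_option (p := fun x => f ((extPerm e * swap none (some none) : Perm (Option (Option D))) x) = f x),
      e1, e2]
    simp only [e3]
    constructor
    · rintro ⟨⟨h1, h2⟩, h3, h4, h5⟩
      exact ⟨⟨h1, h5⟩, h2, by rw [h3, h2]⟩
    · rintro ⟨⟨h1, h5⟩, h2, h3⟩
      exact ⟨⟨h1, h2⟩, by rw [h2, h3], by rw [h2, h3], h5⟩

omit [Fintype D] in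
theorem addLeaf_injective {M M' : Triple s D} {z z' : D} (h : addLeaf M z = addLeaf M' z') :
    M = M' ∧ z = z' := by
  have h1 : extPerm M.1 * swap (some (some z)) none = extPerm M'.1 * swap (some (some z')) none :=
    congrArg Prod.fst h
  have h2 : extPerm M.2.1 * swap none (some none) = extPerm M'.2.1 * swap none (some none) :=
    congrArg (fun M => M.2.1) h
  have h3 : extFun (M.1 z) (M.1 z) M.2.2 = extFun (M'.1 z') (M'.1 z') M'.2.2 :=
    congrArg (fun M => M.2.2) h
  have hz : z = z' := by
    have a := Equiv.congr_fun h1 (some (some z))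
    by_contra hne
    simp [swap_apply_of_ne_of_ne, hne] at a
  subst hz
  refine ⟨Prod.ext (extPerm_injective (mul_right_cancel h1)) (Prod.ext (extPerm_injective
    (mul_right_cancel h2)) (funext fun x => ?_)), rfl⟩
  exact congrFun h3 (some (some x))

/-- Removal of a leaf. -/
theorem exists_eq_addLeaf [Nonempty D] {M : Triple s (Option (Option D))} (hM : IsMap s g M)
    (hv : M.1 (some none) = some none) (he : M.2.1 none = some none) :
    ∃ M' z, IsMap s g M' ∧ M = addLeaf M' z := by
  obtain ⟨v, e, ℓ⟩ := M
  simp only at hv he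
  have hp := (mem_pairings.1 hM.pairing).1
  simp only at hp
  have he' : e (some none) = none := by rw [← he, hp]
  obtain ⟨x₀⟩ := ‹Nonempty D›
  -- otherwise the new edge would be a component of its own
  have hva : v none ≠ none := by
    intro hva
    have := hM.conn (fun x => x = none ∨ x = some none) (fun x => ?_) (fun x => ?_) none
      (some (some x₀))
    · simp at this
    · have h1 : v x = none ↔ x = none := by
        rw [← v.injective.eq_iff (a := x), hva]
      have h2 : v x = some none ↔ x = some none := by
        rw [← v.injective.eq_iff (a := x), hv]
      simp only [h1, h2]
    · have h1 : e x = none ↔ x = some none := by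
        rw [← e.injective.eq_iff (a := x), he']
      have h2 : e x = some none ↔ x = none := by
        rw [← e.injective.eq_iff (a := x), he]
      simp only [h1, h2, or_comm]
  obtain ⟨z, hz⟩ : ∃ z, v (some (some z)) = none := by
    obtain ⟨z, hz⟩ := v.surjective none
    rcases z with _ | _ | z
    · exact absurd hz hva
    · rw [hv] at hz; simp at hz
    · exact ⟨z, hz⟩
  obtain ⟨v', hv'⟩ := exists_eq_extPerm (σ := v * swap (some (some z)) none) (by simp [hz])
    (by simp [swap_apply_of_ne_of_ne, hv])
  obtain ⟨e', he''⟩ := exists_eq_extPerm (σ := e * swap none (some none)) (by simp [he'])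
    (by simp [he])
  have hv2 : v = extPerm v' * swap (some (some z)) none := by
    rw [← hv', mul_assoc, swap_mul_self, mul_one]
  have he2 : e = extPerm e' * swap none (some none) := by
    rw [← he'', mul_assoc, swap_mul_self, mul_one]
  have he3 : ∀ x, e' (e' x) = x := by
    intro x
    have := hp (some (some x))
    rw [he2] at this
    simpa [swap_apply_of_ne_of_ne] using this
  rw [hv2, he2, isMap_leaf_iff he3] at hM
  obtain ⟨ℓ', hℓ, hM'⟩ := hM
  exact ⟨(v', e', ℓ'), z, hM', by rw [addLeaf, hv2, he2, hℓ]⟩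

open Classical in
/-- A map with a given leaf and given adjacent edge is a smaller map together with a corner `z`. -/
theorem sum_addLeaf [Nonempty D] (Ψ : Triple s (Option (Option D)) → ℂ) :
    ∑ M ∈ mapSet s g (Option (Option D)),
      (if M.1 (some none) = some none ∧ M.2.1 none = some none then Ψ M else 0) =
    ∑ M ∈ mapSet s g D, ∑ z, Ψ (addLeaf M z) := by
  rw [← Finset.sum_filter, ← Finset.sum_product']
  symm
  refine Finset.sum_bij (fun p _ => addLeaf p.1 p.2) ?_ ?_ ?_ ?_
  · rintro ⟨M, z⟩ h
    have hM := mem_mapSet.1 (Finset.mem_product.1 h).1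
    rw [Finset.mem_filter, mem_mapSet]
    refine ⟨(isMap_leaf_iff (mem_pairings.1 hM.pairing).1 z _).2 ⟨M.2.2, rfl, hM⟩, ?_, ?_⟩
    · simp [addLeaf, swap_apply_of_ne_of_ne]
    · simp [addLeaf]
  · rintro ⟨M, z⟩ _ ⟨M', z'⟩ _ h
    obtain ⟨rfl, rfl⟩ := addLeaf_injective h
    rfl
  · intro M hM
    rw [Finset.mem_filter, mem_mapSet] at hM
    obtain ⟨M', z, hM', rfl⟩ := exists_eq_addLeaf hM.1 hM.2.1 hM.2.2
    exact ⟨(M', z), Finset.mem_product.2 ⟨mem_mapSet.2 hM', Finset.mem_univ _⟩, rfl⟩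
  · intro _ _
    rfl

end

/-! #### Subdividing an edge -/

section
variable {s g : ℕ} {D : Type} [Fintype D] [DecidableEq D]

/-- The edges after the edge of `b` is subdivided: `none` is paired with `b` and `some none` with
the former partner of `b`. -/
def subdivideEdge (e : Perm D) (b : D) : Perm (Option (Option D)) :=
  swap (some (some b)) (some none) * (extPerm e * swap none (some none)) *
    swap (some (some b)) (some none)

section
variable {e : Perm D} {b : D}

omit [Fintype D] in
theorem subdivideEdge_none : subdivideEdge e b none = some (some b) := by
  simp [subdivideEdge, swap_apply_of_ne_of_ne]

omit [Fintype D] in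
theorem subdivideEdge_some_none (hb : e b ≠ b) :
    subdivideEdge e b (some none) = some (some (e b)) := by
  simp [subdivideEdge, swap_apply_of_ne_of_ne, hb]

omit [Fintype D] in
theorem subdivideEdge_self : subdivideEdge e b (some (some b)) = none := by
  simp [subdivideEdge, swap_apply_of_ne_of_ne]

omit [Fintype D] in
theorem subdivideEdge_partner (he : ∀ x, e (e x) = x) (hb : e b ≠ b) :
    subdivideEdge e b (some (some (e b))) = some none := by
  simp [subdivideEdge, swap_apply_of_ne_of_ne, hb, he]

omit [Fintype D] in
theorem subdivideEdge_of_ne (he : ∀ x, e (e x) = x) {x : D} (h1 : x ≠ b) (h2 : x ≠ e b) :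
    subdivideEdge e b (some (some x)) = some (some (e x)) := by
  have h3 : e x ≠ b := fun h => h2 (by rw [← h, he])
  simp [subdivideEdge, swap_apply_of_ne_of_ne, h1, h3]

end

/-- The map obtained from `M` by subdividing the edge of `b` by a vertex of valence two, whose
half-edges are `none`, facing `b`, and `some none`. -/
def subdivide (M : Triple s D) (b : D) : Triple s (Option (Option D)) :=
  (extPerm M.1 * swap none (some none),
    subdivideEdge M.2.1 b, extFun (M.2.1 b) b M.2.2)

theorem conj_swap_mem_pairings {e : Perm D} (x y : D) :
    swap x y * e * swap x y ∈ pairings Finset.univ ↔ e ∈ pairings Finset.univ := by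
  have h : ∀ e : Perm D, e ∈ pairings Finset.univ →
      swap x y * e * swap x y ∈ pairings Finset.univ := by
    intro e he
    rw [mem_pairings] at he ⊢
    refine ⟨fun d => by simp [he.1], fun d => ?_⟩
    have h1 := (he.2 (swap x y d)).2 (Finset.mem_univ _)
    refine iff_of_true (fun h2 => h1 ?_) (Finset.mem_univ _)
    have h3 := congrArg (swap x y) h2
    simpa using h3
  refine ⟨fun h' => ?_, h e⟩
  have := h _ h'
  simpa [mul_assoc] using this

theorem subdivideEdge_mem_pairings {e : Perm D} (b : D) :
    subdivideEdge e b ∈ pairings Finset.univ ↔ e ∈ pairings Finset.univ := by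
  rw [subdivideEdge, conj_swap_mem_pairings, extPerm_mul_swap_mem_pairings]

/-- A triple with a bivalent vertex is a map exactly if it is so after this vertex is erased. The two new
half-edges lie in the faces on the two sides of the subdivided edge. -/
theorem isMap_subdivide_iff {v e : Perm D} (he : ∀ x, e (e x) = x) {b : D} (hb : e b ≠ b)
    (ℓ : Option (Option D) → Fin s) :
    IsMap s g (extPerm v * swap none (some none),
      subdivideEdge e b, ℓ) ↔
      ∃ ℓ', ℓ = extFun (e b) b ℓ' ∧ IsMap s g (v, e, ℓ') := by
  have v1 : (extPerm v * swap none (some none) : Perm (Option (Option D))) none = some none := by simp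
  have v2 : (extPerm v * swap none (some none) : Perm (Option (Option D))) (some none) = none := by
    simp
  have v3 : ∀ x, (extPerm v * swap none (some none) : Perm (Option (Option D))) (some (some x)) =
      some (some (v x)) := fun x => by simp [swap_apply_of_ne_of_ne]
  have e1 : subdivideEdge e b none = _ := subdivideEdge_none
  have e2 := subdivideEdge_some_none hb
  have e3 : subdivideEdge e b (some (some b)) = _ := subdivideEdge_self
  have e4 := subdivideEdge_partner he hb
  have e5 : ∀ x, x ≠ b → x ≠ e b → subdivideEdge e b (some (some x)) = _ :=
    fun x => subdivideEdge_of_ne he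
  have hpair := subdivideEdge_mem_pairings (e := e) b
  generalize extPerm v * swap none (some none) = v'' at *
  generalize subdivideEdge e b = e'' at *
  have hinvv : ∀ {K : Type} (f : Option (Option D) → K), (∀ x, f (v'' x) = f x) ↔
      (∀ x, f (some (some (v x))) = f (some (some x))) ∧ f none = f (some none) := by
    intro K f
    rw [forall_option_option, v1, v2]
    simp only [v3]
    exact ⟨fun h => ⟨h.2.2, h.2.1⟩, fun h => ⟨h.2.symm, h.2, h.1⟩⟩
  refine isMap_extFun_iff (p' := b) (q' := b) hpair ?_ ?_ ?_ ℓ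
  · refine cyc_eq_of_invariant ?_
    rw [pow_one, show 2 = Nat.card Bool by simp, ← Nat.card_prod]
    let F : Bool → (D → Bool) → Option (Option D) → Bool := fun b f x =>
      x.elim b fun x => x.elim b f
    refine Nat.card_congr ⟨fun f => (f.1 (some none), ⟨fun x => f.1 (some (some x)),
      ((hinvv f.1).1 f.2).1⟩), fun q => ⟨F q.1 q.2.1, (hinvv (F q.1 q.2.1)).2 ⟨q.2.2, rfl⟩⟩,
      fun f => ?_, fun q => rfl⟩
    ext x
    rcases x with _ | _ | x
    · exact ((hinvv f.1).1 f.2).2.symm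
    · rfl
    · rfl
  · intro K f
    rw [forall_option_option, e1, e2, v3, v3]
    constructor
    · rintro ⟨h1, h2, h3⟩
      have hb1 := h3 b
      have hb2 := h3 (e b)
      rw [e3, v1] at hb1
      rw [e4, v2] at hb2
      refine ⟨fun x => ?_, hb2, hb1⟩
      by_cases hx : x = b
      · rw [hx, h2, hb1]
      by_cases hx' : x = e b
      · rw [hx', he, h1, hb2]
      · rw [← v3, ← e5 x hx hx', h3]
    · rintro ⟨h1, h2, h3⟩
      have hb1 := h1 b
      have hb2 := h1 (e b)
      rw [he] at hb2
      refine ⟨by rw [hb2, h2], by rw [hb1, h3], fun x => ?_⟩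
      by_cases hx : x = b
      · rw [hx, e3, v1, h3]
      by_cases hx' : x = e b
      · rw [hx', e4, v2, h2]
      · rw [e5 x hx hx', v3, h1]
  · intro f
    rw [hinvv f, forall_option_option (p := fun x => f (e'' x) = f x), e1, e2]
    constructor
    · rintro ⟨⟨h1, h2⟩, h3, h4, h5⟩
      refine ⟨⟨h1, fun x => ?_⟩, h3.symm, by rw [← h2, h3]⟩
      by_cases hx : x = b
      · rw [hx, h4, ← h2, h3]
      by_cases hx' : x = e b
      · rw [hx', he, h4, ← h2, h3]
      · rw [← e5 x hx hx', h5]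
    · rintro ⟨⟨h1, h5⟩, h2, h3⟩
      refine ⟨⟨h1, by rw [h2, h3]⟩, h2.symm, by rw [h5, h3], fun x => ?_⟩
      by_cases hx : x = b
      · rw [hx, e3, h2]
      by_cases hx' : x = e b
      · rw [hx', e4, h5, h3]
      · rw [e5 x hx hx', h5]

omit [Fintype D] in
theorem subdivide_injective {M M' : Triple s D} {b b' : D} (h : subdivide M b = subdivide M' b') :
    M = M' ∧ b = b' := by
  have h1 : extPerm M.1 * swap none (some none) = extPerm M'.1 * swap none (some none) :=
    congrArg Prod.fst h
  have h2 : (subdivide M b).2.1 = (subdivide M' b').2.1 := congrArg (fun M => M.2.1) h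
  have h3 : extFun (M.2.1 b) b M.2.2 = extFun (M'.2.1 b') b' M'.2.2 := congrArg (fun M => M.2.2) h
  have hb : b = b' := by
    have a := Equiv.congr_fun h2 none
    simpa [subdivide, subdivideEdge_none] using a
  subst hb
  have h4 := mul_right_cancel (mul_left_cancel (mul_right_cancel h2))
  refine ⟨Prod.ext (extPerm_injective (mul_right_cancel h1)) (Prod.ext (extPerm_injective h4)
    (funext fun x => ?_)), rfl⟩
  exact congrFun h3 (some (some x))

/-- Removal of a vertex of valence two. -/
theorem exists_eq_subdivide [Nonempty D] {M : Triple s (Option (Option D))} (hM : IsMap s g M)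
    (hv : M.1 none = some none) (hv' : M.1 (some none) = none) :
    ∃ M' b, IsMap s g M' ∧ M = subdivide M' b := by
  obtain ⟨v, e, ℓ⟩ := M
  simp only at hv hv'
  have hp := mem_pairings.1 hM.pairing
  simp only at hp
  obtain ⟨x₀⟩ := ‹Nonempty D›
  -- otherwise the new vertex with its loop would be a component of its own
  have hea : e none ≠ some none := by
    intro hea
    have hea' : e (some none) = none := by rw [← hea, hp.1]
    have := hM.conn (fun x => x = none ∨ x = some none) (fun x => ?_) (fun x => ?_) none
      (some (some x₀))
    · simp at this
    · have h1 : v x = none ↔ x = some none := by rw [← v.injective.eq_iff (a := x), hv']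
      have h2 : v x = some none ↔ x = none := by rw [← v.injective.eq_iff (a := x), hv]
      simp only [h1, h2, or_comm]
    · have h1 : e x = none ↔ x = some none := by rw [← e.injective.eq_iff (a := x), hea']
      have h2 : e x = some none ↔ x = none := by rw [← e.injective.eq_iff (a := x), hea]
      simp only [h1, h2, or_comm]
  obtain ⟨b, hb⟩ : ∃ b, e none = some (some b) := by
    rcases h : e none with _ | _ | b
    · exact absurd h ((hp.2 _).2 (Finset.mem_univ _))
    · exact absurd h hea
    · exact ⟨b, rfl⟩
  have hb' : e (some (some b)) = none := by rw [← hb, hp.1]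
  have hmid : swap (some (some b)) (some none) * e * swap (some (some b)) (some none) ∈
      pairings Finset.univ := (conj_swap_mem_pairings _ _).2 hM.pairing
  obtain ⟨v', hv2⟩ := exists_eq_extPerm (σ := v * swap none (some none)) (by simp [hv'])
    (by simp [hv])
  obtain ⟨e', he2⟩ := exists_eq_extPerm (σ := swap (some (some b)) (some none) * e *
    swap (some (some b)) (some none) * swap none (some none)) (by simp [hb', swap_apply_of_ne_of_ne])
    (by simp [hb, swap_apply_of_ne_of_ne])
  have hv3 : v = extPerm v' * swap none (some none) := by
    rw [← hv2, mul_assoc, swap_mul_self, mul_one]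
  have he3 : extPerm e' * swap none (some none) = swap (some (some b)) (some none) * e *
      swap (some (some b)) (some none) := by
    rw [← he2, mul_assoc _ (swap none (some none)), swap_mul_self, mul_one]
  have he4 : e = subdivideEdge e' b := by
    rw [subdivideEdge, he3]
    simp [mul_assoc]
  rw [← he3, extPerm_mul_swap_mem_pairings, mem_pairings] at hmid
  rw [hv3, he4, isMap_subdivide_iff hmid.1 ((hmid.2 b).2 (Finset.mem_univ _))] at hM
  obtain ⟨ℓ', hℓ, hM'⟩ := hM
  exact ⟨(v', e', ℓ'), b, hM', by rw [subdivide, hv3, he4, hℓ]⟩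

open Classical in
/-- A map with a given bivalent vertex is a smaller map together with a half-edge `b`. -/
theorem sum_subdivide [Nonempty D] (Ψ : Triple s (Option (Option D)) → ℂ) :
    ∑ M ∈ mapSet s g (Option (Option D)),
      (if M.1 none = some none ∧ M.1 (some none) = none then Ψ M else 0) =
    ∑ M ∈ mapSet s g D, ∑ b, Ψ (subdivide M b) := by
  rw [← Finset.sum_filter, ← Finset.sum_product']
  symm
  refine Finset.sum_bij (fun p _ => subdivide p.1 p.2) ?_ ?_ ?_ ?_
  · rintro ⟨M, b⟩ h
    have hM := mem_mapSet.1 (Finset.mem_product.1 h).1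
    have hp := mem_pairings.1 hM.pairing
    rw [Finset.mem_filter, mem_mapSet]
    refine ⟨(isMap_subdivide_iff hp.1 ((hp.2 b).2 (Finset.mem_univ _)) _).2 ⟨M.2.2, rfl, hM⟩, ?_, ?_⟩
    · simp [subdivide]
    · simp [subdivide]
  · rintro ⟨M, b⟩ _ ⟨M', b'⟩ _ h
    obtain ⟨rfl, rfl⟩ := subdivide_injective h
    rfl
  · intro M hM
    rw [Finset.mem_filter, mem_mapSet] at hM
    obtain ⟨M', b, hM', rfl⟩ := exists_eq_subdivide hM.1 hM.2.1 hM.2.2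
    exact ⟨(M', b), Finset.mem_product.2 ⟨mem_mapSet.2 hM', Finset.mem_univ _⟩, rfl⟩
  · intro _ _
    rfl

/-! ### Statistics of maps -/

/-- The number of half-edges, or length, of the face `i`. -/
def perim {D : Type} [Fintype D] (M : Triple s D) (i : Fin s) : ℕ :=
  (Finset.univ.filter fun d => M.2.2 d = i).card

/-- The number of leaves in the face `i`. -/
def leafCount {D : Type} [Fintype D] [DecidableEq D] (M : Triple s D) (i : Fin s) : ℕ :=
  (Finset.univ.filter fun d => M.1 d = d ∧ M.2.2 d = i).card

/-- The number of half-edges at vertices of valence two. -/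
def bivalCount {D : Type} [Fintype D] [DecidableEq D] (M : Triple s D) : ℕ :=
  (Finset.univ.filter fun d => M.1 d ≠ d ∧ M.1 (M.1 d) = d).card

variable {D' : Type} [Fintype D'] [DecidableEq D']

omit [DecidableEq D] [DecidableEq D'] in
theorem card_filter_equiv (π : D ≃ D') {p : D → Prop} {p' : D' → Prop} [DecidablePred p]
    [DecidablePred p'] (h : ∀ x, p' (π x) ↔ p x) :
    (Finset.univ.filter p').card = (Finset.univ.filter p).card := by
  symm
  refine Finset.card_bij (fun x _ => π x) (fun x hx => ?_) (fun _ _ _ _ h => π.injective h)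
    (fun y hy => ?_)
  · simpa [h] using hx
  · obtain ⟨x, rfl⟩ := π.surjective y
    exact ⟨x, by simpa [h] using hy, rfl⟩

omit [DecidableEq D] [DecidableEq D'] in
theorem perim_map (π : D ≃ D') (M : Triple s D) : perim (Triple.map π M) = perim M := by
  funext i
  exact card_filter_equiv π fun x => by rw [Triple.map_label]

theorem leafCount_map (π : D ≃ D') (M : Triple s D) :
    leafCount (Triple.map π M) = leafCount M := by
  funext i
  exact card_filter_equiv π fun x => by
    rw [Triple.map_label, Triple.map_fst, π.injective.eq_iff]

theorem bivalCount_map (π : D ≃ D') (M : Triple s D) :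
    bivalCount (Triple.map π M) = bivalCount M :=
  card_filter_equiv π fun x => by
    rw [Triple.map_fst, Triple.map_fst, Ne, π.injective.eq_iff, π.injective.eq_iff]

omit [Fintype D] [Fintype D'] in
theorem edgeProd_image {K : Type} (ι : D → D') (hι : Function.Injective ι) (A : Finset D)
    {e : Perm D} {e' : Perm D'} (h : ∀ x ∈ A, e' (ι x) = ι (e x)) (W : Sym2 K → ℂ) {r : D → K}
    {r' : D' → K} (hr : ∀ x, r' (ι x) = r x) :
    edgeProd (A.image ι) e' W r' = edgeProd A e W r := by
  have him : (A.image ι).image (fun d => s(d, e' d)) =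
      (A.image fun d => s(d, e d)).image (Sym2.map ι) := by
    rw [Finset.image_image, Finset.image_image]
    exact Finset.image_congr fun x hx => by simp [h x hx]
  unfold edgeProd
  rw [him, Finset.prod_image fun _ _ _ _ h => Sym2.map.injective hι h]
  refine Finset.prod_congr rfl fun q _ => ?_
  rw [Sym2.map_map]
  congr 2
  funext x
  exact hr x

theorem edgeProd_map {W : Sym2 (Fin s) → ℂ} (π : D ≃ D') (M : Triple s D) :
    edgeProd Finset.univ (Triple.map π M).2.1 W (Triple.map π M).2.2 =
      edgeProd Finset.univ M.2.1 W M.2.2 := by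
  rw [← edgeProd_image π π.injective Finset.univ (fun x _ => Triple.map_snd π M x) W
    (Triple.map_label π M), Finset.image_univ_of_surjective π.surjective]

omit [Fintype D] in
theorem edgeProd_eq_mul {K : Type} {A : Finset D} {e : Perm D} (he : ∀ x, e (e x) = x) {d : D}
    (hd : d ∈ A) (W : Sym2 K → ℂ) (r : D → K) :
    edgeProd A e W r = W s(r d, r (e d)) * edgeProd ((A.erase d).erase (e d)) e W r := by
  have him : A.image (fun d => s(d, e d)) =
      insert s(d, e d) (((A.erase d).erase (e d)).image fun d => s(d, e d)) := by
    ext q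
    simp only [Finset.mem_image, Finset.mem_insert, Finset.mem_erase]
    constructor
    · rintro ⟨x, hx, rfl⟩
      by_cases h1 : x = d
      · left; rw [h1]
      by_cases h2 : x = e d
      · left; rw [h2, he, Sym2.eq_swap]
      · exact Or.inr ⟨x, ⟨h2, h1, hx⟩, rfl⟩
    · rintro (rfl | ⟨x, hx, rfl⟩)
      · exact ⟨d, hd, rfl⟩
      · exact ⟨x, hx.2.2, rfl⟩
  unfold edgeProd
  rw [him, Finset.prod_insert]
  · rfl
  · simp only [Finset.mem_image, Finset.mem_erase, Sym2.eq_iff, not_exists, not_and]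
    rintro x ⟨h1, h2, -⟩ (⟨h, -⟩ | ⟨h, -⟩)
    · exact h2 h
    · exact h1 h

omit [DecidableEq D] in
theorem card_filter_option_option (p : Option (Option D) → Prop) [DecidablePred p] :
    (Finset.univ.filter p).card = (if p none then 1 else 0) + (if p (some none) then 1 else 0) +
      (Finset.univ.filter fun x => p (some (some x))).card := by
  simp only [Finset.card_filter, Fintype.sum_option]
  ring

theorem perim_addLeaf (M : Triple s D) (z : D) :
    perim (addLeaf M z) = perim M + 2 * Pi.single (M.2.2 (M.1 z)) 1 := by
  funext i
  rw [perim, card_filter_option_option]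
  change (if M.2.2 (M.1 z) = i then 1 else 0) + (if M.2.2 (M.1 z) = i then 1 else 0) + perim M i =
    perim M i + 2 * (Pi.single (M.2.2 (M.1 z)) 1 : Fin s → ℕ) i
  rw [Pi.single_apply]
  simp only [eq_comm (a := i)]
  by_cases h : M.2.2 (M.1 z) = i <;> simp only [h, if_true, if_false] <;> ring

theorem leafCount_addLeaf (M : Triple s D) (z : D) : leafCount (addLeaf M z) =
    if M.1 z = z then leafCount M else leafCount M + Pi.single (M.2.2 (M.1 z)) 1 := by
  funext i
  have h1 : ∀ x, (extPerm M.1 * swap (some (some z)) none : Perm (Option (Option D))) (some (some x)) =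
      some (some x) ↔ x ≠ z ∧ M.1 x = x := by
    intro x
    by_cases hx : x = z
    · simp [hx]
    · simp [swap_apply_of_ne_of_ne, hx]
  have h2 : (extPerm M.1 * swap (some (some z)) none : Perm (Option (Option D))) (some none) =
      some none := by simp [swap_apply_of_ne_of_ne]
  have h3 : (extPerm M.1 * swap (some (some z)) none : Perm (Option (Option D))) none ≠ none := by
    simp
  rw [leafCount, card_filter_option_option]
  simp only [addLeaf, h1, h2, h3, extFun, false_and, if_false, true_and, zero_add]
  by_cases h4 : M.1 z = z
  · rw [if_pos h4, leafCount]
    by_cases h5 : M.2.2 (M.1 z) = i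
    · have : Finset.univ.filter (fun x => M.1 x = x ∧ M.2.2 x = i) =
          insert z (Finset.univ.filter fun x => (x ≠ z ∧ M.1 x = x) ∧ M.2.2 x = i) := by
        ext x
        simp only [Finset.mem_filter, Finset.mem_univ, true_and, Finset.mem_insert]
        by_cases hx : x = z
        · rw [hx]; rw [h4] at h5; simp [h4, h5]
        · simp [hx]
      rw [this, Finset.card_insert_of_notMem (by simp), if_pos h5, add_comm]
    · rw [if_neg h5, zero_add]
      congr 1
      ext x
      simp only [Finset.mem_filter, Finset.mem_univ, true_and]
      by_cases hx : x = z
      · rw [hx]; rw [h4] at h5; simp [h4, h5]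
      · simp [hx]
  · have hz : ∀ x, (x ≠ z ∧ M.1 x = x) ↔ M.1 x = x := fun x =>
      ⟨fun h => h.2, fun h => ⟨fun hx => h4 (hx ▸ h), h⟩⟩
    simp only [hz, if_neg h4, Pi.add_apply, leafCount, Pi.single_apply, eq_comm (a := i)]
    ring

omit [Fintype D] in
theorem leafless_subdivide (M : Triple s D) (b : D) :
    (∀ x, (subdivide M b).1 x ≠ x) ↔ ∀ x, M.1 x ≠ x := by
  rw [forall_option_option]
  simp [subdivide, swap_apply_of_ne_of_ne]

theorem bivalCount_subdivide (M : Triple s D) (b : D) :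
    bivalCount (subdivide M b) = bivalCount M + 2 := by
  simp only [bivalCount, card_filter_option_option]
  simp [subdivide, swap_apply_of_ne_of_ne, add_comm]

theorem edgeProd_subdivide {M : Triple s D} (hp : M.2.1 ∈ pairings Finset.univ) (b : D)
    (W : Sym2 (Fin s) → ℂ) :
    edgeProd Finset.univ (subdivide M b).2.1 W (subdivide M b).2.2 =
      W s(M.2.2 b, M.2.2 (M.2.1 b)) * edgeProd Finset.univ M.2.1 W M.2.2 := by
  have hp'' := (subdivideEdge_mem_pairings b).2 hp
  rw [mem_pairings] at hp hp''
  obtain ⟨v, e, ℓ⟩ := M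
  simp only at hp hp''
  have hb : e b ≠ b := (hp.2 b).2 (Finset.mem_univ _)
  have e1 : subdivideEdge e b none = _ := subdivideEdge_none
  have e2 := subdivideEdge_some_none hb
  have e5 : ∀ x, x ≠ b → x ≠ e b → subdivideEdge e b (some (some x)) = _ :=
    fun x => subdivideEdge_of_ne hp.1
  simp only [subdivide]
  generalize subdivideEdge e b = e'' at *
  rw [edgeProd_eq_mul hp''.1 (d := none) (Finset.mem_univ _),
    edgeProd_eq_mul hp''.1 (d := some none) (by simp [e1]),
    edgeProd_eq_mul hp.1 (Finset.mem_univ b), e1, e2]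
  have hset : ((((Finset.univ : Finset (Option (Option D))).erase none).erase
      (some (some b))).erase (some none)).erase (some (some (e b))) =
      (((Finset.univ : Finset D).erase b).erase (e b)).image fun x => some (some x) := by
    ext x
    rcases x with _ | _ | x <;> simp
  rw [hset, edgeProd_image (fun x : D => some (some x)) (fun x y h => by simpa using h) _
    (fun x hx => e5 x (by simp at hx; exact hx.2) (by simp at hx; exact hx.1)) W
    (r := ℓ) (r' := extFun (e b) b ℓ) (fun x => rfl)]
  simp only [extFun, Sym2.eq_swap (a := ℓ (e b)) (b := ℓ b)]

end

/-! ### Counting maps with a distinguished leaf or bivalent vertex -/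

section
variable {s g : ℕ}

open Classical in
/-- Removal of a distinguished leaf in the face `i`. The factor `(n + 2) (n + 1)` is the number of
positions of the removed edge, and the remaining sum runs over the corners of the smaller map. -/
theorem sum_leafCount_mul {n : ℕ} (hn : n ≠ 0) (i : Fin s) (Θ : (Fin s → ℕ) → (Fin s → ℕ) → ℂ) :
    ∑ M ∈ mapSet s g (Fin (n + 2)), (leafCount M i : ℂ) * Θ (perim M) (leafCount M) =
      ((n : ℂ) + 2) * ((n : ℂ) + 1) * ∑ M ∈ mapSet s g (Fin n),
        (((perim M i : ℂ) - leafCount M i) *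
            Θ (perim M + 2 * Pi.single i 1) (leafCount M + Pi.single i 1) +
          leafCount M i * Θ (perim M + 2 * Pi.single i 1) (leafCount M)) := by
  have : NeZero n := ⟨hn⟩
  have hE : Fintype.card (Option (Option (Fin n))) = n + 2 := by simp
  rw [sum_mapSet_congr (Fintype.equivFinOfCardEq hE).symm _
    (fun M => (leafCount M i : ℂ) * Θ (perim M) (leafCount M))
    (fun M => by rw [leafCount_map, perim_map])]
  let Ψ : Triple s (Option (Option (Fin n))) → Option (Option (Fin n)) → Option (Option (Fin n)) →
    ℂ := fun M a b => if M.1 b = b ∧ M.2.1 a = b then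
      (if M.2.2 b = i then Θ (perim M) (leafCount M) else 0) else 0
  have h1 : ∑ M ∈ mapSet s g (Option (Option (Fin n))),
      (leafCount M i : ℂ) * Θ (perim M) (leafCount M) =
      ∑ M ∈ mapSet s g (Option (Option (Fin n))), ∑ a, ∑ b, (if a = b then 0 else Ψ M a b) := by
    refine Finset.sum_congr rfl fun M hM => ?_
    have hp := mem_pairings.1 (mem_mapSet.1 hM).pairing
    rw [Finset.sum_comm]
    have h2 : ∀ b, ∑ a, (if a = b then 0 else Ψ M a b) =
        if M.1 b = b ∧ M.2.2 b = i then Θ (perim M) (leafCount M) else 0 := by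
      intro b
      rw [Finset.sum_eq_single (M.2.1 b)]
      · have : M.2.1 b ≠ b := (hp.2 b).2 (Finset.mem_univ _)
        simp only [this, if_false, Ψ, hp.1, and_true]
        split_ifs <;> simp_all
      · intro a _ ha
        have : M.2.1 a ≠ b := fun h => ha (by rw [← h, hp.1])
        simp [Ψ, this]
      · simp
    rw [Finset.sum_congr rfl fun b _ => h2 b, ← Finset.sum_filter, Finset.sum_const, nsmul_eq_mul]
    rfl
  rw [h1, sum_mapSet_pair Ψ ?_ (a₀ := none) (b₀ := some none) (by simp), hE]
  · simp only [Ψ]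
    rw [sum_addLeaf fun M => if M.2.2 (some none) = i then Θ (perim M) (leafCount M) else 0]
    push_cast
    rw [show (n : ℂ) + 2 - 1 = n + 1 by ring]
    congr 1
    refine Finset.sum_congr rfl fun M _ => ?_
    -- attaching the new leaf at a corner `z` raises the number of leaves by one, unless `z` itself was a leaf
    have h3 : ∀ z, (if (addLeaf M z).2.2 (some none) = i then
        Θ (perim (addLeaf M z)) (leafCount (addLeaf M z)) else 0) =
        (if M.2.2 (M.1 z) = i then
          Θ (perim M + 2 * Pi.single i 1) (leafCount M + Pi.single i 1) else 0) +
        (if M.1 z = z ∧ M.2.2 z = i then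
          Θ (perim M + 2 * Pi.single i 1) (leafCount M) -
          Θ (perim M + 2 * Pi.single i 1) (leafCount M + Pi.single i 1) else 0) := by
      intro z
      rw [perim_addLeaf, leafCount_addLeaf]
      change (if M.2.2 (M.1 z) = i then _ else 0) = _
      by_cases hi : M.2.2 (M.1 z) = i
      · rw [if_pos hi, if_pos hi]
        by_cases hz : M.1 z = z
        · rw [hz] at hi
          simp [hz, hi]
        · simp [hz, hi]
      · rw [if_neg hi, if_neg hi, if_neg, add_zero]
        rintro ⟨h, h'⟩
        rw [h] at hi
        exact hi h'
    rw [Finset.sum_congr rfl fun z _ => h3 z, Finset.sum_add_distrib, ← Finset.sum_filter,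
      Finset.sum_const, ← Finset.sum_filter, Finset.sum_const, nsmul_eq_mul, nsmul_eq_mul]
    have h4 : (Finset.univ.filter fun z => M.2.2 (M.1 z) = i).card = perim M i :=
      (card_filter_equiv M.1 (p := fun z => M.2.2 (M.1 z) = i) (p' := fun d => M.2.2 d = i)
        fun x => Iff.rfl).symm
    rw [h4]
    change _ + (leafCount M i : ℂ) * _ = _
    ring
  · intro π M a b
    simp only [Ψ, Triple.map_fst, Triple.map_snd, Triple.map_label, π.injective.eq_iff, perim_map,
      leafCount_map]

open Classical in
/-- Removal of a distinguished vertex of valence two. -/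
theorem sum_bivalCount_mul {n : ℕ} (hn : n ≠ 0) (W : Sym2 (Fin s) → ℂ) (Θ : ℕ → ℂ) :
    ∑ M ∈ (mapSet s g (Fin (n + 2))).filter (fun M => ∀ x, M.1 x ≠ x),
      (bivalCount M : ℂ) * (Θ (bivalCount M) * edgeProd Finset.univ M.2.1 W M.2.2) =
    ((n : ℂ) + 2) * ((n : ℂ) + 1) *
      ∑ M ∈ (mapSet s g (Fin n)).filter (fun M => ∀ x, M.1 x ≠ x),
        (∑ b, W s(M.2.2 b, M.2.2 (M.2.1 b))) *
          (Θ (bivalCount M + 2) * edgeProd Finset.univ M.2.1 W M.2.2) := by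
  have : NeZero n := ⟨hn⟩
  have hE : Fintype.card (Option (Option (Fin n))) = n + 2 := by simp
  rw [Finset.sum_filter, Finset.sum_filter]
  have hl : ∀ {D D' : Type} [Fintype D] [DecidableEq D] [Fintype D'] [DecidableEq D'] (π : D ≃ D')
      (M : Triple s D), (∀ x, (Triple.map π M).1 x ≠ x) ↔ ∀ x, M.1 x ≠ x := by
    intro D D' _ _ _ _ π M
    rw [← π.forall_congr_right]
    simp only [Triple.map_fst, Ne, π.injective.eq_iff]
  rw [sum_mapSet_congr (Fintype.equivFinOfCardEq hE).symm _
    (fun M => if ∀ x, M.1 x ≠ x then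
      (bivalCount M : ℂ) * (Θ (bivalCount M) * edgeProd Finset.univ M.2.1 W M.2.2) else 0)
    (fun M => by simp only [bivalCount_map, edgeProd_map, hl])]
  let Φ : Triple s (Option (Option (Fin n))) → ℂ := fun M =>
    if ∀ x, M.1 x ≠ x then Θ (bivalCount M) * edgeProd Finset.univ M.2.1 W M.2.2 else 0
  let Ψ : Triple s (Option (Option (Fin n))) → Option (Option (Fin n)) → Option (Option (Fin n)) →
    ℂ := fun M a b => if M.1 a = b ∧ M.1 b = a then Φ M else 0
  have h1 : ∑ M ∈ mapSet s g (Option (Option (Fin n))), (if ∀ x, M.1 x ≠ x then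
      (bivalCount M : ℂ) * (Θ (bivalCount M) * edgeProd Finset.univ M.2.1 W M.2.2) else 0) =
      ∑ M ∈ mapSet s g (Option (Option (Fin n))), ∑ a, ∑ b, (if a = b then 0 else Ψ M a b) := by
    refine Finset.sum_congr rfl fun M _ => ?_
    have h2 : ∀ a, ∑ b, (if a = b then 0 else Ψ M a b) =
        if M.1 a ≠ a ∧ M.1 (M.1 a) = a then Φ M else 0 := by
      intro a
      rw [Finset.sum_eq_single (M.1 a)]
      · by_cases h : M.1 a = a
        · simp [h]
        · have h' : ¬ a = M.1 a := fun h' => h h'.symm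
          simp [h, h', Ψ]
      · intro b _ hb
        simp [Ψ, hb.symm]
      · simp
    rw [Finset.sum_congr rfl fun b _ => h2 b, ← Finset.sum_filter, Finset.sum_const, nsmul_eq_mul]
    change _ = (bivalCount M : ℂ) * Φ M
    simp only [Φ]
    split_ifs <;> ring
  rw [h1, sum_mapSet_pair Ψ ?_ (a₀ := none) (b₀ := some none) (by simp), hE]
  · simp only [Ψ]
    rw [sum_subdivide Φ]
    push_cast
    rw [show (n : ℂ) + 2 - 1 = n + 1 by ring]
    congr 1
    refine Finset.sum_congr rfl fun M hM => ?_
    have hp := (mem_mapSet.1 hM).pairing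
    simp only [Φ, leafless_subdivide, bivalCount_subdivide, edgeProd_subdivide hp]
    split_ifs with h
    · rw [Finset.sum_mul]
      exact Finset.sum_congr rfl fun b _ => by ring
    · simp
  · intro π M a b
    simp only [Ψ, Φ, Triple.map_fst, π.injective.eq_iff, bivalCount_map, edgeProd_map, hl]

theorem sum_perim {D : Type} [Fintype D] (M : Triple s D) : ∑ i, perim M i = Fintype.card D := by
  unfold perim
  rw [← Finset.card_eq_sum_card_fiberwise (fun _ _ => Finset.mem_univ _), Finset.card_univ]

/-- The Euler characteristic excludes the maps with fewer than two edges. -/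
theorem IsMap.four_le {D : Type} [Fintype D] [DecidableEq D] {M : Triple s D} (h : IsMap s g M)
    (hs : 1 ≤ s) (hg : 2 < 2 * g + s) : 4 ≤ Fintype.card D := by
  have h1 := h.genus
  obtain ⟨x, -⟩ := h.surj ⟨0, hs⟩
  have : 0 < cyc M.1 := by
    have : Nonempty (Quotient (Perm.SameCycle.setoid M.1)) := ⟨Quotient.mk _ x⟩
    exact Nat.card_pos
  omega

variable (s g) in
/-- The weighted number of maps with faces of lengths `k`, and with `ρ i` marked leaves in the face
`i`. -/
noncomputable def markedCount (k ρ : Fin s → ℕ) : ℂ :=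
  1 / ((∑ i, k i).factorial : ℂ) * ∑ M ∈ mapSet s g (Fin (∑ i, k i)),
    if perim M = k then ∏ i, ((leafCount M i).choose (ρ i) : ℂ) else 0

theorem markedCount_of_sum_eq {k ρ : Fin s → ℕ} {n : ℕ} (h : ∑ i, k i = n) :
    markedCount s g k ρ = 1 / (n.factorial : ℂ) * ∑ M ∈ mapSet s g (Fin n),
      if perim M = k then ∏ i, ((leafCount M i).choose (ρ i) : ℂ) else 0 := by
  subst h
  rfl

theorem cast_mul_choose_pred (l r : ℕ) :
    (l : ℂ) * ((l - 1).choose r : ℂ) = ((r : ℂ) + 1) * (l.choose (r + 1) : ℂ) := by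
  rcases l with _ | l
  · simp
  · have := Nat.add_one_mul_choose_eq l r
    rw [Nat.add_sub_cancel, mul_comm ((r : ℂ) + 1)]
    exact_mod_cast this

theorem cast_choose_absorb (l r : ℕ) :
    ((r : ℂ) + 1) * (l.choose (r + 1) : ℂ) = ((l : ℂ) - r) * (l.choose r : ℂ) := by
  rcases le_or_gt r l with h | h
  · have := Nat.choose_succ_right_eq l r
    rw [← Nat.cast_sub h, mul_comm, mul_comm ((l - r : ℕ) : ℂ)]
    exact_mod_cast this
  · rw [Nat.choose_eq_zero_of_lt h, Nat.choose_eq_zero_of_lt (by omega)]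
    simp

open Classical in
/-- The sum computed in two ways by distinguishing one of the marked leaves in the face `i`. -/
theorem markedCount_succ_aux (hs : 1 ≤ s) (hg : 2 < 2 * g + s) (k ρ : Fin s → ℕ) (i : Fin s) :
    ((ρ i : ℂ) + 1) * markedCount s g k (ρ + Pi.single i 1) =
      if 2 ≤ k i then ((k i : ℂ) - 2 - ρ i) * markedCount s g (k - 2 * Pi.single i 1) ρ else 0 := by
  have hprod : ∀ l : Fin s → ℕ, ((ρ i : ℂ) + 1) * ∏ j, ((l j).choose ((ρ + Pi.single i 1 : Fin s → ℕ) j) : ℂ) =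
      l i * (((l i - 1).choose (ρ i) : ℂ) * ∏ j ∈ Finset.univ.erase i, ((l j).choose (ρ j) : ℂ)) := by
    intro l
    rw [← Finset.mul_prod_erase _ _ (Finset.mem_univ i), ← mul_assoc, ← mul_assoc,
      cast_mul_choose_pred]
    congr 1
    · simp
    · refine Finset.prod_congr rfl fun j hj => ?_
      simp [Finset.ne_of_mem_erase hj]
  by_cases hn : ∑ j, k j ≤ 2
  · have h0 : ∀ k ρ : Fin s → ℕ, ∑ j, k j ≤ 2 → markedCount s g k ρ = 0 := by
      intro k ρ hk
      refine mul_eq_zero_of_right _ (Finset.sum_eq_zero fun M hM => ?_)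
      have := (mem_mapSet.1 hM).four_le hs hg
      simp at this
      omega
    have hn' : ∑ j, (k - 2 * Pi.single i 1 : Fin s → ℕ) j ≤ 2 :=
      (Finset.sum_le_sum fun j _ => Nat.sub_le _ _).trans hn
    rw [h0 _ _ hn, h0 _ _ hn']
    simp
  · obtain ⟨n, hkn⟩ : ∃ n, ∑ j, k j = n + 2 := ⟨∑ j, k j - 2, by omega⟩
    have hn0 : n ≠ 0 := by omega
    have h1 := sum_leafCount_mul (s := s) (g := g) hn0 i fun p l => if p = k then
      ((l i - 1).choose (ρ i) : ℂ) * ∏ j ∈ Finset.univ.erase i, ((l j).choose (ρ j) : ℂ) else 0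
    have h2 : ((ρ i : ℂ) + 1) * markedCount s g k (ρ + Pi.single i 1) =
        1 / ((n + 2).factorial : ℂ) * ∑ M ∈ mapSet s g (Fin (n + 2)), (leafCount M i : ℂ) *
          if perim M = k then ((leafCount M i - 1).choose (ρ i) : ℂ) *
            ∏ j ∈ Finset.univ.erase i, ((leafCount M j).choose (ρ j) : ℂ) else 0 := by
      rw [markedCount_of_sum_eq hkn, mul_left_comm, Finset.mul_sum]
      congr 1
      refine Finset.sum_congr rfl fun M _ => ?_
      split_ifs
      · exact hprod _
      · simp
    rw [h2, h1]
    have hf : 1 / ((n + 2).factorial : ℂ) * (((n : ℂ) + 2) * ((n : ℂ) + 1)) =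
        1 / (n.factorial : ℂ) := by
      have : ((n + 2).factorial : ℂ) = ((n : ℂ) + 2) * (((n : ℂ) + 1) * n.factorial) := by
        rw [Nat.factorial_succ, Nat.factorial_succ]; push_cast; ring
      rw [this]
      have a : (n.factorial : ℂ) ≠ 0 := by exact_mod_cast n.factorial_ne_zero
      have b : (n : ℂ) + 1 ≠ 0 := by exact_mod_cast (Nat.succ_ne_zero n)
      have c : (n : ℂ) + 2 ≠ 0 := by exact_mod_cast (Nat.succ_ne_zero (n + 1))
      field_simp
    rw [← mul_assoc, hf]
    have h3 : ∀ p : Fin s → ℕ, p + 2 * Pi.single i 1 = k ↔ 2 ≤ k i ∧ p = k - 2 * Pi.single i 1 := by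
      intro p
      constructor
      · rintro rfl
        refine ⟨by simp, ?_⟩
        funext j
        simp
      · rintro ⟨h, rfl⟩
        funext j
        by_cases hj : j = i
        · subst hj; simp [h]
        · simp [hj]
    split_ifs with h2k
    · have hk' : ∑ j, (k - 2 * Pi.single i 1 : Fin s → ℕ) j = n := by
        have e : ∀ j, k j = (k - 2 * Pi.single i 1 : Fin s → ℕ) j + (2 * Pi.single i 1 : Fin s → ℕ) j := by
          intro j
          exact (congrFun ((h3 _).2 ⟨h2k, rfl⟩) j).symm
        rw [Finset.sum_congr rfl fun j _ => e j, Finset.sum_add_distrib] at hkn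
        have : ∑ j, (2 * Pi.single i 1 : Fin s → ℕ) j = 2 := by
          simp [Pi.single_apply]
        omega
      rw [markedCount_of_sum_eq hk', mul_left_comm]
      congr 1
      rw [Finset.mul_sum]
      refine Finset.sum_congr rfl fun M _ => ?_
      simp only [h3, h2k, true_and]
      split_ifs with hM
      · rw [← Finset.mul_prod_erase _ (fun j => ((leafCount M j).choose (ρ j) : ℂ)) (Finset.mem_univ i)]
        have hpi : (perim M i : ℂ) = k i - 2 := by
          rw [hM]
          simp only [Pi.sub_apply, Pi.mul_apply, Pi.ofNat_apply, Pi.single_eq_same, mul_one]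
          rw [Nat.cast_sub h2k]
          simp
        have hpr : ∏ j ∈ Finset.univ.erase i, (((leafCount M + Pi.single i 1 : Fin s → ℕ) j).choose (ρ j) : ℂ) =
            ∏ j ∈ Finset.univ.erase i, ((leafCount M j).choose (ρ j) : ℂ) := by
          refine Finset.prod_congr rfl fun j hj => ?_
          simp [Finset.ne_of_mem_erase hj]
        rw [hpr, hpi, Pi.add_apply, Pi.single_eq_same, Nat.add_sub_cancel]
        have := cast_mul_choose_pred (leafCount M i) (ρ i)
        rw [cast_choose_absorb] at this
        linear_combination (∏ j ∈ Finset.univ.erase i, ((leafCount M j).choose (ρ j) : ℂ)) * this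
      · simp
    · rw [Finset.sum_eq_zero, mul_zero]
      intro M _
      simp [h3, h2k]

theorem cast_mul_choose_add_pred (k r : ℕ) :
    ((k : ℂ) + r) * ((k + r - 1).choose r : ℂ) = ((r : ℂ) + 1) * ((k + r).choose (r + 1) : ℂ) := by
  rw [← cast_mul_choose_pred (k + r) r]
  push_cast
  rfl

/-- The maps with marked leaves are obtained from maps by inserting the marked leaves. -/
theorem markedCount_add (hs : 1 ≤ s) (hg : 2 < 2 * g + s) (k ρ : Fin s → ℕ) :
    markedCount s g (k + 2 * ρ) ρ =
      (∏ i, ((k i + ρ i - 1).choose (ρ i) : ℂ)) * markedCount s g k 0 := by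
  induction hr : ∑ i, ρ i generalizing ρ with
  | zero =>
    have : ρ = 0 := by
      funext i
      exact (Finset.sum_eq_zero_iff.1 hr) i (Finset.mem_univ i)
    subst this
    simp
  | succ r ih =>
    obtain ⟨i, -, hi⟩ : ∃ i ∈ Finset.univ, ρ i ≠ 0 := by
      apply Finset.exists_ne_zero_of_sum_ne_zero
      omega
    obtain ⟨ρ', rfl⟩ : ∃ ρ' : Fin s → ℕ, ρ = ρ' + Pi.single i 1 := by
      refine ⟨ρ - Pi.single i 1, ?_⟩
      funext j
      by_cases hj : j = i
      · subst hj; simp; omega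
      · simp [hj]
    have hr' : ∑ i, ρ' i = r := by
      simp only [Pi.add_apply, Finset.sum_add_distrib, Finset.sum_pi_single', Finset.mem_univ,
        if_true] at hr
      omega
    have h1 := markedCount_succ_aux hs hg (k + 2 * (ρ' + Pi.single i 1)) ρ' i
    have h2 : k + 2 * (ρ' + Pi.single i 1) - 2 * Pi.single i 1 = k + 2 * ρ' := by
      funext j
      simp only [Pi.add_apply, Pi.sub_apply, Pi.mul_apply, Pi.ofNat_apply]
      omega
    rw [if_pos (by simp; omega), h2, ih ρ' hr'] at h1
    have hne : (ρ' i : ℂ) + 1 ≠ 0 := Nat.cast_add_one_ne_zero _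
    apply mul_left_cancel₀ hne
    rw [h1]
    have hpr : ∏ j ∈ Finset.univ.erase i, ((k j + (ρ' + Pi.single i 1 : Fin s → ℕ) j - 1).choose
        ((ρ' + Pi.single i 1 : Fin s → ℕ) j) : ℂ) =
        ∏ j ∈ Finset.univ.erase i, ((k j + ρ' j - 1).choose (ρ' j) : ℂ) := by
      refine Finset.prod_congr rfl fun j hj => ?_
      simp [Finset.ne_of_mem_erase hj]
    have hR := Finset.mul_prod_erase Finset.univ
      (fun j => ((k j + (ρ' + Pi.single i 1 : Fin s → ℕ) j - 1).choose
        ((ρ' + Pi.single i 1 : Fin s → ℕ) j) : ℂ)) (Finset.mem_univ i)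
    have hL := Finset.mul_prod_erase Finset.univ
      (fun j => ((k j + ρ' j - 1).choose (ρ' j) : ℂ)) (Finset.mem_univ i)
    rw [← hL, ← hR, hpr]
    simp only [Pi.add_apply, Pi.single_eq_same, Pi.mul_apply, Pi.ofNat_apply]
    have h3 := cast_mul_choose_add_pred (k i) (ρ' i)
    rw [show k i + (ρ' i + 1) - 1 = k i + ρ' i by omega]
    push_cast
    linear_combination (∏ j ∈ Finset.univ.erase i, ((k j + ρ' j - 1).choose (ρ' j) : ℂ)) *
      markedCount s g k 0 * h3

/-- A marked leaf takes up two half-edges of its face. -/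
theorem markedCount_eq_zero (hs : 1 ≤ s) (hg : 2 < 2 * g + s) {k ρ : Fin s → ℕ} {j : Fin s}
    (hj : k j < 2 * ρ j) : markedCount s g k ρ = 0 := by
  induction hr : ∑ i, ρ i generalizing k ρ with
  | zero =>
    have := Finset.sum_eq_zero_iff.1 hr j (Finset.mem_univ j)
    omega
  | succ r ih =>
    obtain ⟨ρ', rfl⟩ : ∃ ρ' : Fin s → ℕ, ρ = ρ' + Pi.single j 1 := by
      refine ⟨ρ - Pi.single j 1, ?_⟩
      funext i
      by_cases hi : i = j
      · subst hi; simp; omega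
      · simp [hi]
    have h1 := markedCount_succ_aux hs hg k ρ' j
    have hne : (ρ' j : ℂ) + 1 ≠ 0 := Nat.cast_add_one_ne_zero _
    split_ifs at h1 with h2
    · have hj' : (k - 2 * Pi.single j 1 : Fin s → ℕ) j < 2 * ρ' j := by
        simp only [Pi.add_apply, Pi.sub_apply, Pi.mul_apply, Pi.ofNat_apply,
          Pi.single_eq_same] at hj ⊢
        omega
      have hr' : ∑ i, ρ' i = r := by
        simp only [Pi.add_apply, Finset.sum_add_distrib, Finset.sum_pi_single', Finset.mem_univ,
          if_true] at hr
        omega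
      rw [ih hj' hr'] at h1
      simpa [hne] using h1
    · simpa [hne] using h1

variable (s g) in
open Classical in
/-- The weighted number of leafless maps with faces of lengths `p`. -/
noncomputable def leaflessCount (p : Fin s → ℕ) : ℂ :=
  1 / ((∑ i, p i).factorial : ℂ) *
    ((mapSet s g (Fin (∑ i, p i))).filter fun M => (∀ x, M.1 x ≠ x) ∧ perim M = p).card

/-- Inclusion–exclusion over sets of marked leaves. -/
theorem leaflessCount_eq_sum (p : Fin s → ℕ) :
    leaflessCount s g p = ∑ ρ ∈ Fintype.piFinset fun i => Finset.range (p i + 1),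
      (-1) ^ (∑ i, ρ i) * markedCount s g p ρ := by
  classical
  simp only [markedCount, leaflessCount]
  simp only [mul_left_comm _ (1 / _ : ℂ)]
  rw [← Finset.mul_sum]
  congr 1
  simp only [Finset.mul_sum]
  rw [Finset.sum_comm, Finset.card_filter, Nat.cast_sum]
  refine Finset.sum_congr rfl fun M _ => ?_
  by_cases hp : perim M = p
  · simp only [hp, if_true, and_true]
    have h1 : ∀ ρ : Fin s → ℕ, (-1 : ℂ) ^ (∑ i, ρ i) * ∏ i, ((leafCount M i).choose (ρ i) : ℂ) =
        ∏ i, ((-1 : ℂ) ^ ρ i * ((leafCount M i).choose (ρ i) : ℂ)) := by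
      intro ρ
      rw [Finset.prod_mul_distrib, Finset.prod_pow_eq_pow_sum]
    simp only [h1]
    rw [← Finset.prod_univ_sum (fun i => Finset.range (p i + 1))
      fun i r => (-1 : ℂ) ^ r * ((leafCount M i).choose r : ℂ)]
    have h2 : ∀ i, ∑ r ∈ Finset.range (p i + 1), (-1 : ℂ) ^ r * ((leafCount M i).choose r : ℂ) =
        if leafCount M i = 0 then 1 else 0 := by
      intro i
      have hle : leafCount M i ≤ p i := by
        refine le_of_le_of_eq (b := perim M i) (Finset.card_le_card fun x hx => ?_)
          (congrFun hp i)
        simp only [Finset.mem_filter] at hx ⊢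
        exact ⟨hx.1, hx.2.2⟩
      have h3 : ∑ r ∈ Finset.range (p i + 1), (-1 : ℂ) ^ r * ((leafCount M i).choose r : ℂ) =
          ∑ r ∈ Finset.range (leafCount M i + 1), (-1 : ℂ) ^ r * ((leafCount M i).choose r : ℂ) := by
        symm
        refine Finset.sum_subset (Finset.range_mono (by omega)) fun r _ hr => ?_
        rw [Finset.mem_range, not_lt] at hr
        rw [Nat.choose_eq_zero_of_lt (by omega)]
        simp
      rw [h3]
      have := Int.alternating_sum_range_choose (n := leafCount M i)
      exact_mod_cast this
    rw [Finset.prod_congr rfl fun i _ => h2 i, Finset.prod_boole]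
    push_cast
    congr 1
    simp only [Finset.mem_univ, true_imp_iff, leafCount, Finset.card_eq_zero,
      Finset.filter_eq_empty_iff, eq_iff_iff]
    exact ⟨fun h i x hx => h x hx.1, fun h x hx => h (M.2.2 x) ⟨hx, rfl⟩⟩
  · simp [hp]

end

/-! ### Growing trees: the substitution `u = z / (1 + z ^ 2)` -/

/-- The coefficient of `u ^ k` in `z ^ p`, where `z = u (1 + z ^ 2)`. It counts the ways to attach
plane trees along a face of length `p` so that the face gets the length `k`. -/
def treeCount : ℕ → ℕ → ℕ
  | 0, p => if p = 0 then 1 else 0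
  | _ + 1, 0 => 0
  | k + 1, p + 1 => treeCount k p + treeCount k (p + 2)

/-- The inverse of the matrix `treeCount`. -/
def treeInv : ℕ → ℕ → ℤ
  | 0, 0 => 1
  | _ + 1, 0 => 0
  | 0, _ + 1 => 0
  | 1, j + 1 => treeInv 0 j
  | p + 2, j + 1 => treeInv (p + 1) j - treeInv p (j + 1)

theorem treeCount_zero_right (k : ℕ) : treeCount k 0 = if k = 0 then 1 else 0 := by
  cases k <;> simp [treeCount]

theorem treeCount_eq_zero {k p : ℕ} (h : k < p) : treeCount k p = 0 := by
  induction k generalizing p with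
  | zero => simp [treeCount]; omega
  | succ k ih =>
    obtain ⟨p, rfl⟩ : ∃ q, p = q + 1 := ⟨p - 1, by omega⟩
    simp [treeCount, ih (show k < p by omega), ih (show k < p + 2 by omega)]

theorem treeInv_eq_zero : ∀ p j : ℕ, p < j ∨ (p + j) % 2 = 1 → treeInv p j = 0
  | 0, 0, h => by omega
  | _ + 1, 0, _ => rfl
  | 0, _ + 1, _ => rfl
  | 1, j + 1, h => treeInv_eq_zero 0 j (by omega)
  | p + 2, j + 1, h => by
    rw [treeInv, treeInv_eq_zero (p + 1) j (by omega), treeInv_eq_zero p (j + 1) (by omega),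
      sub_zero]

/-- The closed form of the inverse matrix; these are the coefficients which inclusion–exclusion over sets
of leaves produces by `markedCount_add`. -/
theorem treeInv_add (j r : ℕ) : treeInv (j + 2 * r) j = (-1) ^ r * ((j + r - 1).choose r : ℤ) := by
  induction j generalizing r with
  | zero =>
    rcases r with _ | r
    · simp [treeInv]
    · rw [Nat.choose_eq_zero_of_lt (by omega)]
      simp [Nat.mul_add, treeInv]
  | succ j ihj =>
    induction r with
    | zero =>
      rcases j with _ | j
      · simp [treeInv]
      · have := ihj 0
        simp only [mul_zero, add_zero] at this ⊢
        rw [treeInv, this, treeInv_eq_zero j (j + 2) (by omega)]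
        simp
    | succ r ihr =>
      have h1 := ihj (r + 1)
      have h2 : j + 1 + 2 * (r + 1) = (j + 2 * r + 1) + 2 := by ring
      rw [h2, treeInv, show j + 2 * r + 1 + 1 = j + 2 * (r + 1) by ring, h1,
        show j + 2 * r + 1 = j + 1 + 2 * r by ring, ihr,
        show j + 1 + (r + 1) - 1 = j + r + 1 by omega, show j + 1 + r - 1 = j + r by omega,
        show j + (r + 1) - 1 = j + r by omega, Nat.choose_succ_succ]
      push_cast
      ring

theorem sum_treeCount_succ (k : ℕ) (h : ℕ → ℤ) :
    ∑ p ∈ Finset.range (k + 2), (treeCount (k + 1) p : ℤ) * h p =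
      ∑ p ∈ Finset.range (k + 1), (treeCount k p : ℤ) * (h (p + 1) + if 2 ≤ p then h (p - 1) else 0) := by
  rw [Finset.sum_range_succ']
  simp only [treeCount, Nat.cast_add, add_mul, mul_add, Finset.sum_add_distrib, Nat.cast_zero,
    zero_mul, add_zero]
  congr 1
  have h1 : ∑ p ∈ Finset.range (k + 1), (treeCount k (p + 2) : ℤ) * h (p + 1) =
      ∑ p ∈ Finset.range (k + 3), (treeCount k p : ℤ) * if 2 ≤ p then h (p - 1) else 0 := by
    rw [Finset.sum_range_succ' _ (k + 2), Finset.sum_range_succ' _ (k + 1)]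
    simp
  rw [h1, Finset.sum_range_succ, Finset.sum_range_succ, treeCount_eq_zero (show k < k + 2 by omega),
    treeCount_eq_zero (show k < k + 1 by omega)]
  simp

theorem sum_treeCount_mul_treeInv (k j : ℕ) :
    ∑ p ∈ Finset.range (k + 1), (treeCount k p : ℤ) * treeInv p j = if k = j then 1 else 0 := by
  induction k generalizing j with
  | zero => cases j <;> simp [treeCount, treeInv]
  | succ k ih =>
    rw [sum_treeCount_succ]
    rcases j with _ | j
    · have h : ∀ p, treeInv (p + 1) 0 = 0 := fun p => by rw [treeInv]
      rw [if_neg (by omega)]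
      refine Finset.sum_eq_zero fun p _ => ?_
      split_ifs with hp
      · obtain ⟨p, rfl⟩ : ∃ q, p = q + 2 := ⟨p - 2, by omega⟩
        rw [h, show p + 2 - 1 = p + 1 by omega, h]
        simp
      · rw [h]; simp
    · have h : ∀ p, (treeInv (p + 1) (j + 1) + if 2 ≤ p then treeInv (p - 1) (j + 1) else 0) =
          treeInv p j := by
        rintro (_ | _ | p)
        · simp [treeInv]
        · simp [treeInv]
        · simp [treeInv]
      simp only [h, ih, Nat.add_right_cancel_iff]

section
variable {s g : ℕ}

/-- Leafless maps are counted by inclusion–exclusion over sets of leaves. -/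
theorem leaflessCount_eq_sum_treeInv (hs : 1 ≤ s) (hg : 2 < 2 * g + s) {p K : Fin s → ℕ}
    (hK : ∀ i, p i < K i) :
    leaflessCount s g p = ∑ j ∈ Fintype.piFinset fun i => Finset.range (K i),
      (∏ i, (treeInv (p i) (j i) : ℂ)) * markedCount s g j 0 := by
  classical
  rw [leaflessCount_eq_sum]
  rw [← Finset.sum_filter_of_ne (p := fun ρ : Fin s → ℕ => ∀ i, 2 * ρ i ≤ p i)]
  swap
  · intro ρ _ h
    by_contra hc
    push Not at hc
    obtain ⟨i, hi⟩ := hc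
    exact h (by rw [markedCount_eq_zero hs hg hi, mul_zero])
  symm
  rw [← Finset.sum_filter_of_ne (p := fun j : Fin s → ℕ => ∀ i, j i ≤ p i ∧ (p i + j i) % 2 = 0)]
  swap
  · intro j _ h
    by_contra hc
    push Not at hc
    obtain ⟨i, hi⟩ := hc
    refine h (mul_eq_zero_of_left (Finset.prod_eq_zero (Finset.mem_univ i) ?_) _)
    rw [treeInv_eq_zero _ _ (by by_contra hh; push Not at hh; exact hi hh.1 (by omega)), Int.cast_zero]
  -- removing `ρ i` leaves from the face `i` leaves a face of length `j i = p i - 2 * ρ i`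
  refine Finset.sum_nbij' (fun j i => (p i - j i) / 2) (fun ρ i => p i - 2 * ρ i) ?_ ?_ ?_ ?_ ?_
  · intro j hj
    simp only [Finset.mem_filter, Fintype.mem_piFinset, Finset.mem_range] at hj ⊢
    exact ⟨fun i => by omega, fun i => by omega⟩
  · intro ρ hρ
    simp only [Finset.mem_filter, Fintype.mem_piFinset, Finset.mem_range] at hρ ⊢
    exact ⟨fun i => by have := hK i; omega, fun i => by have := hρ.2 i; omega⟩
  · intro j hj
    simp only [Finset.mem_filter] at hj
    funext i
    have := hj.2 i
    simp only
    omega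
  · intro ρ hρ
    simp only [Finset.mem_filter] at hρ
    funext i
    have := hρ.2 i
    simp only
    omega
  · intro j hj
    simp only [Finset.mem_filter] at hj
    obtain ⟨ρ, hρ⟩ : ∃ ρ : Fin s → ℕ, p = j + 2 * ρ := by
      refine ⟨fun i => (p i - j i) / 2, ?_⟩
      funext i
      have := hj.2 i
      simp only [Pi.add_apply, Pi.mul_apply, Pi.ofNat_apply]
      omega
    subst hρ
    have h1 : (fun i => ((j + 2 * ρ : Fin s → ℕ) i - j i) / 2) = ρ := by
      funext i
      simp
    rw [h1, markedCount_add hs hg, ← mul_assoc, ← Finset.prod_pow_eq_pow_sum,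
      ← Finset.prod_mul_distrib]
    congr 1
    refine Finset.prod_congr rfl fun i _ => ?_
    have := treeInv_add (j i) (ρ i)
    simp only [Pi.add_apply, Pi.mul_apply, Pi.ofNat_apply, this]
    push_cast
    rfl

/-- A map is a leafless map with trees attached. -/
theorem markedCount_eq_sum_treeCount (hs : 1 ≤ s) (hg : 2 < 2 * g + s) (k : Fin s → ℕ) :
    markedCount s g k 0 = ∑ p ∈ Fintype.piFinset fun i => Finset.range (k i + 1),
      (∏ i, (treeCount (k i) (p i) : ℂ)) * leaflessCount s g p := by
  classical
  have h1 : ∀ p ∈ Fintype.piFinset fun i => Finset.range (k i + 1),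
      (∏ i, (treeCount (k i) (p i) : ℂ)) * leaflessCount s g p =
      ∑ j ∈ Fintype.piFinset fun i => Finset.range (k i + 1),
        (∏ i, (treeCount (k i) (p i) : ℂ) * (treeInv (p i) (j i) : ℂ)) * markedCount s g j 0 := by
    intro p hp
    simp only [Fintype.mem_piFinset, Finset.mem_range] at hp
    rw [leaflessCount_eq_sum_treeInv hs hg hp, Finset.mul_sum]
    simp only [Finset.prod_mul_distrib, mul_assoc]
  rw [Finset.sum_congr rfl h1, Finset.sum_comm]
  have h2 : ∀ j : Fin s → ℕ, ∑ p ∈ Fintype.piFinset fun i => Finset.range (k i + 1),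
      (∏ i, (treeCount (k i) (p i) : ℂ) * (treeInv (p i) (j i) : ℂ)) * markedCount s g j 0 =
      if k = j then markedCount s g j 0 else 0 := by
    intro j
    rw [← Finset.sum_mul, ← Finset.prod_univ_sum (fun i => Finset.range (k i + 1))
      fun i r => (treeCount (k i) r : ℂ) * (treeInv r (j i) : ℂ)]
    have h3 : ∀ i, ∑ r ∈ Finset.range (k i + 1), (treeCount (k i) r : ℂ) * (treeInv r (j i) : ℂ) =
        if k i = j i then 1 else 0 := by
      intro i
      exact_mod_cast congrArg (Int.cast : ℤ → ℂ) (sum_treeCount_mul_treeInv (k i) (j i))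
    simp only [h3, Finset.prod_boole, Finset.mem_univ, true_imp_iff, funext_iff, ite_mul, one_mul,
      zero_mul]
  simp only [h2]
  rw [Finset.sum_ite_eq, if_pos]
  simp [Fintype.mem_piFinset]

end

/-! ### Analytic form of the tree substitution -/

/-- Partial sums of the tree series are bounded by any supersolution `Z` of `Z = U (1 + Z ^ 2)`. -/
theorem sum_treeCount_mul_pow_le {U Z : ℝ} (hU : 0 ≤ U) (hZ : 0 ≤ Z) (h : U * (1 + Z ^ 2) ≤ Z)
    (K p : ℕ) : ∑ k ∈ Finset.range K, (treeCount k p : ℝ) * U ^ k ≤ Z ^ p := by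
  induction K generalizing p with
  | zero => simpa using pow_nonneg hZ p
  | succ K ih =>
    rw [Finset.sum_range_succ']
    rcases p with _ | p
    · simp [treeCount]
    · have h1 : ∑ k ∈ Finset.range K, (treeCount (k + 1) (p + 1) : ℝ) * U ^ (k + 1) =
          U * (∑ k ∈ Finset.range K, (treeCount k p : ℝ) * U ^ k +
            ∑ k ∈ Finset.range K, (treeCount k (p + 2) : ℝ) * U ^ k) := by
        rw [← Finset.sum_add_distrib, Finset.mul_sum]
        refine Finset.sum_congr rfl fun k _ => ?_
        simp only [treeCount]
        push_cast
        ring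
      rw [h1]
      simp only [treeCount, Nat.add_one_ne_zero, if_false, Nat.cast_zero, zero_mul, add_zero]
      calc U * (_ + _) ≤ U * (Z ^ p + Z ^ (p + 2)) := by gcongr <;> exact ih _
        _ = (U * (1 + Z ^ 2)) * Z ^ p := by ring
        _ ≤ Z * Z ^ p := by gcongr
        _ = Z ^ (p + 1) := by ring

theorem summable_treeCount_mul_pow {U : ℝ} (hU : 0 ≤ U) (hU' : U ≤ 1 / 2) (p : ℕ) :
    Summable (fun k => (treeCount k p : ℝ) * U ^ k) ∧
      ∑' k, (treeCount k p : ℝ) * U ^ k ≤ (2 * U) ^ p := by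
  have h := sum_treeCount_mul_pow_le hU (Z := 2 * U) (by positivity) (by nlinarith)
  have h0 : ∀ k, 0 ≤ (treeCount k p : ℝ) * U ^ k := fun k => by positivity
  exact ⟨summable_of_sum_range_le h0 fun K => h K p,
    Real.tsum_le_of_sum_range_le h0 fun K => h K p⟩

/-- The series `∑ k, treeCount k p * u ^ k` is `z ^ p`: both sides are bounded solutions of
`S 0 = 1`, `S (p + 1) = u (S p + S (p + 2))`, and this recursion is contracting. -/
theorem hasSum_treeCount {u z : ℂ} (hu : ‖u‖ < 1 / 2) (hz : ‖z‖ ≤ 1) (h : u * (1 + z ^ 2) = z)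
    (p : ℕ) : HasSum (fun k => (treeCount k p : ℂ) * u ^ k) (z ^ p) := by
  have hnorm : ∀ p k, ‖(treeCount k p : ℂ) * u ^ k‖ = (treeCount k p : ℝ) * ‖u‖ ^ k := by
    intro p k
    simp
  have hs : ∀ p, Summable fun k => (treeCount k p : ℂ) * u ^ k := by
    intro p
    refine Summable.of_norm ?_
    simp only [hnorm]
    exact (summable_treeCount_mul_pow (norm_nonneg u) hu.le p).1
  let S : ℕ → ℂ := fun p => ∑' k, (treeCount k p : ℂ) * u ^ k
  have hS : ∀ p, HasSum (fun k => (treeCount k p : ℂ) * u ^ k) (S p) := fun p => (hs p).hasSum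
  have hS0 : S 0 = 1 := by
    refine (hS 0).unique ?_
    convert hasSum_ite_eq 0 (1 : ℂ) using 2 with k
    rw [treeCount_zero_right]
    split_ifs with hk <;> simp [hk]
  have hSr : ∀ p, S (p + 1) = u * (S p + S (p + 2)) := by
    intro p
    have h1 := (((hS p).add (hS (p + 2))).mul_left u)
    have h2 := (hasSum_nat_add_iff' 1).2 (hS (p + 1))
    rw [show S (p + 1) = S (p + 1) - ∑ i ∈ Finset.range 1, (treeCount i (p + 1) : ℂ) * u ^ i by
      simp [treeCount]]
    refine h2.unique ?_
    have h3 : (fun k => (treeCount (k + 1) (p + 1) : ℂ) * u ^ (k + 1)) =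
        fun k => u * ((treeCount k p : ℂ) * u ^ k + (treeCount k (p + 2) : ℂ) * u ^ k) := by
      funext k
      simp only [treeCount]
      push_cast
      ring
    rw [h3]
    exact h1
  have hSb : ∀ p, ‖S p‖ ≤ 1 := by
    intro p
    have h1 := summable_treeCount_mul_pow (norm_nonneg u) hu.le p
    have h2 := norm_tsum_le_tsum_norm (f := fun k => (treeCount k p : ℂ) * u ^ k)
      (by simpa only [hnorm] using h1.1)
    simp only [hnorm] at h2
    exact (h2.trans h1.2).trans (pow_le_one₀ (by positivity) (by linarith))
  -- each application of the recursion gains a factor `2 * ‖u‖ < 1`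
  have hd : ∀ n p, ‖S p - z ^ p‖ ≤ (2 * ‖u‖) ^ n * 2 := by
    intro n
    induction n with
    | zero =>
      intro p
      have : ‖z ^ p‖ ≤ 1 := by
        rw [norm_pow]
        exact pow_le_one₀ (norm_nonneg _) hz
      have := norm_sub_le (S p) (z ^ p)
      have := hSb p
      simp only [pow_zero, one_mul]
      linarith
    | succ n ih =>
      rintro (_ | p)
      · rw [hS0]
        simp
      · have h1 : S (p + 1) - z ^ (p + 1) = u * ((S p - z ^ p) + (S (p + 2) - z ^ (p + 2))) := by
          rw [hSr]
          have : z ^ (p + 1) = u * (z ^ p + z ^ (p + 2)) := by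
            calc z ^ (p + 1) = z * z ^ p := by ring
              _ = u * (1 + z ^ 2) * z ^ p := by rw [h]
              _ = _ := by ring
          rw [this]
          ring
        rw [h1, norm_mul]
        have h2 := norm_add_le (S p - z ^ p) (S (p + 2) - z ^ (p + 2))
        calc ‖u‖ * _ ≤ ‖u‖ * ((2 * ‖u‖) ^ n * 2 + (2 * ‖u‖) ^ n * 2) := by
              gcongr
              exact h2.trans (add_le_add (ih p) (ih (p + 2)))
          _ = _ := by ring
  have hlim : Filter.Tendsto (fun n => (2 * ‖u‖) ^ n * 2) Filter.atTop (nhds 0) := by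
    have := (tendsto_pow_atTop_nhds_zero_of_lt_one (r := 2 * ‖u‖) (by positivity)
      (by linarith)).mul_const 2
    simpa using this
  have : ‖S p - z ^ p‖ ≤ 0 := ge_of_tendsto' hlim fun n => hd n p
  have : S p = z ^ p := sub_eq_zero.1 (norm_le_zero_iff.1 this)
  rw [← this]
  exact hS p

/-! ### Erasing the bivalent vertices of leafless maps -/

section
variable {s g : ℕ}

variable (s g) in
open Classical in
/-- The generating function of the leafless maps with `n` half-edges, of which `m` are attached to
vertices of valence at least three, where an edge between the faces `i` and `j` has the weight
`W s(i, j)`. -/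
noncomputable def coreSum (m n : ℕ) (W : Sym2 (Fin s) → ℂ) : ℂ :=
  1 / (n.factorial : ℂ) * ∑ M ∈ (mapSet s g (Fin n)).filter
    (fun M => (∀ x, M.1 x ≠ x) ∧ n = m + bivalCount M), edgeProd Finset.univ M.2.1 W M.2.2

theorem mapSet_eq_empty (hs : 1 ≤ s) (hg : 2 < 2 * g + s) {n : ℕ} (hn : n < 4) :
    mapSet s g (Fin n) = ∅ := by
  refine Finset.eq_empty_of_forall_notMem fun M hM => ?_
  have := (mem_mapSet.1 hM).four_le hs hg
  rw [Fintype.card_fin] at this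
  omega

open Classical in
/-- Removal of a distinguished vertex of valence two from a leafless map. -/
theorem coreSum_succ (hs : 1 ≤ s) (hg : 2 < 2 * g + s) (m n : ℕ) (W : Sym2 (Fin s) → ℂ) :
    ((n : ℂ) + 2 - m) * coreSum s g m (n + 2) W =
      1 / (n.factorial : ℂ) * ∑ M ∈ (mapSet s g (Fin n)).filter
        (fun M => (∀ x, M.1 x ≠ x) ∧ n = m + bivalCount M),
        (∑ b, W s(M.2.2 b, M.2.2 (M.2.1 b))) * edgeProd Finset.univ M.2.1 W M.2.2 := by
  rcases Nat.eq_zero_or_pos n with rfl | hn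
  · rw [coreSum, mapSet_eq_empty hs hg (by omega), mapSet_eq_empty hs hg (by omega)]
    simp
  have h1 := sum_bivalCount_mul (s := s) (g := g) hn.ne' W fun b => if n + 2 = m + b then 1 else 0
  have h2 : ∑ M ∈ (mapSet s g (Fin (n + 2))).filter (fun M => ∀ x, M.1 x ≠ x),
      (bivalCount M : ℂ) * ((if n + 2 = m + bivalCount M then 1 else 0) *
        edgeProd Finset.univ M.2.1 W M.2.2) = ((n : ℂ) + 2 - m) *
      ∑ M ∈ (mapSet s g (Fin (n + 2))).filter (fun M => (∀ x, M.1 x ≠ x) ∧ n + 2 = m + bivalCount M),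
        edgeProd Finset.univ M.2.1 W M.2.2 := by
    rw [← Finset.filter_filter, Finset.sum_filter (fun M => n + 2 = m + bivalCount M), Finset.mul_sum]
    refine Finset.sum_congr rfl fun M _ => ?_
    split_ifs with h
    · have : (n : ℂ) + 2 = m + bivalCount M := by exact_mod_cast h
      rw [this]
      ring
    · simp
  rw [h2] at h1
  have hf : ((n + 2).factorial : ℂ) = ((n : ℂ) + 2) * ((n : ℂ) + 1) * n.factorial := by
    rw [Nat.factorial_succ, Nat.factorial_succ]; push_cast; ring
  have a : (n.factorial : ℂ) ≠ 0 := by exact_mod_cast n.factorial_ne_zero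
  have b : (n : ℂ) + 1 ≠ 0 := by exact_mod_cast (Nat.succ_ne_zero n)
  have c : (n : ℂ) + 2 ≠ 0 := by exact_mod_cast (Nat.succ_ne_zero (n + 1))
  rw [coreSum, mul_left_comm, h1, hf, ← mul_assoc]
  congr 1
  · field_simp
  · rw [← Finset.filter_filter, Finset.sum_filter (fun M => n = m + bivalCount M)]
    refine Finset.sum_congr rfl fun M _ => ?_
    by_cases h : n = m + bivalCount M
    · rw [if_pos h, if_pos (by omega), one_mul]
    · rw [if_neg h, if_neg (by omega)]
      simp

/-- The half-edges at bivalent vertices come in pairs. -/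
theorem even_bivalCount {D : Type} [Fintype D] [DecidableEq D] (M : Triple s D) :
    Even (bivalCount M) := by
  rw [← ZMod.natCast_eq_zero_iff_even, bivalCount, Finset.card_eq_sum_ones, Nat.cast_sum]
  refine Finset.sum_involution (fun x _ => M.1 x) ?_ ?_ ?_ ?_
  · intro _ _
    decide
  · intro x hx _
    exact (Finset.mem_filter.1 hx).2.1
  · intro x hx
    obtain ⟨-, h1, h2⟩ := Finset.mem_filter.1 hx
    refine Finset.mem_filter.2 ⟨Finset.mem_univ _, ?_, by rw [h2]⟩
    rw [h2]
    exact h1.symm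
  · intro x hx
    exact (Finset.mem_filter.1 hx).2.2

theorem coreSum_eq_zero {m n : ℕ} (h : ∀ j, n ≠ m + 2 * j) (W : Sym2 (Fin s) → ℂ) :
    coreSum s g m n W = 0 := by
  classical
  rw [coreSum, Finset.sum_eq_zero, mul_zero]
  intro M hM
  obtain ⟨-, -, h1⟩ := Finset.mem_filter.1 hM
  obtain ⟨j, hj⟩ := even_bivalCount M
  exact absurd (by omega : n = m + 2 * j) (h j)

theorem sum_edges {D : Type} [Fintype D] [DecidableEq D] {e : Perm D}
    (he : e ∈ pairings Finset.univ) (G : Sym2 D → ℂ) :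
    ∑ d, G s(d, e d) = 2 * ∑ q ∈ Finset.univ.image (fun d => s(d, e d)), G q := by
  rw [Finset.sum_comp G fun d => s(d, e d), Finset.mul_sum]
  refine Finset.sum_congr rfl fun q hq => ?_
  obtain ⟨d, -, rfl⟩ := Finset.mem_image.1 hq
  have hp := mem_pairings.1 he
  have : Finset.univ.filter (fun x => s(x, e x) = s(d, e d)) = {d, e d} := by
    ext x
    simp only [Finset.mem_filter, Finset.mem_univ, true_and, Finset.mem_insert,
      Finset.mem_singleton, Sym2.eq_iff]
    constructor
    · rintro (⟨h, -⟩ | ⟨h, -⟩)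
      exacts [Or.inl h, Or.inr h]
    · rintro (rfl | rfl)
      · simp
      · simp [hp.1]
  rw [this, Finset.card_pair ((hp.2 d).2 (Finset.mem_univ d)).symm]
  simp

/-- The weight `W / (1 - q W)` of a chain of edges with the parameter `q` for each interior
vertex. -/
noncomputable def chainWeight (W : Sym2 (Fin s) → ℂ) (q : ℂ) (a : Sym2 (Fin s)) : ℂ :=
  W a / (1 - q * W a)

theorem hasDerivAt_chainWeight {W : Sym2 (Fin s) → ℂ} {q : ℂ} {a : Sym2 (Fin s)}
    (h : 1 - q * W a ≠ 0) :
    HasDerivAt (fun q => chainWeight W q a) (chainWeight W q a * chainWeight W q a) q := by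
  have h1 : HasDerivAt (fun q : ℂ => 1 - q * W a) (-W a) q := by
    simpa using ((hasDerivAt_id q).mul_const (W a)).const_sub 1
  have h2 := (hasDerivAt_const q (W a)).div h1 h
  refine h2.congr_deriv ?_
  simp only [chainWeight]
  field_simp
  ring

/-- Differentiating with respect to the parameter of the chains inserts a bivalent vertex. -/
theorem hasDerivAt_coreSum (hs : 1 ≤ s) (hg : 2 < 2 * g + s) (m j : ℕ) {W : Sym2 (Fin s) → ℂ} {q : ℂ}
    (h : ∀ a, 1 - q * W a ≠ 0) :
    HasDerivAt (fun q => coreSum s g m (m + 2 * j) (chainWeight W q))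
      (((j : ℂ) + 1) * coreSum s g m (m + 2 * (j + 1)) (chainWeight W q)) q := by
  classical
  have h1 := coreSum_succ hs hg m (m + 2 * j) (chainWeight W q)
  have h2 : ((j : ℂ) + 1) * coreSum s g m (m + 2 * (j + 1)) (chainWeight W q) =
      1 / 2 * ((((m + 2 * j : ℕ) : ℂ) + 2 - m) * coreSum s g m (m + 2 * j + 2) (chainWeight W q)) := by
    rw [show m + 2 * (j + 1) = m + 2 * j + 2 by ring]
    push_cast
    ring
  rw [h2, h1, mul_left_comm, Finset.mul_sum]
  refine HasDerivAt.const_mul _ (HasDerivAt.fun_sum fun M hM => ?_)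
  have hp := (mem_mapSet.1 (Finset.mem_filter.1 hM).1).pairing
  have h3 : ∑ b, chainWeight W q s(M.2.2 b, M.2.2 (M.2.1 b)) = _ :=
    sum_edges hp fun a => chainWeight W q (a.map M.2.2)
  rw [h3, mul_assoc, ← mul_assoc (1 / 2 : ℂ), show (1 / 2 : ℂ) * 2 = 1 by norm_num, one_mul]
  refine (HasDerivAt.fun_finsetProd fun a _ => hasDerivAt_chainWeight (h (a.map M.2.2))).congr_deriv ?_
  rw [edgeProd, Finset.sum_mul]
  refine Finset.sum_congr rfl fun a ha => ?_
  rw [← Finset.mul_prod_erase _ _ ha, smul_eq_mul]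
  ring

/-- Summation over the number of bivalent vertices replaces `W` by `W / (1 - W)`. This is a Taylor
expansion in the parameter of the chains. -/
theorem hasSum_coreSum (hs : 1 ≤ s) (hg : 2 < 2 * g + s) (m : ℕ) {W : Sym2 (Fin s) → ℂ} {r : ℝ}
    (hr : 0 < r) (hr1 : r < 1) (hW : ∀ a, ‖W a‖ ≤ r) :
    HasSum (fun n => coreSum s g m n W) (coreSum s g m m fun a => W a / (1 - W a)) := by
  have hinj : Function.Injective fun j : ℕ => m + 2 * j := fun a b h => by simpa using h
  rw [← hinj.hasSum_iff]
  swap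
  · intro n hn
    exact coreSum_eq_zero (fun j hj => hn ⟨j, hj.symm⟩) W
  have hne : ∀ q ∈ Metric.ball (0 : ℂ) r⁻¹, ∀ a, 1 - q * W a ≠ 0 := by
    intro q hq a h0
    have h1 : ‖q * W a‖ = 1 := by rw [← sub_eq_zero.1 h0, norm_one]
    rw [norm_mul] at h1
    rw [mem_ball_zero_iff] at hq
    have : ‖q‖ * ‖W a‖ < 1 := by
      calc ‖q‖ * ‖W a‖ ≤ ‖q‖ * r := by gcongr; exact hW a
        _ < r⁻¹ * r := by gcongr
        _ = 1 := inv_mul_cancel₀ hr.ne'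
    linarith
  have hd : ∀ j, ∀ q ∈ Metric.ball (0 : ℂ) r⁻¹,
      iteratedDeriv j (fun q => coreSum s g m m (chainWeight W q)) q =
        (j.factorial : ℂ) * coreSum s g m (m + 2 * j) (chainWeight W q) := by
    intro j
    induction j with
    | zero => intro q _; simp
    | succ j ih =>
      intro q hq
      have h1 : iteratedDeriv j (fun q => coreSum s g m m (chainWeight W q)) =ᶠ[nhds q]
          fun q => (j.factorial : ℂ) * coreSum s g m (m + 2 * j) (chainWeight W q) :=
        Filter.eventuallyEq_of_mem (Metric.isOpen_ball.mem_nhds hq) ih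
      rw [iteratedDeriv_succ, h1.deriv_eq,
        ((hasDerivAt_coreSum hs hg m j (hne q hq)).const_mul _).deriv, Nat.factorial_succ]
      push_cast
      ring
  have hdiff : DifferentiableOn ℂ (fun q => coreSum s g m m (chainWeight W q))
      (Metric.ball 0 r⁻¹) := by
    intro q hq
    exact (hasDerivAt_coreSum hs hg m 0 (hne q hq)).differentiableAt.differentiableWithinAt
  have h1mem : (1 : ℂ) ∈ Metric.ball (0 : ℂ) r⁻¹ := by
    rw [mem_ball_zero_iff, norm_one]
    exact (one_lt_inv₀ hr).2 hr1
  have h := Complex.hasSum_taylorSeries_on_ball hdiff h1mem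
  have e1 : (chainWeight W 1) = fun a => W a / (1 - W a) := by
    funext a
    simp [chainWeight]
  have e0 : (chainWeight W 0) = W := by
    funext a
    simp [chainWeight]
  rw [e1] at h
  have h2 : (fun j : ℕ => (j.factorial : ℂ)⁻¹ • ((1 : ℂ) - 0) ^ j •
      iteratedDeriv j (fun q => coreSum s g m m (chainWeight W q)) 0) =
      (fun n => coreSum s g m n W) ∘ fun j => m + 2 * j := by
    funext j
    rw [hd j 0 (Metric.mem_ball_self (by positivity)), e0]
    have : (j.factorial : ℂ) ≠ 0 := by exact_mod_cast j.factorial_ne_zero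
    simp [this]
  rw [← h2]
  exact h

/-! ### The Euler characteristic bounds the shapes -/

/-- Every vertex of valence two has two bivalent half-edges, and every other vertex of a leafless map
has at least three half-edges. -/
theorem six_mul_cyc_le {D : Type} [Fintype D] [DecidableEq D] {M : Triple s D}
    (h : ∀ x, M.1 x ≠ x) : 6 * cyc M.1 ≤ 2 * Fintype.card D + bivalCount M := by
  classical
  let w : D → ℕ := fun x => 2 + if M.1 x ≠ x ∧ M.1 (M.1 x) = x then 1 else 0
  have h1 : 2 * Fintype.card D + bivalCount M = ∑ x, w x := by
    simp only [w, Finset.sum_add_distrib, Finset.sum_const, smul_eq_mul, ← Finset.card_filter]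
    rw [Finset.card_univ, mul_comm]
    rfl
  have : Fintype (Quotient (Perm.SameCycle.setoid M.1)) := Fintype.ofFinite _
  rw [h1, ← Finset.sum_fiberwise (g := fun x => (Quotient.mk (Perm.SameCycle.setoid M.1) x)), cyc,
    Nat.card_eq_fintype_card, mul_comm, ← smul_eq_mul, ← Finset.card_univ]
  refine Finset.card_nsmul_le_sum _ _ _ fun c _ => ?_
  obtain ⟨x, rfl⟩ := Quotient.exists_rep c
  have hmem : ∀ y, M.1.SameCycle x y → y ∈ Finset.univ.filter
      fun y => Quotient.mk (Perm.SameCycle.setoid M.1) y = Quotient.mk _ x := by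
    intro y hy
    exact Finset.mem_filter.2 ⟨Finset.mem_univ _, Quotient.sound hy.symm⟩
  have s1 : M.1.SameCycle x (M.1 x) := ⟨1, by simp⟩
  have s2 : M.1.SameCycle x (M.1 (M.1 x)) := ⟨2, by simp [zpow_ofNat, pow_two]⟩
  have s0 : M.1.SameCycle x x := ⟨0, by simp⟩
  by_cases h2 : M.1 (M.1 x) = x
  · have hsub : ({x, M.1 x} : Finset D) ⊆ Finset.univ.filter
        fun y => Quotient.mk (Perm.SameCycle.setoid M.1) y = Quotient.mk _ x := by
      intro y hy
      rcases Finset.mem_insert.1 hy with rfl | hy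
      · exact hmem _ s0
      · rw [Finset.mem_singleton.1 hy]; exact hmem _ s1
    refine le_trans ?_ (Finset.sum_le_sum_of_subset hsub)
    rw [Finset.sum_pair (h x).symm]
    simp [w, h, h2]
  · have hsub : ({x, M.1 x, M.1 (M.1 x)} : Finset D) ⊆ Finset.univ.filter
        fun y => Quotient.mk (Perm.SameCycle.setoid M.1) y = Quotient.mk _ x := by
      intro y hy
      simp only [Finset.mem_insert, Finset.mem_singleton] at hy
      rcases hy with rfl | rfl | rfl
      · exact hmem _ s0
      · exact hmem _ s1
      · exact hmem _ s2
    refine le_trans ?_ (Finset.sum_le_sum_of_subset hsub)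
    rw [Finset.sum_insert, Finset.sum_pair (h (M.1 x)).symm]
    · simp only [w]; omega
    · simp only [Finset.mem_insert, Finset.mem_singleton, not_or]
      exact ⟨(h x).symm, fun h' => h2 h'.symm⟩

theorem IsMap.card_le {D : Type} [Fintype D] [DecidableEq D] {M : Triple s D} (hM : IsMap s g M)
    (h : ∀ x, M.1 x ≠ x) : Fintype.card D ≤ 6 * (2 * g + s - 2) + bivalCount M := by
  have h1 := six_mul_cyc_le h
  have h2 := cyc_pairing hM.pairing
  have h3 := hM.genus
  omega

open Classical in
/-- Leafless maps sorted by the number `m` of half-edges which are not at bivalent vertices. -/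
theorem sum_coreSum (n : ℕ) (W : Sym2 (Fin s) → ℂ) :
    ∑ m ∈ Finset.range (6 * (2 * g + s - 2) + 1), coreSum s g m n W = 1 / (n.factorial : ℂ) *
      ∑ M ∈ (mapSet s g (Fin n)).filter (fun M => ∀ x, M.1 x ≠ x),
        edgeProd Finset.univ M.2.1 W M.2.2 := by
  simp only [coreSum]
  rw [← Finset.mul_sum]
  congr 1
  simp only [← Finset.filter_filter]
  simp only [Finset.sum_filter (fun M => n = _ + bivalCount M)]
  rw [Finset.sum_comm]
  refine Finset.sum_congr rfl fun M hM => ?_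
  obtain ⟨hM, hl⟩ := Finset.mem_filter.1 hM
  have h1 := (mem_mapSet.1 hM).card_le hl
  have h2 : bivalCount M ≤ n := by
    have := Finset.card_le_univ (Finset.univ.filter fun x => M.1 x ≠ x ∧ M.1 (M.1 x) = x)
    rwa [Fintype.card_fin] at this
  rw [Fintype.card_fin] at h1
  rw [Finset.sum_eq_single (n - bivalCount M)]
  · rw [if_pos (by omega)]
  · intro m _ hm
    rw [if_neg (by omega)]
  · intro h
    rw [Finset.mem_range] at h
    omega

end

/-! ### Summation over leafless maps and over trees -/

theorem hasSum_pi_prod {s : ℕ} {f : Fin s → ℕ → ℂ} {a : Fin s → ℂ}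
    (hf : ∀ i, Summable fun k => ‖f i k‖) (ha : ∀ i, HasSum (f i) (a i)) :
    (Summable fun k : Fin s → ℕ => ‖∏ i, f i (k i)‖) ∧
      HasSum (fun k : Fin s → ℕ => ∏ i, f i (k i)) (∏ i, a i) := by
  induction s with
  | zero => exact ⟨(hasSum_fintype _).summable, by simp⟩
  | succ s ih =>
    have hf' : ∀ i : Fin s, Summable fun k => ‖f i.succ k‖ := fun i => hf _
    have ha' : ∀ i : Fin s, HasSum (f i.succ) (a i.succ) := fun i => ha _
    obtain ⟨h1, h2⟩ := ih hf' ha'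
    rw [← (Fin.consEquiv fun _ : Fin (s + 1) => ℕ).summable_iff,
      ← (Fin.consEquiv fun _ : Fin (s + 1) => ℕ).hasSum_iff]
    have e : ∀ q : ℕ × (Fin s → ℕ), ∏ i, f i (Fin.consEquiv (fun _ : Fin (s + 1) => ℕ) q i) =
        f 0 q.1 * ∏ i : Fin s, f i.succ (q.2 i) := by
      intro q
      rw [Fin.prod_univ_succ]
      rfl
    simp only [Function.comp_def, e, Fin.prod_univ_succ a]
    have h3 : ∀ (F : ℕ → ℂ) (G : (Fin s → ℕ) → ℂ) (b c : ℂ), (Summable fun k => ‖F k‖) →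
        (Summable fun k => ‖G k‖) → HasSum F b → HasSum G c →
        (Summable fun q : ℕ × (Fin s → ℕ) => ‖F q.1 * G q.2‖) ∧
          HasSum (fun q : ℕ × (Fin s → ℕ) => F q.1 * G q.2) (b * c) := fun F G b c hF hG hb hc =>
      ⟨hF.mul_norm hG, hb.mul hc (hF.mul_norm hG).of_norm⟩
    exact h3 (f 0) (fun k => ∏ i : Fin s, f i.succ (k i)) _ _ (hf 0) h1 (ha 0) h2

section
variable {s g : ℕ}

/-- The weight `z i * z j` of an edge between the faces `i` and `j`. -/
def mulWeight (z : Fin s → ℂ) : Sym2 (Fin s) → ℂ :=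
  Sym2.lift ⟨fun i j => z i * z j, fun _ _ => mul_comm _ _⟩

theorem edgeProd_mulWeight {D : Type} [Fintype D] [DecidableEq D] {M : Triple s D}
    (h : M.2.1 ∈ pairings Finset.univ) (z : Fin s → ℂ) :
    edgeProd Finset.univ M.2.1 (mulWeight z) M.2.2 = ∏ i, z i ^ perim M i := by
  have h1 : ∏ i, z i ^ perim M i = ∏ d, z (M.2.2 d) := by
    rw [← Finset.prod_fiberwise (g := M.2.2)]
    refine Finset.prod_congr rfl fun i _ => ?_
    rw [Finset.prod_congr rfl fun d hd => by rw [(Finset.mem_filter.1 hd).2], Finset.prod_const]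
    rfl
  rw [h1, ← Finset.prod_fiberwise_of_maps_to (g := fun d => s(d, M.2.1 d))
    (fun d hd => Finset.mem_image_of_mem (fun d => s(d, M.2.1 d)) hd), edgeProd]
  refine Finset.prod_congr rfl fun q hq => ?_
  obtain ⟨d, -, rfl⟩ := Finset.mem_image.1 hq
  have hp := mem_pairings.1 h
  have : Finset.univ.filter (fun x => s(x, M.2.1 x) = s(d, M.2.1 d)) = {d, M.2.1 d} := by
    ext x
    simp only [Finset.mem_filter, Finset.mem_univ, true_and, Finset.mem_insert,
      Finset.mem_singleton, Sym2.eq_iff]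
    constructor
    · rintro (⟨h, -⟩ | ⟨h, -⟩)
      exacts [Or.inl h, Or.inr h]
    · rintro (rfl | rfl)
      · simp
      · simp [hp.1]
  rw [this, Finset.prod_pair ((hp.2 d).2 (Finset.mem_univ d)).symm]
  rfl

open Classical in
/-- The face variables `z i` distribute over the edges: an edge between the faces `i` and `j` has one
half-edge in each of them, and thus the weight `z i * z j`. -/
theorem sum_leaflessCount (n : ℕ) (z : Fin s → ℂ) :
    ∑ p ∈ Finset.piAntidiag Finset.univ n, leaflessCount s g p * ∏ i, z i ^ p i =
      ∑ m ∈ Finset.range (6 * (2 * g + s - 2) + 1), coreSum s g m n (mulWeight z) := by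
  rw [sum_coreSum, ← Finset.sum_fiberwise_of_maps_to (g := fun M => perim M)
    (t := Finset.piAntidiag Finset.univ n), Finset.mul_sum]
  · refine Finset.sum_congr rfl fun p hp => ?_
    obtain ⟨rfl, -⟩ := Finset.mem_piAntidiag.1 hp
    rw [leaflessCount, mul_assoc, Finset.filter_filter, ← nsmul_eq_mul, ← Finset.sum_const]
    congr 1
    refine Finset.sum_congr rfl fun M hM => ?_
    obtain ⟨hM, -, hp⟩ := Finset.mem_filter.1 hM
    rw [edgeProd_mulWeight (mem_mapSet.1 hM).pairing, hp]
  · intro M _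
    rw [Finset.mem_piAntidiag]
    exact ⟨by simp [sum_perim], fun i _ => Finset.mem_univ i⟩

theorem norm_leaflessCount (p : Fin s → ℕ) :
    ((‖leaflessCount s g p‖ : ℝ) : ℂ) = leaflessCount s g p := by
  simp [leaflessCount]

variable (s g) in
/-- The generating function of the maps without vertices of valence one or two, at the edge weights
`w / (1 - w)`, where `w = z i * z j`. -/
noncomputable def shapeGen (z : Fin s → ℂ) : ℂ :=
  ∑ m ∈ Finset.range (6 * (2 * g + s - 2) + 1),
    coreSum s g m m fun a => mulWeight z a / (1 - mulWeight z a)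

/-- The sum over leafless maps, first ordered by the number of half-edges; absolute convergence follows
since all counts are nonnegative. -/
theorem hasSum_leaflessCount (hs : 1 ≤ s) (hg : 2 < 2 * g + s) {z : Fin s → ℂ}
    (hz : ∀ i, ‖z i‖ < 1) :
    (Summable fun p : Fin s → ℕ => ‖leaflessCount s g p * ∏ i, z i ^ p i‖) ∧
      HasSum (fun p : Fin s → ℕ => leaflessCount s g p * ∏ i, z i ^ p i) (shapeGen s g z) := by
  classical
  have hG : ∀ z : Fin s → ℂ, (∀ i, ‖z i‖ < 1) → HasSum (fun n =>
      ∑ p ∈ Finset.piAntidiag Finset.univ n, leaflessCount s g p * ∏ i, z i ^ p i)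
      (shapeGen s g z) := by
    intro z hz
    have : Nonempty (Fin s) := ⟨⟨0, hs⟩⟩
    obtain ⟨i₀, hi₀⟩ := Finite.exists_max fun i => ‖z i‖
    simp only [sum_leaflessCount]
    refine hasSum_sum fun m _ => hasSum_coreSum hs hg m (r := max ‖z i₀‖ (1 / 2)) (by positivity)
      (max_lt (hz _) (by norm_num)) fun a => ?_
    induction a using Sym2.ind with
    | _ i j =>
      change ‖z i * z j‖ ≤ _
      rw [norm_mul]
      calc ‖z i‖ * ‖z j‖ ≤ ‖z i₀‖ * 1 := by
            gcongr
            exacts [hi₀ i, (hz j).le]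
        _ ≤ _ := by rw [mul_one]; exact le_max_left _ _
  -- sorting by the number `∑ i, p i` of half-edges
  let E := Equiv.sigmaFiberEquiv fun p : Fin s → ℕ => ∑ i, p i
  have hfin : ∀ n, Fintype {p : Fin s → ℕ // ∑ i, p i = n} := fun n =>
    Fintype.subtype (Finset.piAntidiag Finset.univ n) fun p => by
      rw [Finset.mem_piAntidiag]; simp
  have hfib : ∀ (n : ℕ) (F : (Fin s → ℕ) → ℂ), ∑ p : {p : Fin s → ℕ // ∑ i, p i = n}, F p =
      ∑ p ∈ Finset.piAntidiag Finset.univ n, F p := by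
    intro n F
    refine (Finset.sum_subtype _ (fun p => ?_) F).symm
    rw [Finset.mem_piAntidiag]; simp
  have hnorm : ∀ p : Fin s → ℕ, ((‖leaflessCount s g p * ∏ i, z i ^ p i‖ : ℝ) : ℂ) =
      leaflessCount s g p * ∏ i, ((‖z i‖ : ℝ) : ℂ) ^ p i := by
    intro p
    rw [norm_mul, Complex.ofReal_mul, norm_leaflessCount, norm_prod]
    simp
  have hS : Summable fun p : Fin s → ℕ => ‖leaflessCount s g p * ∏ i, z i ^ p i‖ := by
    rw [← E.summable_iff]
    refine (summable_sigma_of_nonneg fun _ => norm_nonneg _).2 ⟨fun n => ?_, ?_⟩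
    · exact (hasSum_fintype _).summable
    · rw [← Complex.summable_ofReal]
      refine (hG (fun i => (‖z i‖ : ℝ)) (by simpa using hz)).summable.congr fun n => ?_
      rw [← hfib, tsum_fintype, Complex.ofReal_sum]
      exact Finset.sum_congr rfl fun p _ => (hnorm p.1).symm
  refine ⟨hS, ?_⟩
  rw [← E.hasSum_iff]
  refine HasSum.sigma_of_hasSum (hG z hz) (fun n => ?_) ((E.summable_iff).2 hS.of_norm)
  rw [← hfib]
  exact hasSum_fintype _

/-- The contribution of the maps with face lengths `q.2` whose leafless parts have the face lengths
`q.1`. -/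
noncomputable def treeTerm (s g : ℕ) (u : Fin s → ℂ) (q : (Fin s → ℕ) × (Fin s → ℕ)) : ℂ :=
  leaflessCount s g q.1 * ∏ i, ((treeCount (q.2 i) (q.1 i) : ℂ) * u i ^ q.2 i)

theorem summable_norm_treeCount {u : ℂ} (hu : ‖u‖ < 1 / 2) (p : ℕ) :
    Summable fun k => ‖(treeCount k p : ℂ) * u ^ k‖ := by
  simpa using (summable_treeCount_mul_pow (norm_nonneg u) hu.le p).1

theorem hasSum_treeTerm {u z : Fin s → ℂ} (hu : ∀ i, ‖u i‖ < 1 / 2) (hz : ∀ i, ‖z i‖ < 1)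
    (h : ∀ i, u i * (1 + z i ^ 2) = z i) (p : Fin s → ℕ) :
    HasSum (fun k => treeTerm s g u (p, k)) (leaflessCount s g p * ∏ i, z i ^ p i) :=
  have h1 : ∀ i, Summable fun k => ‖(treeCount k (p i) : ℂ) * u i ^ k‖ := fun i =>
    summable_norm_treeCount (hu i) (p i)
  have h2 : ∀ i, HasSum (fun k => (treeCount k (p i) : ℂ) * u i ^ k) (z i ^ p i) := fun i =>
    hasSum_treeCount (hu i) (hz i).le (h i) (p i)
  (hasSum_pi_prod (f := fun i k => (treeCount k (p i) : ℂ) * u i ^ k) (a := fun i => z i ^ p i)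
    h1 h2).2.mul_left (leaflessCount s g p)

/-- The tree series at `‖u i‖` are at most powers of `2 ‖u i‖ < 1`. -/
theorem summable_norm_treeTerm {u : Fin s → ℂ} (hu : ∀ i, ‖u i‖ < 1 / 2) (p : Fin s → ℕ) :
    Summable (fun k => ‖treeTerm s g u (p, k)‖) ∧ ∑' k, ‖treeTerm s g u (p, k)‖ ≤
      ‖leaflessCount s g p * ∏ i, (((2 * ‖u i‖ : ℝ) : ℂ)) ^ p i‖ := by
  have h1 : ∀ i, Summable fun k =>
      ‖((‖(treeCount k (p i) : ℂ) * u i ^ k‖ : ℝ) : ℂ)‖ := by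
    intro i
    simp only [Complex.norm_real, norm_norm]
    exact summable_norm_treeCount (hu i) (p i)
  have h2 := hasSum_pi_prod (f := fun i k => ((‖(treeCount k (p i) : ℂ) * u i ^ k‖ : ℝ) : ℂ))
    (a := fun i => ((∑' k, ‖(treeCount k (p i) : ℂ) * u i ^ k‖ : ℝ) : ℂ))
    h1 fun i => Complex.hasSum_ofReal.2 (summable_norm_treeCount (hu i) (p i)).hasSum
  have h3 : HasSum (fun k : Fin s → ℕ => ‖∏ i, (treeCount (k i) (p i) : ℂ) * u i ^ k i‖)
      (∏ i, ∑' k, ‖(treeCount k (p i) : ℂ) * u i ^ k‖) := by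
    rw [← Complex.hasSum_ofReal]
    have e1 : (fun k : Fin s → ℕ => ∏ i, ((‖(treeCount (k i) (p i) : ℂ) * u i ^ k i‖ : ℝ) : ℂ)) =
        fun k : Fin s → ℕ => ((‖∏ i, (treeCount (k i) (p i) : ℂ) * u i ^ k i‖ : ℝ) : ℂ) := by
      funext k
      rw [norm_prod, Complex.ofReal_prod]
    rw [← e1, Complex.ofReal_prod]
    exact h2.2
  have h4 : HasSum (fun k => ‖treeTerm s g u (p, k)‖)
      (‖leaflessCount s g p‖ * ∏ i, ∑' k, ‖(treeCount k (p i) : ℂ) * u i ^ k‖) := by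
    simpa only [treeTerm, norm_mul] using h3.mul_left ‖leaflessCount s g p‖
  refine ⟨h4.summable, ?_⟩
  rw [h4.tsum_eq, norm_mul, norm_prod]
  refine mul_le_mul_of_nonneg_left (Finset.prod_le_prod (fun i _ => tsum_nonneg fun k =>
    norm_nonneg _) fun i _ => ?_) (norm_nonneg _)
  rw [norm_pow, Complex.norm_real, Real.norm_of_nonneg (by positivity)]
  simpa using (summable_treeCount_mul_pow (norm_nonneg (u i)) (hu i).le (p i)).2

/-- Summation over all maps: `u i` and `z i` are related by `u = z / (1 + z ^ 2)`. -/
theorem hasSum_markedCount (hs : 1 ≤ s) (hg : 2 < 2 * g + s) {u z : Fin s → ℂ}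
    (hu : ∀ i, ‖u i‖ < 1 / 2) (hz : ∀ i, ‖z i‖ < 1) (h : ∀ i, u i * (1 + z i ^ 2) = z i) :
    HasSum (fun k : Fin s → ℕ => (∏ i, u i ^ k i) * markedCount s g k 0) (shapeGen s g z) := by
  classical
  have hsum : Summable (treeTerm s g u) := by
    refine Summable.of_norm ((summable_prod_of_nonneg fun _ => norm_nonneg _).2
      ⟨fun p => (summable_norm_treeTerm hu p).1, ?_⟩)
    -- the norms are dominated by the series of leafless maps at `2 * ‖u i‖ < 1`
    have h2 := (hasSum_leaflessCount hs hg (z := fun i => ((2 * ‖u i‖ : ℝ) : ℂ)) fun i => by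
      rw [Complex.norm_real, Real.norm_of_nonneg (by positivity)]
      linarith [hu i]).1
    exact Summable.of_nonneg_of_le (fun p => tsum_nonneg fun _ => norm_nonneg _)
      (fun p => (summable_norm_treeTerm hu p).2) h2
  have htot : HasSum (treeTerm s g u) (shapeGen s g z) := by
    have h1 := hsum.hasSum.prod_fiberwise fun p => hasSum_treeTerm hu hz h p
    rw [← h1.unique (hasSum_leaflessCount hs hg hz).2]
    exact hsum.hasSum
  have hswap : HasSum (treeTerm s g u ∘ Prod.swap) (shapeGen s g z) :=
    (Equiv.prodComm _ _).hasSum_iff.2 htot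
  refine hswap.prod_fiberwise fun k => ?_
  rw [markedCount_eq_sum_treeCount hs hg, Finset.mul_sum]
  have h1 : ∀ p : Fin s → ℕ, (treeTerm s g u ∘ Prod.swap) (k, p) =
      (∏ i, u i ^ k i) * ((∏ i, (treeCount (k i) (p i) : ℂ)) * leaflessCount s g p) := by
    intro p
    simp only [treeTerm, Function.comp, Prod.swap, Finset.prod_mul_distrib]
    ring
  simp only [h1]
  refine hasSum_sum_of_ne_finset_zero fun p hp => ?_
  rw [Fintype.mem_piFinset] at hp
  push Not at hp
  obtain ⟨i, hi⟩ := hp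
  rw [Finset.mem_range, not_lt] at hi
  rw [Finset.prod_eq_zero (f := fun i => (treeCount (k i) (p i) : ℂ)) (Finset.mem_univ i), zero_mul, mul_zero]
  rw [treeCount_eq_zero (by omega), Nat.cast_zero]

end

/-! ### Genus means count maps -/

section
variable {s g : ℕ}

theorem finRotate_mk {n j : ℕ} (h : j + 1 < n) :
    finRotate n ⟨j, by omega⟩ = ⟨j + 1, h⟩ := by
  obtain ⟨n, rfl⟩ : ∃ m, n = m + 1 := ⟨n - 1, by omega⟩
  exact finRotate_of_lt (by omega)

theorem finRotate_mk_last {n j : ℕ} (h : j + 1 = n) :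
    finRotate n ⟨j, by omega⟩ = ⟨0, by omega⟩ := by
  subst h
  exact finRotate_last'

open Classical in
/-- The bijections which identify the blockwise rotation with a permutation `φ`, compatibly with
labels of its cycles, are determined by the choice of an origin in every cycle. -/
theorem card_rot_equiv {D : Type} [Fintype D] [DecidableEq D] {k : Fin s → ℕ} (hk : ∀ i, k i ≠ 0)
    {φ : Perm D} {ℓ : D → Fin s} (hinv : ∀ x, ℓ (φ x) = ℓ x)
    (hsep : ∀ f : D → Prop, (∀ x, f (φ x) = f x) → ∀ x y, ℓ x = ℓ y → f x = f y)
    (hcard : ∀ i, (Finset.univ.filter fun x => ℓ x = i).card = k i) :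
    (Finset.univ.filter fun β : HalfEdge k ≃ D =>
      ∀ d, β (rot k d) = φ (β d) ∧ ℓ (β d) = d.1).card = ∏ i, k i := by
  have h0 : ∀ i, 0 < k i := fun i => Nat.pos_of_ne_zero (hk i)
  have h1 : (∏ i, k i) = Fintype.card (∀ i, {x // ℓ x = i}) := by
    rw [Fintype.card_pi]
    refine Finset.prod_congr rfl fun i _ => ?_
    rw [Fintype.card_subtype, hcard]
  rw [h1, ← Fintype.card_subtype]
  refine Fintype.card_of_bijective (f := fun β i => ⟨β.1 ⟨i, 0, h0 i⟩, (β.2 _).2⟩) ⟨?_, ?_⟩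
  · intro β β' h
    have h2 : ∀ i, β.1 ⟨i, 0, h0 i⟩ = β'.1 ⟨i, 0, h0 i⟩ := fun i =>
      congrArg Subtype.val (congrFun h i)
    have h3 : ∀ i j (hj : j < k i), β.1 ⟨i, j, hj⟩ = β'.1 ⟨i, j, hj⟩ := by
      intro i j
      induction j with
      | zero => intro _; exact h2 i
      | succ j ih =>
        intro hj
        have e : (⟨i, j + 1, hj⟩ : HalfEdge k) = rot k ⟨i, j, by omega⟩ := by
          rw [rot, Perm.sigmaCongrRight, Equiv.sigmaCongrRight_apply]
          exact congrArg (Sigma.mk i) (finRotate_mk hj).symm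
        rw [e, (β.2 _).1, (β'.2 _).1, ih]
    exact Subtype.ext (Equiv.ext fun ⟨i, j, hj⟩ => h3 i j hj)
  · intro b
    have hl : ∀ i (j : ℕ), ℓ (φ^[j] (b i).1) = i := by
      intro i j
      induction j with
      | zero => exact (b i).2
      | succ j ih => rw [Function.iterate_succ_apply', hinv, ih]
    -- the orbit of the origin `b i` exhausts the cycle `i`, which has `k i` elements
    have hper : ∀ i, Function.minimalPeriod φ (b i).1 ≤ k i := by
      intro i
      rw [← hcard i, ← Finset.card_range (Function.minimalPeriod φ (b i).1)]
      refine Finset.card_le_card_of_injOn (fun j => φ^[j] (b i).1) (fun j _ => ?_) fun x hx y hy h => ?_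
      · simp [hl]
      · exact Function.iterate_injOn_Iio_minimalPeriod (Finset.mem_range.1 hx)
          (Finset.mem_range.1 hy) h
    have hpos : ∀ i, 0 < Function.minimalPeriod φ (b i).1 := fun i =>
      Function.minimalPeriod_pos_of_mem_periodicPts
        (φ.injective.mem_periodicPts _)
    have hreach : ∀ y, ∃ j < Function.minimalPeriod φ (b (ℓ y)).1, φ^[j] (b (ℓ y)).1 = y := by
      intro y
      have hs : φ.SameCycle (b (ℓ y)).1 y := by
        refine sameCycle_of_forall_invariant fun f hf => hsep f hf _ _ ?_
        exact (b (ℓ y)).2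
      obtain ⟨m, -, -, hm⟩ := hs.exists_pow_eq
      refine ⟨m % Function.minimalPeriod φ (b (ℓ y)).1, Nat.mod_lt _ (hpos _), ?_⟩
      rw [Function.iterate_mod_minimalPeriod_eq, Equiv.Perm.iterate_eq_pow, hm]
    have hper' : ∀ i, Function.minimalPeriod φ (b i).1 = k i := by
      intro i
      refine le_antisymm (hper i) ?_
      rw [← hcard i]
      conv_rhs => rw [← Finset.card_range (Function.minimalPeriod φ (b i).1)]
      refine Finset.card_le_card_of_surjOn (fun j => φ^[j] (b i).1) fun y hy => ?_
      obtain rfl : ℓ y = i := by simpa using hy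
      obtain ⟨j, hj, h⟩ := hreach y
      exact ⟨j, by simpa using hj, h⟩
    let f : HalfEdge k → D := fun d => φ^[d.2] (b d.1).1
    have hsurj : Function.Surjective f := by
      intro y
      obtain ⟨j, hj, h⟩ := hreach y
      exact ⟨⟨ℓ y, j, hj.trans_eq (hper' _)⟩, h⟩
    have hcardD : Fintype.card (HalfEdge k) = Fintype.card D := by
      rw [Fintype.card_sigma, ← Finset.card_univ (α := D),
        Finset.card_eq_sum_card_fiberwise (f := ℓ) (t := Finset.univ) (fun _ _ => Finset.mem_univ _)]
      simp [hcard]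
    have hbij := (Fintype.bijective_iff_surjective_and_card f).2 ⟨hsurj, hcardD⟩
    refine ⟨⟨Equiv.ofBijective f hbij, fun d => ⟨?_, hl _ _⟩⟩, ?_⟩
    · obtain ⟨i, j, hj⟩ := d
      change f (rot k ⟨i, j, hj⟩) = φ (φ^[j] (b i).1)
      rw [← Function.iterate_succ_apply' φ]
      rcases Nat.lt_or_ge (j + 1) (k i) with h | h
      · have e : rot k ⟨i, j, hj⟩ = (⟨i, j + 1, h⟩ : HalfEdge k) := by
          rw [rot, Perm.sigmaCongrRight, Equiv.sigmaCongrRight_apply]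
          exact congrArg (Sigma.mk i) (finRotate_mk h)
        rw [e]
      · have h' : j + 1 = k i := by omega
        have e : rot k ⟨i, j, hj⟩ = (⟨i, 0, h0 i⟩ : HalfEdge k) := by
          rw [rot, Perm.sigmaCongrRight, Equiv.sigmaCongrRight_apply]
          exact congrArg (Sigma.mk i) (finRotate_mk_last h')
        have h6 : φ^[k i] (b i).1 = (b i).1 := by
          rw [← hper' i]
          exact Function.iterate_minimalPeriod
        rw [e, Nat.succ_eq_add_one, h', h6]
        rfl
    · rfl

/-- A map and its dual are connected at the same time. -/
theorem permConnected_mul_iff {D : Type} {v e : Perm D} :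
    PermConnected (v * e) e ↔ PermConnected v e := by
  constructor
  · intro h f hv he
    exact h f (fun x => by rw [Perm.mul_apply, hv, he]) he
  · intro h f hv he
    refine h f (fun x => ?_) he
    have h1 := hv (e.symm x)
    have h2 := he (e.symm x)
    rw [Perm.mul_apply, Equiv.apply_symm_apply] at h1
    rw [Equiv.apply_symm_apply] at h2
    rw [h1, h2]

open Classical in
/-- The genus mean of a product of traces is the weighted number of maps with given face lengths: a
pairing of the half-edges of the `s` polygons is a map with an origin in each face. -/
theorem genusMean_eq_markedCount (hs : 1 ≤ s) (g : ℕ) {k : Fin s → ℕ} (hk : ∀ i, k i ≠ 0) :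
    genusMean g k = (∏ i, (k i : ℂ)) * markedCount s g k 0 := by
  let n := ∑ i, k i
  let good : (HalfEdge k ≃ Fin n) → Triple s (Fin n) → Prop := fun β M =>
    ∀ d, β (rot k d) = (M.1 * M.2.1) (β d) ∧ M.2.2 (β d) = d.1
  let std : Triple s (HalfEdge k) → Prop := fun M =>
    ∀ d, rot k d = M.1 (M.2.1 d) ∧ M.2.2 d = d.1
  have hcard : ∀ (i : Fin s), (Finset.univ.filter fun d : HalfEdge k => d.1 = i).card = k i := by
    intro i
    have := card_blockSet k {i}
    simpa [blockSet] using this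
  have h1 : ∀ M ∈ mapSet s g (Fin n), ∑ β : HalfEdge k ≃ Fin n, (if good β M then (1 : ℂ) else 0) =
      if perim M = k then ∏ i, (k i : ℂ) else 0 := by
    intro M hM
    have hM' := mem_mapSet.1 hM
    split_ifs with hp
    · rw [Finset.sum_boole, card_rot_equiv hk (φ := M.1 * M.2.1) (ℓ := M.2.2) hM'.inv hM'.sep
        (fun i => congrFun hp i)]
      push_cast
      rfl
    · refine Finset.sum_eq_zero fun β _ => if_neg fun hg => hp ?_
      funext i
      rw [← hcard i]
      exact card_filter_equiv β fun d => by rw [(hg d).2]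
  have h2 : ∀ β : HalfEdge k ≃ Fin n, ∑ M ∈ mapSet s g (Fin n), (if good β M then (1 : ℂ) else 0) =
      ∑ M ∈ mapSet s g (HalfEdge k), if std M then (1 : ℂ) else 0 := by
    intro β
    refine (sum_mapSet_congr β _ _ fun M => ?_).symm
    simp only [good, std, Perm.mul_apply, Triple.map_snd, Triple.map_fst, Triple.map_label,
      β.injective.eq_iff]
  have h3 : ∑ M ∈ mapSet s g (HalfEdge k), (if std M then (1 : ℂ) else 0) = genusMean g k := by
    rw [genusMean_eq_card hs g hk, Finset.sum_boole]
    congr 1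
    symm
    refine Finset.card_bij' (fun e _ => (rot k * e, e, Sigma.fst)) (fun M _ => M.2.1) ?_ ?_ ?_ ?_
    · intro e he
      obtain ⟨hp, hc, hg⟩ := Finset.mem_filter.1 he
      have hp' := mem_pairings.1 hp
      refine Finset.mem_filter.2 ⟨mem_mapSet.2 ⟨hp, permConnected_mul_iff.2 hc, fun i =>
        ⟨⟨i, 0, Nat.pos_of_ne_zero (hk i)⟩, rfl⟩, fun x => ?_, fun f hf x y hxy => ?_, hg⟩, ?_⟩
      · simp [hp'.1, rot_fst]
      · refine apply_eq_of_sameCycle (σ := rot k) (fun x => ?_) (sameCycle_rot_iff.2 hxy)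
        have := hf x
        simpa [hp'.1] using this
      · intro d
        simp [hp'.1]
    · intro M hM
      obtain ⟨hM, hstd⟩ := Finset.mem_filter.1 hM
      have hM' := mem_mapSet.1 hM
      have hv : M.1 = rot k * M.2.1 := by
        ext1 d
        rw [Perm.mul_apply, (hstd _).1, (mem_pairings.1 hM'.pairing).1]
      refine Finset.mem_filter.2 ⟨hM'.pairing, ?_, ?_⟩
      · rw [← permConnected_mul_iff, ← hv]
        exact hM'.conn
      · rw [← hv]
        exact hM'.genus
    · intro e _
      rfl
    · intro M hM
      obtain ⟨hM, hstd⟩ := Finset.mem_filter.1 hM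
      have hM' := mem_mapSet.1 hM
      refine Prod.ext ?_ (Prod.ext rfl ?_)
      · ext1 d
        change rot k (M.2.1 d) = _
        rw [(hstd _).1, (mem_pairings.1 hM'.pairing).1]
      · funext d
        exact (hstd d).2.symm
  have h4 := Finset.sum_congr rfl h1
  rw [Finset.sum_comm, Finset.sum_congr rfl fun β _ => h2 β, h3, Finset.sum_const, Finset.card_univ,
    nsmul_eq_mul] at h4
  have hn : Fintype.card (HalfEdge k ≃ Fin n) = n.factorial := by
    have e : HalfEdge k ≃ Fin n := Fintype.equivFinOfCardEq (by simp [n])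
    rw [Fintype.card_equiv e]
    simp [n]
  have hne : (n.factorial : ℂ) ≠ 0 := by exact_mod_cast n.factorial_ne_zero
  rw [hn] at h4
  apply mul_left_cancel₀ hne
  rw [h4, markedCount, mul_left_comm, ← mul_assoc (n.factorial : ℂ), mul_one_div_cancel hne, one_mul,
    Finset.mul_sum]
  refine Finset.sum_congr rfl fun M _ => ?_
  simp

theorem markedCount_eq_zero_of_exists {k : Fin s → ℕ} {i : Fin s} (hi : k i = 0) :
    markedCount s g k 0 = 0 := by
  refine mul_eq_zero_of_right _ (Finset.sum_eq_zero fun M hM => if_neg fun hp => ?_)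
  obtain ⟨x, hx⟩ := (mem_mapSet.1 hM).surj i
  have h1 := congrFun hp i
  rw [hi, perim, Finset.card_eq_zero] at h1
  exact Finset.notMem_empty x (h1 ▸ Finset.mem_filter.2 ⟨Finset.mem_univ x, hx⟩)

/-- The genus means of the logarithms. -/
theorem hasSum_genusMean (hs : 1 ≤ s) (hg : 2 < 2 * g + s) {l : Fin s → ℂ}
    (hl : ∀ i, 0 < (l i).re ∧ 2 < ‖Complex.exp (l i) + Complex.exp (-l i)‖) :
    HasSum (fun k : Fin s → ℕ =>
        (∏ i, logCoeff (Complex.exp (l i) + Complex.exp (-l i)) (k i)) * genusMean g k)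
      ((-1) ^ s * shapeGen s g fun i => Complex.exp (-l i)) := by
  have hz : ∀ i, ‖Complex.exp (-l i)‖ < 1 := by
    intro i
    rw [Complex.norm_exp, Real.exp_lt_one_iff]
    simpa using (hl i).1
  have hx : ∀ i, Complex.exp (l i) + Complex.exp (-l i) ≠ 0 := by
    intro i h
    have := (hl i).2
    rw [h, norm_zero] at this
    linarith
  have hu : ∀ i, ‖(Complex.exp (l i) + Complex.exp (-l i))⁻¹‖ < 1 / 2 := by
    intro i
    rw [norm_inv, one_div]
    exact inv_strictAnti₀ (by norm_num) (hl i).2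
  have h := (hasSum_markedCount hs hg hu hz fun i => by
    rw [inv_mul_eq_iff_eq_mul₀ (hx i), add_mul, ← Complex.exp_add, add_neg_cancel, Complex.exp_zero]
    ring).mul_left ((-1) ^ s)
  have e : (fun k : Fin s → ℕ =>
      (∏ i, logCoeff (Complex.exp (l i) + Complex.exp (-l i)) (k i)) * genusMean g k) =
      fun k : Fin s → ℕ => (-1) ^ s *
        ((∏ i, (Complex.exp (l i) + Complex.exp (-l i))⁻¹ ^ k i) * markedCount s g k 0) := by
    funext k
    by_cases hk : ∀ i, k i ≠ 0
    · rw [genusMean_eq_markedCount hs g hk, ← mul_assoc, ← mul_assoc, ← Finset.prod_mul_distrib]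
      congr 1
      have h1 : ((-1 : ℂ)) ^ s = ∏ _i : Fin s, (-1 : ℂ) := by simp
      rw [h1, ← Finset.prod_mul_distrib]
      refine Finset.prod_congr rfl fun i _ => ?_
      have hki : (k i : ℂ) ≠ 0 := by exact_mod_cast hk i
      rw [logCoeff, if_neg (hk i), inv_pow]
      field_simp
    · push Not at hk
      obtain ⟨i, hi⟩ := hk
      rw [genusMean_eq_zero hs hg hi, markedCount_eq_zero_of_exists hi]
      simp
  rw [e]
  exact h

end

/-! ### Isomorphism classes of fatgraphs -/

section
variable {s g : ℕ}

theorem Triple.map_eq_iff {D D' : Type} (π : D ≃ D') (M : Triple s D) (M' : Triple s D') :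
    Triple.map π M = M' ↔ (∀ x, π (M.1 x) = M'.1 (π x)) ∧ (∀ x, π (M.2.1 x) = M'.2.1 (π x)) ∧
      ∀ x, M'.2.2 (π x) = M.2.2 x := by
  constructor
  · rintro rfl
    exact ⟨fun x => by simp [Triple.map], fun x => by simp [Triple.map],
      fun x => by simp [Triple.map]⟩
  · rintro ⟨h1, h2, h3⟩
    refine Prod.ext ?_ (Prod.ext ?_ ?_)
    · ext1 x
      simp [Triple.map, h1]
    · ext1 x
      simp [Triple.map, h2]
    · funext x
      simp [Triple.map, ← h3]

/-- The rotation system of a fatgraph. -/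
def Fatgraph.triple (G : Fatgraph s) : Triple s (Fin G.n) := (G.vert, G.edge, G.face)

theorem Fatgraph.permConnected (G : Fatgraph s) : PermConnected G.vert G.edge := by
  intro f hv he x y
  obtain ⟨p, hp, rfl⟩ := G.connected x y
  have : ∀ z, f (p z) = f z := by
    induction hp using Subgroup.closure_induction with
    | mem σ h =>
      rcases h with rfl | h
      · exact hv
      · rw [Set.mem_singleton_iff.1 h]; exact he
    | one => intro z; rfl
    | mul a b _ _ ha hb => intro z; rw [Perm.mul_apply, ha, hb]
    | inv a _ ha =>
      intro z
      rw [← ha (a⁻¹ z)]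
      simp
  exact (this x).symm

/-- A fatgraph of genus `g` is a map on its set of half-edges. -/
theorem Fatgraph.isMap (G : Fatgraph s) (hG : G.HasGenus g) : IsMap s g G.triple := by
  have hp : G.edge ∈ pairings Finset.univ :=
    mem_pairings.2 ⟨G.edge_edge, fun d => by simp [G.edge_ne]⟩
  refine ⟨hp, G.permConnected, G.face_surjective, fun x => ?_, fun f hf x y hxy => ?_, ?_⟩
  · refine (G.face_eq_iff _ _).2 ?_
    exact (show (G.vert * G.edge).SameCycle x ((G.vert * G.edge) x) from ⟨1, by simp⟩).symm
  · exact apply_eq_of_sameCycle (σ := G.vert * G.edge) hf ((G.face_eq_iff x y).1 hxy)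
  · have h1 := two_mul_card_edges hp
    rw [Finset.card_univ] at h1
    have h2 : G.edges.card * 2 = Fintype.card (Fin G.n) := h1
    have h3 : G.numVertices = cyc G.vert := rfl
    have h4 : G.numVertices + s + 2 * g = G.edges.card + 2 := hG
    change cyc G.vert + s + 2 * g = _
    omega

/-- The fatgraph with a given rotation system. -/
def IsMap.fatgraph (hs : 1 ≤ s) {n : ℕ} {M : Triple s (Fin n)} (h : IsMap s g M) : Fatgraph s where
  n := n
  n_pos := (h.surj ⟨0, hs⟩).choose.pos
  vert := M.1
  edge := M.2.1
  edge_edge := (mem_pairings.1 h.pairing).1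
  edge_ne x := ((mem_pairings.1 h.pairing).2 x).2 (Finset.mem_univ x)
  connected x y := by
    have hc := h.conn (fun z => ∃ p ∈ Subgroup.closure {M.1, M.2.1}, p x = z) ?_ ?_ x y
    · exact hc.mp ⟨1, Subgroup.one_mem _, rfl⟩
    · have hv : M.1 ∈ Subgroup.closure {M.1, M.2.1} := Subgroup.subset_closure (by simp)
      refine fun z => propext ⟨?_, ?_⟩
      · rintro ⟨p, hp, h⟩
        exact ⟨M.1⁻¹ * p, Subgroup.mul_mem _ (Subgroup.inv_mem _ hv) hp, by simp [h]⟩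
      · rintro ⟨p, hp, h⟩
        exact ⟨M.1 * p, Subgroup.mul_mem _ hv hp, by simp [h]⟩
    · have he : M.2.1 ∈ Subgroup.closure {M.1, M.2.1} := Subgroup.subset_closure (by simp)
      refine fun z => propext ⟨?_, ?_⟩
      · rintro ⟨p, hp, h⟩
        exact ⟨M.2.1⁻¹ * p, Subgroup.mul_mem _ (Subgroup.inv_mem _ he) hp, by simp [h]⟩
      · rintro ⟨p, hp, h⟩
        exact ⟨M.2.1 * p, Subgroup.mul_mem _ he hp, by simp [h]⟩
  face := M.2.2
  face_surjective := h.surj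
  face_eq_iff x y := ⟨fun hxy => sameCycle_of_forall_invariant fun f hf => h.sep f hf x y hxy,
    fun hxy => apply_eq_of_sameCycle (σ := M.1 * M.2.1) h.inv hxy⟩

theorem IsMap.hasGenus_fatgraph (hs : 1 ≤ s) {n : ℕ} {M : Triple s (Fin n)} (h : IsMap s g M) :
    (h.fatgraph hs).HasGenus g := by
  have h1 := two_mul_card_edges h.pairing
  rw [Finset.card_univ] at h1
  have h2 : (h.fatgraph hs).edges.card * 2 = Fintype.card (Fin n) := h1
  have h3 : (h.fatgraph hs).numVertices = cyc M.1 := rfl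
  have h4 := h.genus
  rw [Fatgraph.HasGenus]
  omega

theorem Fatgraph.three_le_valence_iff (G : Fatgraph s) (x : Fin G.n) :
    3 ≤ G.valence x ↔ G.vert x ≠ x ∧ G.vert (G.vert x) ≠ x := by
  classical
  have s0 : G.vert.SameCycle x x := ⟨0, by simp⟩
  have s1 : G.vert.SameCycle x (G.vert x) := ⟨1, by simp⟩
  have s2 : G.vert.SameCycle x (G.vert (G.vert x)) := ⟨2, by simp [zpow_ofNat, pow_two]⟩
  rw [Fatgraph.valence, Nat.card_eq_fintype_card, Fintype.card_subtype]
  constructor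
  · intro h
    by_contra hc
    have h2 : G.vert (G.vert x) = x := by
      by_contra h2
      refine hc ⟨fun h1 => h2 (by rw [h1, h1]), h2⟩
    have hle : Finset.univ.filter (fun y => G.vert.SameCycle x y) ⊆ {x, G.vert x} := by
      intro y hy
      have h3 := apply_eq_of_sameCycle (f := fun y => y = x ∨ y = G.vert x) (fun z => propext ⟨?_, ?_⟩)
        (Finset.mem_filter.1 hy).2
      · simpa using h3.mp (Or.inl rfl)
      · rintro (h | h)
        · exact Or.inr (by rw [← h2] at h; exact G.vert.injective h)
        · exact Or.inl (G.vert.injective h)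
      · rintro (h | h)
        · exact Or.inr (by rw [h])
        · exact Or.inl (by rw [h, h2])
    have := Finset.card_le_card hle
    have := Finset.card_le_two (a := x) (b := G.vert x)
    omega
  · rintro ⟨h1, h2⟩
    have h3 : ({x, G.vert x, G.vert (G.vert x)} : Finset (Fin G.n)).card = 3 := by
      rw [Finset.card_insert_of_notMem, Finset.card_pair]
      · exact fun h => h1 (G.vert.injective h.symm)
      · simp only [Finset.mem_insert, Finset.mem_singleton, not_or]
        exact ⟨h1.symm, h2.symm⟩
    rw [← h3]
    refine Finset.card_le_card fun y hy => ?_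
    simp only [Finset.mem_insert, Finset.mem_singleton] at hy
    refine Finset.mem_filter.2 ⟨Finset.mem_univ y, ?_⟩
    rcases hy with rfl | rfl | rfl
    exacts [s0, s1, s2]

open Classical in
variable (s g) in
/-- The maps on `n` labelled half-edges whose vertices have valence at least three. -/
noncomputable def shapeSet (n : ℕ) : Finset (Triple s (Fin n)) :=
  (mapSet s g (Fin n)).filter fun M => (∀ x, M.1 x ≠ x) ∧ n = n + bivalCount M

theorem mem_shapeSet {n : ℕ} {M : Triple s (Fin n)} :
    M ∈ shapeSet s g n ↔ IsMap s g M ∧ ∀ x, M.1 x ≠ x ∧ M.1 (M.1 x) ≠ x := by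
  rw [shapeSet, Finset.mem_filter, mem_mapSet]
  refine and_congr_right fun _ => ?_
  rw [left_eq_add, bivalCount, Finset.card_eq_zero, Finset.filter_eq_empty_iff]
  constructor
  · rintro ⟨h1, h2⟩ x
    exact ⟨h1 x, fun h => h2 (Finset.mem_univ x) ⟨h1 x, h⟩⟩
  · intro h
    exact ⟨fun x => (h x).1, fun x _ h' => (h x).2 h'.2⟩

theorem Fatgraph.IsShape.mem_shapeSet {G : Fatgraph s} (h : G.IsShape g) :
    G.triple ∈ shapeSet s g G.n :=
  _root_.mem_shapeSet.2 ⟨G.isMap h.1, fun x => (G.three_le_valence_iff x).1 (h.2 x)⟩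

theorem isShape_fatgraph (hs : 1 ≤ s) {n : ℕ} {M : Triple s (Fin n)} (h : M ∈ shapeSet s g n) :
    ((mem_shapeSet.1 h).1.fatgraph hs).IsShape g :=
  ⟨(mem_shapeSet.1 h).1.hasGenus_fatgraph hs, fun x =>
    (Fatgraph.three_le_valence_iff _ x).2 ((mem_shapeSet.1 h).2 x)⟩

theorem card_le_of_mem_shapeSet {n : ℕ} {M : Triple s (Fin n)} (h : M ∈ shapeSet s g n) :
    n ≤ 6 * (2 * g + s - 2) := by
  have h1 := mem_shapeSet.1 h
  have h2 := h1.1.card_le fun x => (h1.2 x).1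
  have h3 := (Finset.mem_filter.1 h).2.2
  rw [Fintype.card_fin] at h2
  omega

/-- Isomorphisms of fatgraphs are bijections which transport the rotation systems. -/
def Fatgraph.isoEquiv (G H : Fatgraph s) :
    Fatgraph.Iso G H ≃ {π : Fin G.n ≃ Fin H.n // Triple.map π G.triple = H.triple} where
  toFun f := ⟨f.toEquiv, (Triple.map_eq_iff _ _ _).2 ⟨f.map_vert, f.map_edge, f.map_face⟩⟩
  invFun π := ⟨π.1, ((Triple.map_eq_iff _ _ _).1 π.2).1, ((Triple.map_eq_iff _ _ _).1 π.2).2.1,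
    ((Triple.map_eq_iff _ _ _).1 π.2).2.2⟩
  left_inv _ := rfl
  right_inv _ := rfl

theorem finite_shape (hs : 1 ≤ s) : Finite (Shape g s) := by
  let f : (Σ n : Fin (6 * (2 * g + s - 2) + 1), {M // M ∈ shapeSet s g n}) → Shape g s :=
    fun q => Quotient.mk (Fatgraph.shapeSetoid g s) ⟨_, isShape_fatgraph hs q.2.2⟩
  refine Finite.of_surjective f fun γ => ?_
  obtain ⟨G, rfl⟩ := Quotient.exists_rep γ
  refine ⟨⟨⟨G.1.n, Nat.lt_succ_of_le (card_le_of_mem_shapeSet G.2.mem_shapeSet)⟩,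
    ⟨G.1.triple, G.2.mem_shapeSet⟩⟩, ?_⟩
  exact Quotient.sound (s := Fatgraph.shapeSetoid g s)
    ⟨⟨Equiv.refl _, fun _ => rfl, fun _ => rfl, fun _ => rfl⟩⟩

/-- The weight `1 / (exp (l i + l j) - 1)` of an edge between the faces `i` and `j`. -/
noncomputable def expWeight {K : Type} (l : K → ℂ) : Sym2 K → ℂ :=
  Sym2.lift ⟨fun i j => 1 / (Complex.exp (l i + l j) - 1), fun i j => by simp only [add_comm]⟩

theorem Fatgraph.weight_eq_edgeProd (G : Fatgraph s) (l : Fin s → ℂ) :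
    G.weight l = 1 / (G.autCard : ℂ) * edgeProd Finset.univ G.edge (expWeight l) G.face := by
  rw [Fatgraph.weight, edgeProd]
  congr 1
  refine Finset.prod_congr rfl fun q _ => ?_
  induction q using Sym2.ind with
  | _ x y => rfl

open Classical in
/-- The rotation systems isomorphic to a given one form an orbit of the symmetric group with the
automorphism group as stabilizer. -/
theorem sum_iso_fatgraph {G : Fatgraph s} (hG : G.IsShape g) :
    (∑ M ∈ shapeSet s g G.n, if ∃ π : Perm (Fin G.n), Triple.map π G.triple = M then (1 : ℂ) else 0) *
      G.autCard = G.n.factorial := by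
  have h1 : ∀ M ∈ shapeSet s g G.n,
      (if ∃ π : Perm (Fin G.n), Triple.map π G.triple = M then (1 : ℂ) else 0) * G.autCard =
      ∑ π : Perm (Fin G.n), if Triple.map π G.triple = M then 1 else 0 := by
    intro M _
    rw [Finset.sum_boole]
    split_ifs with h
    · obtain ⟨π₀, rfl⟩ := h
      rw [one_mul, Fatgraph.autCard, Nat.card_congr (Fatgraph.isoEquiv G G), Nat.card_eq_fintype_card,
        Fintype.card_subtype]
      congr 1
      refine Finset.card_bij (fun π _ => π.trans π₀) ?_ ?_ ?_
      · intro π hπ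
        refine Finset.mem_filter.2 ⟨Finset.mem_univ _, ?_⟩
        have h2 := (Finset.mem_filter.1 hπ).2
        conv_rhs => rw [← h2]
        rfl
      · intro π _ π' _ h
        ext1 x
        exact π₀.injective (Equiv.congr_fun h x)
      · intro π hπ
        refine ⟨π.trans π₀.symm, Finset.mem_filter.2 ⟨Finset.mem_univ _, ?_⟩, ?_⟩
        · have h2 := congrArg (Triple.map π₀.symm) (Finset.mem_filter.1 hπ).2
          have h3 : Triple.map π₀.symm (Triple.map π₀ G.triple) = G.triple :=
            (Triple.map π₀).left_inv _
          rw [h3] at h2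
          exact h2
        · ext x
          simp
    · rw [zero_mul, eq_comm, Nat.cast_eq_zero, Finset.card_eq_zero, Finset.filter_eq_empty_iff]
      exact fun π _ hπ => h ⟨π, hπ⟩
  rw [Finset.sum_mul, Finset.sum_congr rfl h1, Finset.sum_comm]
  have h2 : ∀ π : Perm (Fin G.n), ∑ M ∈ shapeSet s g G.n,
      (if Triple.map π G.triple = M then (1 : ℂ) else 0) = 1 := by
    intro π
    rw [Finset.sum_ite_eq, if_pos]
    have h3 := mem_shapeSet.1 hG.mem_shapeSet
    refine mem_shapeSet.2 ⟨h3.1.map π, fun x => ?_⟩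
    obtain ⟨x, rfl⟩ := π.surjective x
    rw [Triple.map_fst, Triple.map_fst, Ne, Ne, π.injective.eq_iff, π.injective.eq_iff]
    exact h3.2 x
  rw [Finset.sum_congr rfl fun π _ => h2 π, Finset.sum_const, Finset.card_univ, Fintype.card_perm,
    Fintype.card_fin, nsmul_eq_mul, mul_one]

open Classical in
/-- The sum over isomorphism classes weighted with `1 / |Aut|` is a sum over labelled objects: the
isomorphism class of a shape with `n` half-edges contains `n! / |Aut|` rotation systems on `Fin n`. -/
theorem shapeSum_eq_sum (hs : 1 ≤ s) (l : Fin s → ℂ) {K : ℕ} (hK : 6 * (2 * g + s - 2) < K) :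
    shapeSum g s l = ∑ n ∈ Finset.range K, 1 / (n.factorial : ℂ) *
      ∑ M ∈ shapeSet s g n, edgeProd Finset.univ M.2.1 (expWeight l) M.2.2 := by
  have := finite_shape (g := g) hs
  have := Fintype.ofFinite (Shape g s)
  -- `M` represents the isomorphism class `γ`
  let R : ∀ n, Triple s (Fin n) → Shape g s → Prop := fun n M γ =>
    ∃ G : {G : Fatgraph s // G.IsShape g}, Quotient.mk (Fatgraph.shapeSetoid g s) G = γ ∧
      ∃ π : Fin G.1.n ≃ Fin n, Triple.map π G.1.triple = M
  have hR : ∀ (G : {G : Fatgraph s // G.IsShape g}) n M,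
      R n M (Quotient.mk (Fatgraph.shapeSetoid g s) G) ↔
        ∃ π : Fin G.1.n ≃ Fin n, Triple.map π G.1.triple = M := by
    intro G n M
    constructor
    · rintro ⟨G', h1, π, rfl⟩
      obtain ⟨f⟩ := Quotient.exact (s := Fatgraph.shapeSetoid g s) h1
      obtain ⟨σ, hσ⟩ := Fatgraph.isoEquiv _ _ f
      refine ⟨σ.symm.trans π, ?_⟩
      rw [← hσ]
      change Triple.map π (Triple.map σ.symm (Triple.map σ G'.1.triple)) = _
      congr 1
      exact (Triple.map σ).left_inv _
    · rintro ⟨π, h⟩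
      exact ⟨G, rfl, π, h⟩
  have h1 : ∀ n, ∀ M ∈ shapeSet s g n, ∑ γ : Shape g s, (if R n M γ then (1 : ℂ) else 0) = 1 := by
    intro n M hM
    let γ₀ : Shape g s := Quotient.mk (Fatgraph.shapeSetoid g s) ⟨_, isShape_fatgraph hs hM⟩
    refine (Finset.sum_eq_single γ₀ ?_ ?_).trans ?_
    rotate_left 2
    · refine if_pos ((hR _ _ _).2 ⟨Equiv.refl _, ?_⟩)
      rfl
    · intro γ _ hγ
      refine if_neg ?_
      obtain ⟨G, rfl⟩ := Quotient.exists_rep γ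
      rw [hR]
      rintro ⟨π, h⟩
      refine hγ (Quotient.sound (s := Fatgraph.shapeSetoid g s) ?_)
      exact ⟨(Fatgraph.isoEquiv G.1 ((mem_shapeSet.1 hM).1.fatgraph hs)).symm ⟨π, h⟩⟩
    · intro h
      exact absurd (Finset.mem_univ _) h
  have h2 : ∀ n, ∑ M ∈ shapeSet s g n, edgeProd Finset.univ M.2.1 (expWeight l) M.2.2 =
      ∑ γ : Shape g s, ∑ M ∈ shapeSet s g n, (if R n M γ then (1 : ℂ) else 0) *
        edgeProd Finset.univ M.2.1 (expWeight l) M.2.2 := by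
    intro n
    rw [Finset.sum_comm]
    refine Finset.sum_congr rfl fun M hM => ?_
    rw [← Finset.sum_mul, h1 n M hM, one_mul]
  simp only [h2, Finset.mul_sum]
  rw [shapeSum, finsum_eq_sum_of_fintype, Finset.sum_comm]
  refine Finset.sum_congr rfl fun γ _ => ?_
  obtain ⟨G, rfl⟩ := Quotient.exists_rep γ
  change G.1.weight l = _
  have hGn := card_le_of_mem_shapeSet G.2.mem_shapeSet
  rw [Finset.sum_eq_single G.1.n]
  · have h3 := sum_iso_fatgraph G.2
    have h4 : ∀ M ∈ shapeSet s g G.1.n, 1 / (G.1.n.factorial : ℂ) *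
        ((if R G.1.n M (Quotient.mk (Fatgraph.shapeSetoid g s) G) then (1 : ℂ) else 0) *
          edgeProd Finset.univ M.2.1 (expWeight l) M.2.2) =
        (1 / (G.1.n.factorial : ℂ) * edgeProd Finset.univ G.1.edge (expWeight l) G.1.face) *
          if ∃ π : Perm (Fin G.1.n), Triple.map π G.1.triple = M then (1 : ℂ) else 0 := by
      intro M _
      simp only [hR]
      split_ifs with h
      · obtain ⟨π, rfl⟩ := h
        rw [edgeProd_map]
        simp only [Fatgraph.triple]
        ring
      · simp
    rw [Finset.sum_congr rfl h4, ← Finset.mul_sum, Fatgraph.weight_eq_edgeProd]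
    have hf : (G.1.n.factorial : ℂ) ≠ 0 := by exact_mod_cast G.1.n.factorial_ne_zero
    have ha : (G.1.autCard : ℂ) ≠ 0 := by
      intro h
      rw [h, mul_zero] at h3
      exact hf h3.symm
    rw [← h3] at hf ⊢
    have hb := left_ne_zero_of_mul hf
    field_simp
  · intro n _ hn
    refine Finset.sum_eq_zero fun M _ => ?_
    rw [if_neg, zero_mul, mul_zero]
    rw [hR]
    rintro ⟨π, -⟩
    exact hn (by simpa using (Fintype.card_congr π).symm)
  · intro h
    rw [Finset.mem_range] at h
    omega

/-- With `w = z i * z j` and `z = exp (-l)` the chain weight `w / (1 - w)` is `1 / (exp (l i + l j) - 1)`. -/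
theorem shapeGen_eq_shapeSum (hs : 1 ≤ s) (l : Fin s → ℂ) :
    shapeGen s g (fun i => Complex.exp (-l i)) = shapeSum g s l := by
  rw [shapeSum_eq_sum hs l (Nat.lt_succ_self _), shapeGen]
  refine Finset.sum_congr rfl fun n _ => ?_
  have h : (fun a => mulWeight (fun i => Complex.exp (-l i)) a /
      (1 - mulWeight (fun i => Complex.exp (-l i)) a)) = expWeight l := by
    funext a
    induction a using Sym2.ind with
    | _ i j =>
      change Complex.exp (-l i) * Complex.exp (-l j) / (1 - Complex.exp (-l i) * Complex.exp (-l j)) =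
        1 / (Complex.exp (l i + l j) - 1)
      rw [← Complex.exp_add, ← neg_add, Complex.exp_neg, ← one_div]
      have h0 := Complex.exp_ne_zero (l i + l j)
      by_cases h1 : Complex.exp (l i + l j) - 1 = 0
      · rw [h1, sub_eq_zero.1 h1]
        simp
      · field_simp
  rw [h]
  rfl

end

/-! ### The exponential formula for pairs of permutations -/

section
variable {D D' : Type}

theorem sameCycle_permCongr (π : D ≃ D') {σ : Perm D} {x y : D} :
    (π.permCongr σ).SameCycle (π x) (π y) ↔ σ.SameCycle x y := by
  constructor <;> intro h
  · refine sameCycle_of_forall_invariant fun f hf => ?_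
    have := apply_eq_of_sameCycle (f := fun z => f (π.symm z)) (fun z => by simp [hf]) h
    simpa using this
  · refine sameCycle_of_forall_invariant fun f hf => ?_
    refine apply_eq_of_sameCycle (f := fun z => f (π z)) (fun z => ?_) h
    rw [← hf (π z)]
    simp

theorem sameCycle_sumCongr_inl {σ : Perm D} {σ' : Perm D'} {x : D} {y : D ⊕ D'} :
    (Perm.sumCongr σ σ').SameCycle (Sum.inl x) y ↔ ∃ z, σ.SameCycle x z ∧ y = Sum.inl z := by
  constructor
  · intro h
    have := apply_eq_of_sameCycle (f := fun y => ∃ z, σ.SameCycle x z ∧ y = Sum.inl z)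
      (fun y => propext ?_) h
    · exact this.mp ⟨x, ⟨0, by simp⟩, rfl⟩
    · rcases y with y | y
      · simp
      · simp
  · rintro ⟨z, h, rfl⟩
    refine sameCycle_of_forall_invariant fun f hf => ?_
    refine apply_eq_of_sameCycle (f := fun z => f (Sum.inl z)) (fun z => ?_) h
    rw [← hf (Sum.inl z)]
    rfl

theorem cyc_sumCongr [Finite D] [Finite D'] (σ : Perm D) (σ' : Perm D') :
    cyc (Perm.sumCongr σ σ') = cyc σ + cyc σ' := by
  refine cyc_eq_of_invariant ?_
  have h := natCard_invariant σ Bool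
  have hB : Nat.card Bool = 2 := by simp
  rw [hB] at h
  rw [← h, ← Nat.card_prod]
  refine Nat.card_congr ⟨fun f => (⟨fun x => f.1 (Sum.inl x), fun x => f.2 (Sum.inl x)⟩,
    ⟨fun x => f.1 (Sum.inr x), fun x => f.2 (Sum.inr x)⟩), fun p =>
    ⟨Sum.elim p.1.1 p.2.1, ?_⟩, ?_, ?_⟩
  · rintro (x | x)
    exacts [p.1.2 x, p.2.2 x]
  · rintro ⟨f, hf⟩
    apply Subtype.ext
    funext x
    rcases x with x | x <;> rfl
  · rintro ⟨f, f'⟩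
    rfl

/-- The contribution of a half-edge to the number of half-edges minus twice the number of
vertices. -/
noncomputable def excess (σ : Perm D) (d : D) : ℂ := 1 - 2 / (Nat.card {y // σ.SameCycle d y} : ℂ)

theorem excess_permCongr (π : D ≃ D') (σ : Perm D) (d : D) :
    excess (π.permCongr σ) (π d) = excess σ d := by
  unfold excess
  have h : {y // σ.SameCycle d y} ≃ {z // (π.permCongr σ).SameCycle (π d) z} :=
    π.subtypeEquiv fun y => (sameCycle_permCongr π).symm
  rw [Nat.card_congr h]

theorem excess_sumCongr (σ : Perm D) (σ' : Perm D') (d : D) :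
    excess (Perm.sumCongr σ σ') (Sum.inl d) = excess σ d := by
  unfold excess
  rw [← Nat.card_congr (Equiv.ofBijective (fun y : {y // σ.SameCycle d y} =>
    (⟨Sum.inl y.1, sameCycle_sumCongr_inl.2 ⟨y.1, y.2, rfl⟩⟩ :
      {y // (Perm.sumCongr σ σ').SameCycle (Sum.inl d) y})) ⟨?_, ?_⟩)]
  · intro y y' h
    exact Subtype.ext (Sum.inl_injective (congrArg Subtype.val h))
  · rintro ⟨y, hy⟩
    obtain ⟨z, hz, rfl⟩ := sameCycle_sumCongr_inl.1 hy
    exact ⟨⟨z, hz⟩, rfl⟩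

/-- Each cycle of length `k` has the total excess `k - 2`. -/
theorem sum_excess [Fintype D] (σ : Perm D) :
    ∑ d, excess σ d = (Fintype.card D : ℂ) - 2 * cyc σ := by
  classical
  have : Fintype (Quotient (Perm.SameCycle.setoid σ)) := Fintype.ofFinite _
  have h1 : ∑ d, 1 / (Nat.card {y // σ.SameCycle d y} : ℂ) = cyc σ := by
    rw [← Finset.sum_fiberwise (g := fun d => Quotient.mk (Perm.SameCycle.setoid σ) d), cyc,
      Nat.card_eq_fintype_card, ← Finset.card_univ, Finset.card_eq_sum_ones, Nat.cast_sum]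
    refine Finset.sum_congr rfl fun c _ => ?_
    obtain ⟨x, rfl⟩ := Quotient.exists_rep c
    have hx : (Finset.univ.filter fun d => Quotient.mk (Perm.SameCycle.setoid σ) d =
        Quotient.mk _ x) = Finset.univ.filter fun d => σ.SameCycle x d := by
      refine Finset.filter_congr fun d _ => ?_
      rw [Quotient.eq]
      exact ⟨fun h => Perm.SameCycle.symm h, fun h => Perm.SameCycle.symm h⟩
    have h2 : ∀ d ∈ Finset.univ.filter (fun d => σ.SameCycle x d),
        1 / (Nat.card {y // σ.SameCycle d y} : ℂ) =
          1 / ((Finset.univ.filter fun d => σ.SameCycle x d).card : ℂ) := by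
      intro d hd
      have hd' := (Finset.mem_filter.1 hd).2
      rw [Nat.card_eq_fintype_card, Fintype.card_subtype]
      congr 3
      refine Finset.filter_congr fun y _ => ?_
      exact ⟨fun h => hd'.trans h, fun h => hd'.symm.trans h⟩
    rw [hx, Finset.sum_congr rfl h2, Finset.sum_const, nsmul_eq_mul, mul_one_div_cancel, Nat.cast_one]
    rw [Nat.cast_ne_zero, ← Nat.pos_iff_ne_zero, Finset.card_pos]
    exact ⟨x, Finset.mem_filter.2 ⟨Finset.mem_univ _, 0, by simp⟩⟩
  simp only [excess, Finset.sum_sub_distrib, div_eq_mul_one_div (2 : ℂ), ← Finset.mul_sum, h1]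
  simp

/-- A union `B` of components of the pair `(σ, e)` which is empty or a single component. -/
def IsComponent (σ e : Perm D) (B : Finset D) : Prop :=
  (∀ x, σ x ∈ B ↔ x ∈ B) ∧ (∀ x, e x ∈ B ↔ x ∈ B) ∧
    ∀ f : D → Prop, (∀ x, f (σ x) = f x) → (∀ x, f (e x) = f x) → ∀ x ∈ B, ∀ y ∈ B, f x = f y

open Classical in
/-- Every half-edge lies in exactly one component. -/
theorem sum_isComponent [Fintype D] [DecidableEq D] (σ e : Perm D) (θ : D → ℂ) :
    ∑ B : Finset D, (if IsComponent σ e B then ∑ d ∈ B, θ d else 0) = ∑ d, θ d := by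
  have h1 : ∀ B : Finset D, (if IsComponent σ e B then ∑ d ∈ B, θ d else 0) =
      ∑ d, if IsComponent σ e B ∧ d ∈ B then θ d else 0 := by
    intro B
    split_ifs with h
    · simp [h]
    · simp [h]
  simp only [h1]
  rw [Finset.sum_comm]
  refine Finset.sum_congr rfl fun d _ => ?_
  -- the component of `d`
  let B₀ : Finset D := Finset.univ.filter fun x => ∀ f : D → Prop, (∀ x, f (σ x) = f x) →
    (∀ x, f (e x) = f x) → f x = f d
  have hm : ∀ x, x ∈ B₀ ↔ ∀ f : D → Prop, (∀ x, f (σ x) = f x) →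
    (∀ x, f (e x) = f x) → f x = f d := fun x => by simp [B₀]
  have hB₀ : IsComponent σ e B₀ := by
    refine ⟨fun x => ?_, fun x => ?_, fun f hσ he x hx y hy => ?_⟩
    · rw [hm, hm]
      exact forall₃_congr fun f hσ _ => by rw [hσ]
    · rw [hm, hm]
      exact forall₃_congr fun f _ he => by rw [he]
    · rw [(hm x).1 hx f hσ he, (hm y).1 hy f hσ he]
  have hd : d ∈ B₀ := (hm d).2 fun _ _ _ => rfl
  rw [Finset.sum_eq_single B₀]
  · rw [if_pos ⟨hB₀, hd⟩]
  · intro B _ hB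
    refine if_neg fun ⟨h, hdB⟩ => hB ?_
    ext x
    rw [hm]
    constructor
    · intro hx f hσ he
      exact h.2.2 f hσ he x hx d hdB
    · intro hx
      have := hx (fun x => x ∈ B) (fun x => propext (h.1 x)) fun x => propext (h.2.1 x)
      exact this.mpr hdB
  · intro h
    exact absurd (Finset.mem_univ _) h

/-- Weights of pairs of permutations of finite sets. -/
abbrev PairWeight : Type 1 :=
  ∀ (D : Type) [Fintype D] [DecidableEq D], Perm D → Perm D → ℂ

/-- The weight is invariant under bijections and multiplicative for disjoint unions, and it vanishes
unless the first permutation has at most `|D| / 3` cycles. -/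
structure PairWeight.IsMultiplicative (w : PairWeight) : Prop where
  map : ∀ {D D' : Type} [Fintype D] [DecidableEq D] [Fintype D'] [DecidableEq D'] (π : D ≃ D')
    (σ e : Perm D), w D' (π.permCongr σ) (π.permCongr e) = w D σ e
  sum : ∀ {D D' : Type} [Fintype D] [DecidableEq D] [Fintype D'] [DecidableEq D'] (σ e : Perm D)
    (σ' e' : Perm D'), w (D ⊕ D') (Perm.sumCongr σ σ') (Perm.sumCongr e e') = w D σ e * w D' σ' e'
  empty : w (Fin 0) 1 1 = 1
  three_mul_cyc_le : ∀ {D : Type} [Fintype D] [DecidableEq D] (σ e : Perm D), w D σ e ≠ 0 →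
    3 * cyc σ ≤ Fintype.card D

/-- The sum of the weights of the pairs on `n` labelled half-edges with `(n - m) / 2` vertices,
divided by `n!`. -/
noncomputable def pairSum (w : PairWeight) (n m : ℕ) : ℂ :=
  1 / (n.factorial : ℂ) * ∑ σ : Perm (Fin n), ∑ e : Perm (Fin n),
    if n = m + 2 * cyc σ then w (Fin n) σ e else 0

open Classical in
/-- The connected part of `pairSum`. -/
noncomputable def connSum (w : PairWeight) (n m : ℕ) : ℂ :=
  1 / (n.factorial : ℂ) * ∑ σ : Perm (Fin n), ∑ e : Perm (Fin n),
    if n = m + 2 * cyc σ ∧ PermConnected σ e then w (Fin n) σ e else 0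

/-- A sum over permutations of a disjoint union which is supported on the permutations preserving the
two parts. -/
theorem sum_perm_sum {D D' : Type} [Fintype D] [DecidableEq D] [Fintype D'] [DecidableEq D']
    (F : Perm (D ⊕ D') → ℂ) (hF : ∀ σ, F σ ≠ 0 → ∀ x, ∃ y, σ (Sum.inl x) = Sum.inl y) :
    ∑ σ, F σ = ∑ σ : Perm D, ∑ σ' : Perm D', F (Perm.sumCongr σ σ') := by
  rw [← Fintype.sum_prod_type' (f := fun (σ : Perm D) (σ' : Perm D') => F (Perm.sumCongr σ σ'))]
  symm
  refine Finset.sum_of_injOn (fun p => Perm.sumCongr p.1 p.2) ?_ ?_ ?_ ?_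
  · intro p _ p' _ h
    exact Equiv.Perm.sumCongrHom_injective (α := D) (β := D') h
  · intro _ _
    exact Finset.mem_coe.2 (Finset.mem_univ _)
  · intro σ _ hσ
    by_contra h
    have h1 : σ ∈ (Perm.sumCongrHom D D').range := by
      refine Perm.mem_sumCongrHom_range_of_perm_mapsTo_inl ?_
      rintro _ ⟨x, rfl⟩
      obtain ⟨y, hy⟩ := hF σ h x
      exact ⟨y, hy.symm⟩
    obtain ⟨p, hp⟩ := h1
    exact hσ ⟨p, Finset.mem_coe.2 (Finset.mem_univ p), hp⟩
  · intro _ _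
    rfl

theorem isComponent_map_iff [DecidableEq D'] (π : D ≃ D') (σ e : Perm D) (B : Finset D) :
    IsComponent (π.permCongr σ) (π.permCongr e) (B.map π.toEmbedding) ↔ IsComponent σ e B := by
  unfold IsComponent
  have hmem : ∀ x, π x ∈ B.map π.toEmbedding ↔ x ∈ B := fun x => by simp
  refine and_congr ?_ (and_congr ?_ ?_)
  · rw [← π.forall_congr_right]
    simp
  · rw [← π.forall_congr_right]
    simp
  · rw [← (Equiv.arrowCongr π (Equiv.refl Prop)).forall_congr_right]
    refine forall_congr' fun f => ?_
    rw [← π.forall_congr_right, ← π.forall_congr_right, ← π.forall_congr_right]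
    simp only [Equiv.arrowCongr_apply, Function.comp, Equiv.permCongr_apply,
      Equiv.symm_apply_apply, Equiv.refl_apply, hmem]
    refine forall_congr' fun _ => forall_congr' fun _ => forall_congr' fun x => forall_congr' fun _ => ?_
    rw [← π.forall_congr_right]
    simp only [hmem, Equiv.symm_apply_apply]

/-- The left part of a disjoint union is a component exactly if it is connected. -/
theorem isComponent_sumCongr [Fintype D] (σ e : Perm D) (σ' e' : Perm D') :
    IsComponent (Perm.sumCongr σ σ') (Perm.sumCongr e e')
      (Finset.univ.map (Function.Embedding.inl : D ↪ D ⊕ D')) ↔ PermConnected σ e := by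
  constructor
  · intro h f hσ he x y
    refine h.2.2 (Sum.elim f fun _ => True) ?_ ?_ (Sum.inl x) (by simp) (Sum.inl y) (by simp)
    · rintro (x | x)
      exacts [hσ x, rfl]
    · rintro (x | x)
      exacts [he x, rfl]
  · intro h
    refine ⟨?_, ?_, fun f hσ he x hx y hy => ?_⟩
    · rintro (x | x) <;> simp
    · rintro (x | x) <;> simp
    · obtain ⟨x, -, rfl⟩ := Finset.mem_map.1 hx
      obtain ⟨y, -, rfl⟩ := Finset.mem_map.1 hy
      exact h (fun x => f (Sum.inl x)) (fun x => hσ (Sum.inl x)) (fun x => he (Sum.inl x)) x y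


theorem cyc_permCongr [Finite D] (π : D ≃ D') (σ : Perm D) : cyc (π.permCongr σ) = cyc σ := by
  have := Finite.of_equiv D π
  refine (cyc_congr π fun x => ?_).symm
  simp

open Classical in
/-- The sum over all pairs with `(|D| - m) / 2` vertices and with `B` as a component, weighted
with the excess of `B`. -/
noncomputable def markedSum (w : PairWeight) (m : ℕ) (D : Type) [Fintype D] [DecidableEq D]
    (B : Finset D) : ℂ :=
  ∑ σ : Perm D, ∑ e : Perm D, if Fintype.card D = m + 2 * cyc σ ∧ IsComponent σ e B then
    w D σ e * ∑ d ∈ B, excess σ d else 0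

variable [Fintype D] [DecidableEq D] [Fintype D'] [DecidableEq D'] {w : PairWeight}

theorem markedSum_map (hw : w.IsMultiplicative) (m : ℕ) (π : D ≃ D') (B : Finset D) :
    markedSum w m D' (B.map π.toEmbedding) = markedSum w m D B := by
  unfold markedSum
  rw [← Equiv.sum_comp π.permCongr]
  refine Finset.sum_congr rfl fun σ _ => ?_
  rw [← Equiv.sum_comp π.permCongr]
  refine Finset.sum_congr rfl fun e _ => ?_
  rw [isComponent_map_iff, cyc_permCongr, hw.map, ← Fintype.card_congr π, Finset.sum_map]
  simp only [Equiv.coe_toEmbedding, excess_permCongr]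

open Classical in
/-- If the component with the marked half-edge is the left part, then the right part carries an
arbitrary pair, and the total excess of the left part is `q.1`. -/
theorem markedSum_inl (hw : w.IsMultiplicative) (m : ℕ) :
    markedSum w m (D ⊕ D') (Finset.univ.map Function.Embedding.inl) =
      ∑ q ∈ Finset.HasAntidiagonal.antidiagonal m, (q.1 : ℂ) *
        (∑ σ : Perm D, ∑ e : Perm D,
          if Fintype.card D = q.1 + 2 * cyc σ ∧ PermConnected σ e then w D σ e else 0) *
        ∑ σ : Perm D', ∑ e : Perm D',
          if Fintype.card D' = q.2 + 2 * cyc σ then w D' σ e else 0 := by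
  unfold markedSum
  rw [sum_perm_sum]
  swap
  · intro σ hσ x
    obtain ⟨e, -, he⟩ := Finset.exists_ne_zero_of_sum_ne_zero hσ
    have h := (ite_ne_right_iff.1 he).1.2.1 (Sum.inl x)
    obtain ⟨y, -, hy⟩ := Finset.mem_map.1 (h.2 (by simp))
    exact ⟨y, hy.symm⟩
  have h1 : ∀ (σ : Perm D) (σ' : Perm D'), (∑ e : Perm (D ⊕ D'),
      if Fintype.card (D ⊕ D') = m + 2 * cyc (Perm.sumCongr σ σ') ∧
        IsComponent (Perm.sumCongr σ σ') e (Finset.univ.map Function.Embedding.inl) then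
      w (D ⊕ D') (Perm.sumCongr σ σ') e *
        ∑ d ∈ Finset.univ.map (Function.Embedding.inl : D ↪ D ⊕ D'), excess (Perm.sumCongr σ σ') d
      else 0) = ∑ e : Perm D, ∑ e' : Perm D', ∑ q ∈ Finset.HasAntidiagonal.antidiagonal m, (q.1 : ℂ) *
        (if Fintype.card D = q.1 + 2 * cyc σ ∧ PermConnected σ e then w D σ e else 0) *
        if Fintype.card D' = q.2 + 2 * cyc σ' then w D' σ' e' else 0 := by
    intro σ σ'
    rw [sum_perm_sum]
    swap
    · intro e he x
      have h := (ite_ne_right_iff.1 he).1.2.2.1 (Sum.inl x)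
      obtain ⟨y, -, hy⟩ := Finset.mem_map.1 (h.2 (by simp))
      exact ⟨y, hy.symm⟩
    refine Finset.sum_congr rfl fun e _ => Finset.sum_congr rfl fun e' _ => ?_
    rw [isComponent_sumCongr, cyc_sumCongr, hw.sum, Fintype.card_sum, Finset.sum_map]
    simp only [Function.Embedding.inl_apply, excess_sumCongr, sum_excess]
    by_cases hwσ : w D σ e = 0
    · simp [hwσ]
    by_cases hwσ' : w D' σ' e' = 0
    · simp [hwσ']
    by_cases hc : PermConnected σ e
    swap
    · simp [hc]
    have h3 := hw.three_mul_cyc_le σ e hwσ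
    have h3' := hw.three_mul_cyc_le σ' e' hwσ'
    simp only [hc, and_true]
    split_ifs with h
    · rw [Finset.sum_eq_single (Fintype.card D - 2 * cyc σ, Fintype.card D' - 2 * cyc σ')]
      · rw [if_pos (by omega), if_pos (by omega), Nat.cast_sub (by omega)]
        push_cast
        ring
      · rintro ⟨a, b⟩ hq hne
        by_cases ha : Fintype.card D = a + 2 * cyc σ
        · by_cases hb : Fintype.card D' = b + 2 * cyc σ'
          · refine absurd (Prod.ext ?_ ?_) hne
            · simp only; omega
            · simp only; omega
          · rw [if_neg hb, mul_zero]
        · rw [if_neg ha, mul_zero, zero_mul]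
      · intro hq
        rw [Finset.HasAntidiagonal.mem_antidiagonal] at hq
        omega
    · symm
      refine Finset.sum_eq_zero fun q hq => ?_
      rw [Finset.HasAntidiagonal.mem_antidiagonal] at hq
      by_cases ha : Fintype.card D = q.1 + 2 * cyc σ
      · rw [if_neg (by omega : ¬ Fintype.card D' = q.2 + 2 * cyc σ'), mul_zero]
      · rw [if_neg ha, mul_zero, zero_mul]
  rw [Finset.sum_congr rfl fun σ _ => Finset.sum_congr rfl fun σ' _ => h1 σ σ']
  symm
  simp only [mul_assoc, Finset.sum_mul_sum]
  simp only [Finset.mul_sum]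
  exact Finset.sum_comm.trans <| Finset.sum_congr rfl fun σ _ => Finset.sum_comm.trans <|
    Finset.sum_congr rfl fun σ' _ => Finset.sum_comm.trans <|
      Finset.sum_congr rfl fun e _ => Finset.sum_comm

/-- Removing the component which contains a marked half-edge. -/
theorem mul_pairSum (hw : w.IsMultiplicative) (n m : ℕ) :
    (m : ℂ) * pairSum w n m = ∑ p ∈ Finset.HasAntidiagonal.antidiagonal n, ∑ q ∈ Finset.HasAntidiagonal.antidiagonal m,
      (q.1 : ℂ) * connSum w p.1 q.1 * pairSum w p.2 q.2 := by
  classical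
  have hf : ∀ a : ℕ, (a.factorial : ℂ) ≠ 0 := fun a => by exact_mod_cast a.factorial_ne_zero
  let G : ℕ → ℂ := fun k => ∑ q ∈ Finset.HasAntidiagonal.antidiagonal m, (q.1 : ℂ) *
    (k.factorial * connSum w k q.1) * ((n - k).factorial * pairSum w (n - k) q.2)
  have h1 : ∀ B : Finset (Fin n), markedSum w m (Fin n) B = G B.card := by
    intro B
    have hc : Fintype.card {x // x ∉ B} = n - B.card := by
      rw [Fintype.card_subtype_compl]
      simp
    -- a bijection which moves `B` to the left part
    let π : Fin n ≃ Fin B.card ⊕ Fin (n - B.card) := (Equiv.sumCompl (· ∈ B)).symm.trans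
      (Equiv.sumCongr (Fintype.equivFinOfCardEq (by simp)) (Fintype.equivFinOfCardEq hc))
    have hπ : B.map π.toEmbedding = Finset.univ.map Function.Embedding.inl := by
      refine Finset.eq_of_subset_of_card_le ?_ (by simp)
      intro y hy
      obtain ⟨x, hx, rfl⟩ := Finset.mem_map.1 hy
      simp [π, Equiv.sumCompl_symm_apply_of_pos hx]
    rw [← markedSum_map hw m π, hπ, markedSum_inl hw]
    refine Finset.sum_congr rfl fun q _ => ?_
    simp only [connSum, pairSum, Fintype.card_fin]
    rw [← mul_assoc (B.card.factorial : ℂ), mul_one_div_cancel (hf _), one_mul,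
      ← mul_assoc ((n - B.card).factorial : ℂ), mul_one_div_cancel (hf _), one_mul]
  have h2 : (m : ℂ) * pairSum w n m = 1 / (n.factorial : ℂ) * ∑ B, markedSum w m (Fin n) B := by
    unfold pairSum markedSum
    rw [mul_left_comm, Finset.mul_sum, Finset.sum_comm (s := (Finset.univ : Finset (Finset (Fin n))))]
    congr 1
    refine Finset.sum_congr rfl fun σ _ => ?_
    rw [Finset.sum_comm, Finset.mul_sum]
    refine Finset.sum_congr rfl fun e _ => ?_
    rw [Fintype.card_fin]
    split_ifs with h
    · have h3 := sum_isComponent σ e (excess σ)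
      rw [sum_excess, Fintype.card_fin] at h3
      have h4 : (n : ℂ) - 2 * cyc σ = m := by
        rw [sub_eq_iff_eq_add]
        exact_mod_cast h
      rw [← h4, ← h3, mul_comm, Finset.mul_sum]
      refine Finset.sum_congr rfl fun B _ => ?_
      by_cases hB : IsComponent σ e B
      · rw [if_pos hB, if_pos ⟨h, hB⟩]
      · rw [if_neg hB, if_neg fun h => hB h.2, mul_zero]
    · rw [mul_zero]
      symm
      exact Finset.sum_eq_zero fun B _ => if_neg fun h' => h h'.1
  rw [h2, Finset.sum_congr rfl fun B _ => h1 B, ← Finset.powerset_univ,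
    Finset.sum_powerset_apply_card, Finset.Nat.sum_antidiagonal_eq_sum_range_succ_mk,
    Finset.card_univ, Fintype.card_fin, Finset.mul_sum]
  refine Finset.sum_congr rfl fun k hk => ?_
  have hk' : k ≤ n := Nat.lt_succ_iff.1 (Finset.mem_range.1 hk)
  rw [nsmul_eq_mul, ← mul_assoc, Finset.mul_sum]
  refine Finset.sum_congr rfl fun q _ => ?_
  have h3 := Nat.choose_mul_factorial_mul_factorial hk'
  have h4 : (n.choose k : ℂ) * k.factorial * (n - k).factorial = n.factorial := by
    exact_mod_cast h3
  rw [one_div, inv_mul_eq_div, div_mul_eq_mul_div, div_eq_iff (hf n), ← h4]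
  ring

end

theorem sum_range_antidiagonal {F : ℕ × ℕ → ℂ} {a b : ℕ}
    (hF : ∀ p, F p ≠ 0 → p.1 ≤ a ∧ p.2 ≤ b) :
    ∑ n ∈ Finset.range (a + b + 1), ∑ p ∈ Finset.HasAntidiagonal.antidiagonal n, F p =
      ∑ i ∈ Finset.range (a + 1), ∑ j ∈ Finset.range (b + 1), F (i, j) := by
  rw [← Finset.sum_product', ← Finset.sum_fiberwise_of_maps_to
    (s := Finset.range (a + 1) ×ˢ Finset.range (b + 1)) (t := Finset.range (a + b + 1))
    (g := fun p => p.1 + p.2)]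
  · refine Finset.sum_congr rfl fun n _ => (Finset.sum_subset ?_ ?_).symm
    · intro p hp
      exact Finset.HasAntidiagonal.mem_antidiagonal.2 (Finset.mem_filter.1 hp).2
    · intro p hp h
      by_contra hne
      have := hF p hne
      refine h (Finset.mem_filter.2 ⟨Finset.mem_product.2 ⟨?_, ?_⟩,
        Finset.HasAntidiagonal.mem_antidiagonal.1 hp⟩)
      · exact Finset.mem_range.2 (by omega)
      · exact Finset.mem_range.2 (by omega)
  · intro p hp
    have h := Finset.mem_product.1 hp
    simp only [Finset.mem_range] at h ⊢
    omega

/-- The exponential of a power series `U` is determined by the differential equation `Z' = U' Z`. -/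
theorem mk_eq_exp_subst {U : PowerSeries ℂ} (hU : PowerSeries.constantCoeff U = 0) {z : ℕ → ℂ}
    (h0 : z 0 = 1)
    (hz : ∀ m : ℕ, (m : ℂ) * z m = ∑ q ∈ Finset.HasAntidiagonal.antidiagonal m,
      (q.1 : ℂ) * PowerSeries.coeff q.1 U * z q.2) :
    PowerSeries.mk z = (PowerSeries.exp ℂ).subst U := by
  have hs : PowerSeries.HasSubst U := PowerSeries.HasSubst.of_constantCoeff_zero' hU
  set V : PowerSeries ℂ := (PowerSeries.exp ℂ).subst U with hV
  have hd := PowerSeries.derivative_subst (f := PowerSeries.exp ℂ) hs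
  rw [PowerSeries.derivative_exp, ← hV] at hd
  have hV0 : PowerSeries.coeff 0 V = 1 := by
    rw [hV, PowerSeries.coeff_subst' hs, finsum_eq_single _ 0]
    · simp
    · intro d hd
      simp [hU, hd]
  have hrec : ∀ m : ℕ, ((m + 1 : ℕ) : ℂ) * PowerSeries.coeff (m + 1) V =
      ∑ q ∈ Finset.HasAntidiagonal.antidiagonal m,
        ((q.1 + 1 : ℕ) : ℂ) * PowerSeries.coeff (q.1 + 1) U * PowerSeries.coeff q.2 V := by
    intro m
    have h1 := congrArg (PowerSeries.coeff m) hd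
    rw [mul_comm V, PowerSeries.coeff_mul, PowerSeries.coeff_derivative] at h1
    rw [mul_comm]
    push_cast
    rw [h1]
    refine Finset.sum_congr rfl fun q _ => ?_
    rw [PowerSeries.coeff_derivative]
    ring
  ext m
  rw [PowerSeries.coeff_mk]
  induction m using Nat.strong_induction_on with
  | _ m ih =>
    rcases m with _ | m
    · rw [h0, hV0]
    · have hm : ((m + 1 : ℕ) : ℂ) ≠ 0 := by exact_mod_cast m.succ_ne_zero
      refine mul_left_cancel₀ hm ?_
      rw [hrec, hz, Finset.Nat.sum_antidiagonal_succ]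
      simp only [Nat.cast_zero, zero_mul, zero_add]
      refine Finset.sum_congr rfl fun q hq => ?_
      rw [Finset.HasAntidiagonal.mem_antidiagonal] at hq
      rw [ih q.2 (by omega)]

section
variable {w : PairWeight}

theorem PairWeight.IsMultiplicative.eq_zero (hw : w.IsMultiplicative) {n m : ℕ} (h : 3 * m < n)
    {σ e : Perm (Fin n)} (hn : n = m + 2 * cyc σ) : w (Fin n) σ e = 0 := by
  by_contra hne
  have := hw.three_mul_cyc_le σ e hne
  rw [Fintype.card_fin] at this
  omega

/-- With at most `n / 3` vertices, `m = n - 2 V` is at least `n / 3`. -/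
theorem pairSum_eq_zero (hw : w.IsMultiplicative) {n m : ℕ} (h : 3 * m < n) : pairSum w n m = 0 := by
  rw [pairSum, Finset.sum_eq_zero, mul_zero]
  refine fun σ _ => Finset.sum_eq_zero fun e _ => ?_
  split_ifs with h1
  exacts [hw.eq_zero h h1, rfl]

theorem connSum_eq_zero (hw : w.IsMultiplicative) {n m : ℕ} (h : 3 * m < n) : connSum w n m = 0 := by
  rw [connSum, Finset.sum_eq_zero, mul_zero]
  refine fun σ _ => Finset.sum_eq_zero fun e _ => ?_
  split_ifs with h1
  exacts [hw.eq_zero h h1.1, rfl]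

/-- The exponential formula: the generating series of all pairs is the exponential of the
generating series of the connected ones. -/
theorem mk_pairSum_eq_exp (hw : w.IsMultiplicative) :
    (PowerSeries.mk fun m => ∑ n ∈ Finset.range (3 * m + 1), pairSum w n m) =
      (PowerSeries.exp ℂ).subst (PowerSeries.mk fun m =>
        if m = 0 then 0 else ∑ n ∈ Finset.range (3 * m + 1), connSum w n m) := by
  refine mk_eq_exp_subst ?_ ?_ ?_
  · simp [← PowerSeries.coeff_zero_eq_constantCoeff_apply]
  · rw [mul_zero, zero_add, Finset.sum_range_one, pairSum]
    have h : cyc (1 : Perm (Fin 0)) = 0 := by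
      rw [cyc]
      have : IsEmpty (Quotient (Perm.SameCycle.setoid (1 : Perm (Fin 0)))) :=
        ⟨fun q => by obtain ⟨x, -⟩ := Quotient.exists_rep q; exact x.elim0⟩
      simp
    have h1 : (default : Perm (Fin 0)) = 1 := rfl
    simp [h1, h, hw.empty]
  · intro m
    rw [Finset.mul_sum, Finset.sum_congr rfl fun n _ => mul_pairSum hw n m]
    rw [Finset.sum_congr rfl fun n _ => Finset.sum_comm, Finset.sum_comm]
    refine Finset.sum_congr rfl fun q hq => ?_
    rw [Finset.HasAntidiagonal.mem_antidiagonal] at hq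
    have h3 : 3 * m + 1 = 3 * q.1 + 3 * q.2 + 1 := by omega
    rw [h3, sum_range_antidiagonal (a := 3 * q.1) (b := 3 * q.2), PowerSeries.coeff_mk]
    · by_cases hq0 : q.1 = 0
      · simp [hq0]
      · rw [if_neg hq0, Finset.mul_sum (Finset.range (3 * q.1 + 1)), Finset.sum_mul_sum]
    · intro p hp
      constructor
      · by_contra h
        rw [connSum_eq_zero hw (by omega)] at hp
        simp at hp
      · by_contra h
        rw [pairSum_eq_zero hw (by omega)] at hp
        simp at hp

end

/-! ### The interaction of the Kontsevich–Penner model -/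

section
variable {D D' : Type}

/-- All cycles of the permutation have length at least three. -/
def CyclesGeThree (σ : Perm D) : Prop := ∀ x, σ x ≠ x ∧ σ (σ x) ≠ x

theorem cyclesGeThree_permCongr (π : D ≃ D') (σ : Perm D) :
    CyclesGeThree (π.permCongr σ) ↔ CyclesGeThree σ := by
  unfold CyclesGeThree
  rw [← π.forall_congr_right]
  simp

theorem cyclesGeThree_sumCongr (σ : Perm D) (σ' : Perm D') :
    CyclesGeThree (Perm.sumCongr σ σ') ↔ CyclesGeThree σ ∧ CyclesGeThree σ' := by
  simp [CyclesGeThree, Sum.forall]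

theorem CyclesGeThree.three_mul_cyc_le [Fintype D] {σ : Perm D}
    (h : CyclesGeThree σ) : 3 * cyc σ ≤ Fintype.card D := by
  classical
  have h1 := six_mul_cyc_le (s := 1) (M := (σ, 1, fun _ => 0)) fun x => (h x).1
  have h2 : bivalCount (s := 1) ((σ, 1, fun _ => 0) : Triple 1 D) = 0 := by
    rw [bivalCount, Finset.card_eq_zero, Finset.filter_eq_empty_iff]
    exact fun x _ hx => (h x).2 hx.2
  rw [h2] at h1
  change 6 * cyc σ ≤ _ at h1
  omega

/-- A transitive permutation has a single cycle. -/
theorem cyc_eq_one {σ : Perm D} [Nonempty D] (h : PermConnected σ 1) : cyc σ = 1 := by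
  rw [cyc, Nat.card_eq_one_iff_unique]
  refine ⟨⟨fun a b => ?_⟩, ⟨Quotient.mk _ (Classical.arbitrary D)⟩⟩
  obtain ⟨x, rfl⟩ := Quotient.exists_rep a
  obtain ⟨y, rfl⟩ := Quotient.exists_rep b
  exact Quotient.sound (s := Perm.SameCycle.setoid σ)
    (sameCycle_of_forall_invariant fun f hf => h f hf (fun _ => rfl) x y)

variable {N : ℕ} (Y : Matrix (Fin N) (Fin N) ℂ)

/-- The product of the traces `tr Y ^ k` over the lengths `k` of the cycles of `σ`. -/
def traceProd [Fintype D] [DecidableEq D] (σ : Perm D) : ℂ :=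
  ∑ f : D → Fin N, ∏ d, Y (f d) (f (σ d))

variable [Fintype D] [DecidableEq D] [Fintype D'] [DecidableEq D']

theorem traceProd_permCongr (π : D ≃ D') (σ : Perm D) :
    traceProd Y (π.permCongr σ) = traceProd Y σ := by
  unfold traceProd
  rw [← (π.arrowCongr (Equiv.refl (Fin N))).sum_comp]
  refine Finset.sum_congr rfl fun f _ => ?_
  rw [← π.prod_comp]
  simp

theorem traceProd_sumCongr (σ : Perm D) (σ' : Perm D') :
    traceProd Y (Perm.sumCongr σ σ') = traceProd Y σ * traceProd Y σ' := by
  unfold traceProd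
  rw [← (Equiv.sumArrowEquivProdArrow D D' (Fin N)).symm.sum_comp, Finset.sum_mul_sum,
    ← Finset.sum_product']
  refine Finset.sum_congr rfl fun f _ => ?_
  rw [Fintype.prod_sum_type]
  rfl

open Classical in
/-- The number of `n`-cycles is `(n - 1)!`; each of them contributes `tr Y ^ n`. -/
theorem sum_traceProd {n : ℕ} (hn : n ≠ 0) :
    (n : ℂ) * ∑ σ : Perm (Fin n), (if PermConnected σ 1 then traceProd Y σ else 0) =
      n.factorial * (Y ^ n).trace := by
  let k : Fin 1 → ℕ := fun _ => n
  have h1 : ∀ σ : Perm (Fin n), (n : ℂ) * (if PermConnected σ 1 then traceProd Y σ else 0) =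
      ∑ β : HalfEdge k ≃ Fin n, if β.permCongr (rot k) = σ then traceProd Y (rot k) else 0 := by
    intro σ
    have h2 : ∀ β : HalfEdge k ≃ Fin n, β.permCongr (rot k) = σ ↔
        ∀ d, β (rot k d) = σ (β d) ∧ (0 : Fin 1) = d.1 := by
      intro β
      rw [Equiv.ext_iff, ← β.forall_congr_right]
      refine forall_congr' fun d => ?_
      simp [Subsingleton.elim (0 : Fin 1) d.1]
    split_ifs with h
    · have h3 := card_rot_equiv (k := k) (fun _ => hn) (φ := σ) (ℓ := fun _ => 0) (fun _ => rfl)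
        (fun f hf x y _ => h f hf (fun _ => rfl) x y)
        (fun i => by simp [Subsingleton.elim (0 : Fin 1) i, k])
      have h4 : ∀ β : HalfEdge k ≃ Fin n,
          (if β.permCongr (rot k) = σ then traceProd Y (rot k) else 0) =
            if ∀ d, β (rot k d) = σ (β d) ∧ (0 : Fin 1) = d.1 then traceProd Y σ else 0 := by
        intro β
        by_cases hβ : β.permCongr (rot k) = σ
        · rw [if_pos hβ, if_pos ((h2 β).1 hβ), ← hβ, traceProd_permCongr]
        · rw [if_neg hβ, if_neg fun h => hβ ((h2 β).2 h)]
      rw [Finset.sum_congr rfl fun β _ => h4 β, ← Finset.sum_filter, Finset.sum_const, h3]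
      simp [k]
    · rw [mul_zero]
      symm
      refine Finset.sum_eq_zero fun β _ => if_neg fun hβ => h fun f hf _ x y => ?_
      subst hβ
      obtain ⟨x, rfl⟩ := β.surjective x
      obtain ⟨y, rfl⟩ := β.surjective y
      refine apply_eq_of_sameCycle hf (sameCycle_permCongr β |>.2 ?_)
      exact sameCycle_rot_iff.2 (Subsingleton.elim _ _)
  rw [Finset.mul_sum, Finset.sum_congr rfl fun σ _ => h1 σ, Finset.sum_comm]
  have h5 : traceProd Y (rot k) = (Y ^ n).trace := by
    have h6 := sum_prod_rot k fun _ => Y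
    rw [Fin.prod_univ_one, if_neg hn] at h6
    exact h6
  have h7 : Fintype.card (HalfEdge k ≃ Fin n) = n.factorial := by
    rw [Fintype.card_equiv (Fintype.equivFinOfCardEq (by simp [k])), Fintype.card_sigma]
    simp [k]
  simp only [Finset.sum_ite_eq, Finset.mem_univ, if_true, Finset.sum_const, Finset.card_univ, h7,
    h5, nsmul_eq_mul]

open Classical in
/-- The weight of a disjoint union of vertices of the Kontsevich–Penner model. -/
noncomputable def vertexWeight : PairWeight := fun _ _ _ σ e =>
  if e = 1 ∧ CyclesGeThree σ then ((N : ℂ) / 2) ^ cyc σ * traceProd Y σ else 0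

theorem cyc_fin_zero (σ : Perm (Fin 0)) : cyc σ = 0 := by
  rw [cyc]
  have : IsEmpty (Quotient (Perm.SameCycle.setoid σ)) :=
    ⟨fun q => by obtain ⟨x, -⟩ := Quotient.exists_rep q; exact x.elim0⟩
  simp

theorem vertexWeight_isMultiplicative : (vertexWeight Y).IsMultiplicative where
  map π σ e := by
    classical
    have h : π.permCongr e = 1 ↔ e = 1 := by
      rw [Equiv.ext_iff, Equiv.ext_iff, ← π.forall_congr_right]
      simp
    simp only [vertexWeight, h, cyclesGeThree_permCongr, cyc_permCongr, traceProd_permCongr]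
  sum σ e σ' e' := by
    classical
    have h : Perm.sumCongr e e' = 1 ↔ e = 1 ∧ e' = 1 := by
      simp [Equiv.ext_iff, Sum.forall]
    simp only [vertexWeight, h, cyclesGeThree_sumCongr, cyc_sumCongr, traceProd_sumCongr]
    by_cases h1 : e = 1 ∧ CyclesGeThree σ
    · by_cases h2 : e' = 1 ∧ CyclesGeThree σ'
      · rw [if_pos h1, if_pos h2, if_pos ⟨⟨h1.1, h2.1⟩, h1.2, h2.2⟩]
        ring
      · rw [if_neg h2, if_neg fun h => h2 ⟨h.1.2, h.2.2⟩, mul_zero]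
    · rw [if_neg h1, if_neg fun h => h1 ⟨h.1.1, h.2.1⟩, zero_mul]
  empty := by
    classical
    have h : CyclesGeThree (1 : Perm (Fin 0)) := fun x => x.elim0
    simp [vertexWeight, h, cyc_fin_zero, traceProd]
  three_mul_cyc_le σ e h := by
    classical
    rw [vertexWeight] at h
    exact (ite_ne_right_iff.1 h).1.2.three_mul_cyc_le

/-- The connected contributions are those of a single vertex. -/
theorem sum_connSum_vertexWeight {m : ℕ} (hm : m ≠ 0) :
    ∑ n ∈ Finset.range (3 * m + 1), connSum (vertexWeight Y) n m =
      (N : ℂ) / 2 * ((Y ^ (m + 2)).trace / ((m + 2 : ℕ) : ℂ)) := by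
  classical
  have hcyc : ∀ {n : ℕ} (σ : Perm (Fin n)), n = m + 2 * cyc σ → PermConnected σ 1 → n = m + 2 := by
    intro n σ h1 h2
    have : NeZero n := ⟨by omega⟩
    rw [cyc_eq_one h2] at h1
    exact h1
  rw [Finset.sum_eq_single (m + 2)]
  · have h2 := sum_traceProd Y (n := m + 2) (by omega)
    have h3 : ∀ σ e : Perm (Fin (m + 2)), (if m + 2 = m + 2 * cyc σ ∧ PermConnected σ e then
        vertexWeight Y (Fin (m + 2)) σ e else 0) =
        if e = 1 then (N : ℂ) / 2 * (if PermConnected σ 1 then traceProd Y σ else 0) else 0 := by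
      intro σ e
      by_cases he : e = 1
      · subst he
        rw [if_pos rfl]
        by_cases hc : PermConnected σ 1
        · have h4 := cyc_eq_one hc
          -- a single cycle on `m + 2 ≥ 3` points
          have h5 : CyclesGeThree σ := by
            have hno : ∀ x, ∃ y : Fin (m + 2), y ≠ x ∧ y ≠ σ x := by
              intro x
              by_contra hx
              push Not at hx
              have h6 : (Finset.univ : Finset (Fin (m + 2))) ⊆ {x, σ x} := by
                intro y _
                by_cases hy : y = x
                · simp [hy]
                · simp [hx y hy]
              have := Finset.card_le_card h6
              have := Finset.card_le_two (a := x) (b := σ x)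
              simp at *
              omega
            have hsq : ∀ x, σ (σ x) ≠ x := by
              intro x hx
              obtain ⟨y, hy, hy'⟩ := hno x
              have := hc (fun z => z = x ∨ z = σ x) (fun z => propext ⟨?_, ?_⟩) (fun _ => rfl) x y
              · rcases this.mp (Or.inl rfl) with h | h
                exacts [hy h, hy' h]
              · rintro (h | h)
                · exact Or.inr (σ.injective (h.trans hx.symm))
                · exact Or.inl (σ.injective h)
              · rintro (h | h)
                · exact Or.inr (by rw [h])
                · exact Or.inl (by rw [h, hx])
            exact fun x => ⟨fun h => hsq x (by rw [h, h]), hsq x⟩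
          rw [if_pos ⟨by rw [h4], hc⟩, if_pos hc, vertexWeight, if_pos ⟨rfl, h5⟩, h4, pow_one]
        · rw [if_neg fun h => hc h.2, if_neg hc, mul_zero]
      · rw [if_neg he, vertexWeight, if_neg fun h : e = 1 ∧ CyclesGeThree σ => he h.1, ite_self]
    have hf : ((m + 2).factorial : ℂ) ≠ 0 := by exact_mod_cast (m + 2).factorial_ne_zero
    have hm2 : ((m + 2 : ℕ) : ℂ) ≠ 0 := by exact_mod_cast (by omega : m + 2 ≠ 0)
    simp only [connSum, h3, Finset.sum_ite_eq', Finset.mem_univ, if_true]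
    rw [← Finset.mul_sum]
    rw [mul_comm, ← eq_div_iff hm2] at h2
    rw [h2]
    field_simp
  · intro n _ hn
    rw [connSum, Finset.sum_eq_zero, mul_zero]
    refine fun σ _ => Finset.sum_eq_zero fun e _ => ?_
    by_cases he : e = 1
    · subst he
      exact if_neg fun h => hn (hcyc σ h.1 h.2)
    · rw [vertexWeight, if_neg fun h : e = 1 ∧ CyclesGeThree σ => he h.1, ite_self]
  · intro h
    rw [Finset.mem_range] at h
    omega

/-- The exponential of the interaction is the sum over all collections of vertices. -/
theorem exp_kpInteraction : (PowerSeries.exp ℂ).subst (kpInteraction Y) =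
    PowerSeries.mk fun m => ∑ n ∈ Finset.range (3 * m + 1), pairSum (vertexWeight Y) n m := by
  rw [mk_pairSum_eq_exp (vertexWeight_isMultiplicative Y)]
  congr 1
  ext m
  rw [kpInteraction, PowerSeries.coeff_mk, PowerSeries.coeff_mk]
  split_ifs with h
  exacts [rfl, (sum_connSum_vertexWeight Y h).symm]

end

/-! ### The formal integral as a sum over fatgraphs -/

section
variable {D D' : Type} {N : ℕ}

theorem hermitianAverage_sum {c : Sym2 (Fin N) → ℝ} (hc : ∀ q, 0 < c q)
    {Q : Matrix (Fin N) (Fin N) ℂ → ℂ} (hQ : ∀ H, Q H = ∑ i, ∑ j, (c s(i, j) : ℂ) * H i j * H j i)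
    {κ : Type} (S : Finset κ) (P : κ → Matrix (Fin N) (Fin N) ℂ → ℂ)
    (hP : ∀ k, ∃ p : MvPolynomial (Fin N × Fin N) ℂ, ∀ x : Fin N × Fin N → ℝ,
      P k (hermitianOf x) = MvPolynomial.eval (fun q => (x q : ℂ)) p) :
    hermitianAverage N Q (fun H => ∑ k ∈ S, P k H) = ∑ k ∈ S, hermitianAverage N Q (P k) := by
  choose p hp using hP
  have ha : ∀ p, 0 < quadCoeff c p := fun p => by
    unfold quadCoeff
    split_ifs
    · exact hc _
    · linarith [hc s(p.1, p.2)]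
  have h1 : ∀ k, (∫ x : Fin N × Fin N → ℝ, P k (hermitianOf x) * Complex.exp (-Q (hermitianOf x))) =
      gaussInt (quadCoeff c) (p k) := by
    intro k
    unfold gaussInt
    simp only [hQ, quadForm_hermitianOf, hp]
  have h2 : (∫ x : Fin N × Fin N → ℝ, (∑ k ∈ S, P k (hermitianOf x)) *
      Complex.exp (-Q (hermitianOf x))) = gaussInt (quadCoeff c) (∑ k ∈ S, p k) := by
    unfold gaussInt
    simp only [hQ, quadForm_hermitianOf, hp, map_sum]
  unfold hermitianAverage
  rw [h2, gaussInt_sum ha, Finset.sum_div]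
  simp only [h1]

theorem exists_eval_sum_prod {κ : Type} (S : Finset κ) (b : κ → ℂ) (A : Finset D)
    (r t : κ → D → Fin N) :
    ∃ p : MvPolynomial (Fin N × Fin N) ℂ, ∀ x : Fin N × Fin N → ℝ,
      ∑ k ∈ S, b k * ∏ d ∈ A, hermitianOf x (r k d) (t k d) =
        MvPolynomial.eval (fun q => (x q : ℂ)) p := by
  refine ⟨∑ k ∈ S, MvPolynomial.C (b k) * ∏ d ∈ A, linForm (entryCoeff (r k d) (t k d)), fun x => ?_⟩
  simp only [map_sum, map_mul, map_prod, eval_entryCoeff, MvPolynomial.eval_C]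

variable [Fintype D] [DecidableEq D] [Fintype D'] [DecidableEq D']

/-- The sum over the assignments `f` of eigenvalues to the faces of `(σ, e)` of the products of the
edge weights. -/
def faceSum (W : Sym2 (Fin N) → ℂ) (σ e : Perm D) : ℂ :=
  ∑ f : D → Fin N, (∏ d, if f d = f (σ (e d)) then 1 else 0) * edgeProd Finset.univ e W f

open Classical in
/-- The weight of a not necessarily connected fatgraph with vertices of valence at least three. -/
noncomputable def fatgraphWeight (W : Sym2 (Fin N) → ℂ) : PairWeight := fun _ _ _ σ e =>
  if CyclesGeThree σ ∧ e ∈ pairings Finset.univ then ((N : ℂ) / 2) ^ cyc σ * faceSum W σ e else 0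

/-- The sum over collections of vertices as a polynomial in the matrix entries. -/
theorem pairSum_vertexWeight (Y : Matrix (Fin N) (Fin N) ℂ) (n m : ℕ) [DecidablePred
    (CyclesGeThree (D := Fin n))] :
    pairSum (vertexWeight Y) n m = ∑ p : Perm (Fin n) × (Fin n → Fin N),
      (1 / (n.factorial : ℂ) * if n = m + 2 * cyc p.1 ∧ CyclesGeThree p.1 then
        ((N : ℂ) / 2) ^ cyc p.1 else 0) * ∏ d, Y (p.2 d) (p.2 (p.1 d)) := by
  classical
  rw [pairSum, Fintype.sum_prod_type, Finset.mul_sum]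
  refine Finset.sum_congr rfl fun σ _ => ?_
  simp only [mul_assoc, ← Finset.mul_sum]
  congr 1
  rw [Finset.sum_eq_single 1]
  · simp only [vertexWeight, true_and, traceProd]
    by_cases h1 : n = m + 2 * cyc σ
    · by_cases h2 : CyclesGeThree σ
      · rw [if_pos h1, if_pos h2, if_pos ⟨h1, h2⟩]
      · rw [if_pos h1, if_neg h2, if_neg fun h => h2 h.2, zero_mul]
    · rw [if_neg h1, if_neg fun h => h1 h.1, zero_mul]
  · intro e _ he
    rw [vertexWeight, if_neg fun h : e = 1 ∧ CyclesGeThree σ => he h.1, ite_self]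
  · intro h
    exact absurd (Finset.mem_univ _) h

/-- Wick's theorem joins the vertices to fatgraphs. -/
theorem hermitianAverage_pairSum {c : Sym2 (Fin N) → ℝ} (hc : ∀ q, 0 < c q)
    {Q : Matrix (Fin N) (Fin N) ℂ → ℂ} (hQ : ∀ H, Q H = ∑ i, ∑ j, (c s(i, j) : ℂ) * H i j * H j i)
    (n m : ℕ) :
    hermitianAverage N Q (fun Y => pairSum (vertexWeight Y) n m) =
      pairSum (fatgraphWeight fun q => 1 / (2 * (c q : ℂ))) n m := by
  classical
  have h := hermitianAverage_sum_prod hc Q (fun Y => pairSum (vertexWeight Y) n m) hQ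
    (Finset.univ : Finset (Perm (Fin n) × (Fin n → Fin N)))
    (fun p => 1 / (n.factorial : ℂ) * if n = m + 2 * cyc p.1 ∧ CyclesGeThree p.1 then
      ((N : ℂ) / 2) ^ cyc p.1 else 0) (fun p => p.2) (fun p d => p.2 (p.1 d)) Finset.univ
    (fun Y => pairSum_vertexWeight Y n m)
  rw [h, pairSum, Fintype.sum_prod_type, Finset.mul_sum]
  refine Finset.sum_congr rfl fun σ _ => ?_
  simp only [mul_assoc, ← Finset.mul_sum]
  congr 1
  simp only [fatgraphWeight]
  by_cases h1 : n = m + 2 * cyc σ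
  · by_cases h2 : CyclesGeThree σ
    · simp only [h2, true_and, and_true, if_pos h1, faceSum]
      rw [Finset.sum_comm, ← Finset.sum_filter, Finset.filter_univ_mem, Finset.mul_sum]
    · simp [h2]
  · simp [h1]

theorem kpQuadratic_eq (l : Fin N → ℝ) (Y : Matrix (Fin N) (Fin N) ℂ) :
    kpQuadratic l Y = ∑ i, ∑ j, ((N : ℂ) / 4 * (Complex.exp (l i + l j) - 1)) * Y i j * Y j i := by
  rw [kpQuadratic, Matrix.trace_sub, pow_two, Matrix.trace, Matrix.trace, ← Finset.sum_sub_distrib,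
    Finset.mul_sum]
  refine Finset.sum_congr rfl fun i _ => ?_
  rw [Matrix.diag_apply, Matrix.diag_apply, Matrix.mul_apply, Matrix.mul_apply,
    ← Finset.sum_sub_distrib, Finset.mul_sum]
  refine Finset.sum_congr rfl fun j _ => ?_
  rw [Matrix.mul_diagonal, Matrix.diagonal_mul, Complex.exp_add]
  ring

/-- The formal integral is the sum over all fatgraphs. The quadratic form has the coefficients
`c s(i, j) = N (exp (l i + l j) - 1) / 4`, so that the propagator is
`1 / (2 c) = 2 / (N (exp (l i + l j) - 1))`. -/
theorem kpIntegral_eq (hN : 1 ≤ N) {l : Fin N → ℝ} (hl : ∀ i, 0 < l i) :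
    kpIntegral N l = PowerSeries.mk fun m => ∑ n ∈ Finset.range (3 * m + 1),
      pairSum (fatgraphWeight fun q => 2 / (N : ℂ) * expWeight (fun i => (l i : ℂ)) q) n m := by
  classical
  let c : Sym2 (Fin N) → ℝ := Sym2.lift ⟨fun i j => (N : ℝ) / 4 * (Real.exp (l i + l j) - 1),
    fun i j => by simp only [add_comm]⟩
  have hN' : (0 : ℝ) < N := by exact_mod_cast hN
  have hc : ∀ q, 0 < c q := by
    intro q
    induction q using Sym2.ind with
    | _ i j =>
      have h1 := hl i
      have h2 := hl j
      have h3 : 1 < Real.exp (l i + l j) := Real.one_lt_exp_iff.2 (by linarith)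
      have h4 : 0 < Real.exp (l i + l j) - 1 := by linarith
      change 0 < (N : ℝ) / 4 * (Real.exp (l i + l j) - 1)
      positivity
  have hQ : ∀ H, kpQuadratic l H = ∑ i, ∑ j, (c s(i, j) : ℂ) * H i j * H j i := by
    intro H
    rw [kpQuadratic_eq]
    refine Finset.sum_congr rfl fun i _ => Finset.sum_congr rfl fun j _ => ?_
    simp [c]
  have hW : (fun q => 1 / (2 * (c q : ℂ))) =
      fun q => 2 / (N : ℂ) * expWeight (fun i => (l i : ℂ)) q := by
    funext q
    induction q using Sym2.ind with
    | _ i j =>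
      have hN0 : (N : ℂ) ≠ 0 := by exact_mod_cast hN'.ne'
      have h0 : Complex.exp (l i + l j) - 1 ≠ 0 := by
        have := (hc s(i, j)).ne'
        intro h
        apply this
        have h2 : Real.exp (l i + l j) - 1 = 0 := by exact_mod_cast h
        change (N : ℝ) / 4 * (Real.exp (l i + l j) - 1) = 0
        rw [h2, mul_zero]
      simp only [c, expWeight, Sym2.lift_mk]
      push_cast
      field_simp
      norm_num
  rw [kpIntegral]
  congr 1
  funext m
  simp only [exp_kpInteraction, PowerSeries.coeff_mk]
  rw [hermitianAverage_sum hc hQ _ fun n Y => pairSum (vertexWeight Y) n m]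
  · refine Finset.sum_congr rfl fun n _ => ?_
    rw [hermitianAverage_pairSum hc hQ, hW]
  · intro n
    simp only [pairSum_vertexWeight]
    exact exists_eval_sum_prod _ _ _ _ _

theorem pairings_permCongr (π : D ≃ D') (e : Perm D) :
    π.permCongr e ∈ pairings Finset.univ ↔ e ∈ pairings Finset.univ := by
  rw [mem_pairings, mem_pairings, ← π.forall_congr_right, ← π.forall_congr_right]
  simp

theorem pairings_sumCongr (e : Perm D) (e' : Perm D') :
    Perm.sumCongr e e' ∈ pairings Finset.univ ↔
      e ∈ pairings Finset.univ ∧ e' ∈ pairings Finset.univ := by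
  simp only [mem_pairings, Sum.forall, Perm.sumCongr_apply, Sum.map_inl, Sum.map_inr,
    Sum.inl.injEq, Sum.inr.injEq, Finset.mem_univ, ne_eq, iff_true]
  tauto

theorem faceSum_permCongr (W : Sym2 (Fin N) → ℂ) (π : D ≃ D') (σ e : Perm D) :
    faceSum W (π.permCongr σ) (π.permCongr e) = faceSum W σ e := by
  unfold faceSum
  rw [← (π.arrowCongr (Equiv.refl (Fin N))).sum_comp]
  refine Finset.sum_congr rfl fun f _ => ?_
  congr 1
  · rw [← π.prod_comp]
    simp
  · change edgeProd _ _ W (f ∘ π.symm) = _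
    rw [← edgeProd_image π π.injective Finset.univ (e := e) (e' := π.permCongr e) (r := f)
      (r' := f ∘ π.symm) (fun x _ => by simp) W (fun x => by simp),
      Finset.image_univ_of_surjective π.surjective]

theorem edgeProd_sumCongr (W : Sym2 (Fin N) → ℂ) (e : Perm D) (e' : Perm D') (f : D → Fin N)
    (f' : D' → Fin N) :
    edgeProd Finset.univ (Perm.sumCongr e e') W (Sum.elim f f') =
      edgeProd Finset.univ e W f * edgeProd Finset.univ e' W f' := by
  rw [← edgeProd_image (Sum.inl : D → D ⊕ D') Sum.inl_injective Finset.univ (e' := Perm.sumCongr e e')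
      (r := f) (r' := Sum.elim f f') (fun x _ => rfl) W (fun x => rfl),
    ← edgeProd_image (Sum.inr : D' → D ⊕ D') Sum.inr_injective Finset.univ (e := e')
      (e' := Perm.sumCongr e e') (r := f') (r' := Sum.elim f f') (fun x _ => rfl) W (fun x => rfl)]
  unfold edgeProd
  rw [← Finset.prod_union, ← Finset.image_union]
  · congr 2
    ext x
    rcases x with x | x <;> simp
  · rw [Finset.disjoint_left]
    intro q hq hq'
    simp only [Finset.mem_image, Finset.mem_univ, true_and, exists_exists_eq_and] at hq hq'
    obtain ⟨x, rfl⟩ := hq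
    obtain ⟨y, hy⟩ := hq'
    simp at hy

theorem faceSum_sumCongr (W : Sym2 (Fin N) → ℂ) (σ e : Perm D) (σ' e' : Perm D') :
    faceSum W (Perm.sumCongr σ σ') (Perm.sumCongr e e') = faceSum W σ e * faceSum W σ' e' := by
  unfold faceSum
  rw [← (Equiv.sumArrowEquivProdArrow D D' (Fin N)).symm.sum_comp, Finset.sum_mul_sum,
    ← Finset.sum_product']
  refine Finset.sum_congr rfl fun f _ => ?_
  rw [Fintype.prod_sum_type]
  change (_ * _) * edgeProd Finset.univ _ W (Sum.elim f.1 f.2) = _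
  rw [edgeProd_sumCongr]
  change (∏ d, if f.1 d = f.1 (σ (e d)) then (1 : ℂ) else 0) *
    (∏ d, if f.2 d = f.2 (σ' (e' d)) then (1 : ℂ) else 0) * _ = _
  ring

theorem fatgraphWeight_isMultiplicative (W : Sym2 (Fin N) → ℂ) :
    (fatgraphWeight W).IsMultiplicative where
  map π σ e := by
    classical
    simp only [fatgraphWeight, pairings_permCongr, cyclesGeThree_permCongr, cyc_permCongr,
      faceSum_permCongr]
  sum σ e σ' e' := by
    classical
    simp only [fatgraphWeight, pairings_sumCongr, cyclesGeThree_sumCongr, cyc_sumCongr,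
      faceSum_sumCongr]
    by_cases h1 : CyclesGeThree σ ∧ e ∈ pairings Finset.univ
    · by_cases h2 : CyclesGeThree σ' ∧ e' ∈ pairings Finset.univ
      · rw [if_pos h1, if_pos h2, if_pos ⟨⟨h1.1, h2.1⟩, h1.2, h2.2⟩]
        ring
      · rw [if_neg h2, if_neg fun h => h2 ⟨h.1.2, h.2.2⟩, mul_zero]
    · rw [if_neg h1, if_neg fun h => h1 ⟨h.1.1, h.2.1⟩, zero_mul]
  empty := by
    classical
    have h : CyclesGeThree (1 : Perm (Fin 0)) := fun x => x.elim0
    have h2 : (1 : Perm (Fin 0)) ∈ pairings Finset.univ :=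
      mem_pairings.2 ⟨fun x => x.elim0, fun x => x.elim0⟩
    rw [fatgraphWeight, if_pos ⟨h, h2⟩]
    simp [cyc_fin_zero, faceSum, edgeProd]
  three_mul_cyc_le σ e h := by
    classical
    rw [fatgraphWeight] at h
    exact (ite_ne_right_iff.1 h).1.1.three_mul_cyc_le

end

/-! ### The free energy -/

section
variable {D : Type} {s : ℕ}

/-- A labelling of the cycles of `φ` by `Fin s`, given as a function on the half-edges. -/
def IsLabelling (φ : Perm D) (ℓ : D → Fin s) : Prop :=
  Function.Surjective ℓ ∧ (∀ x, ℓ (φ x) = ℓ x) ∧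
    ∀ f : D → Prop, (∀ x, f (φ x) = f x) → ∀ x y, ℓ x = ℓ y → f x = f y

/-- Labellings of the cycles are numberings of the set of cycles. -/
noncomputable def labellingEquiv (φ : Perm D) :
    {ℓ : D → Fin s // IsLabelling φ ℓ} ≃ (Quotient (Perm.SameCycle.setoid φ) ≃ Fin s) where
  toFun ℓ := Equiv.ofBijective
    (Quotient.lift (s := Perm.SameCycle.setoid φ) ℓ.1 fun _ _ h => apply_eq_of_sameCycle ℓ.2.2.1 h) (by
      constructor
      · intro a b h
        obtain ⟨x, rfl⟩ := Quotient.exists_rep a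
        obtain ⟨y, rfl⟩ := Quotient.exists_rep b
        exact Quotient.sound (s := Perm.SameCycle.setoid φ)
          (sameCycle_of_forall_invariant fun f hf => ℓ.2.2.2 f hf x y h)
      · intro i
        obtain ⟨x, hx⟩ := ℓ.2.1 i
        exact ⟨Quotient.mk _ x, hx⟩)
  invFun π := ⟨fun x => π (Quotient.mk _ x), by
    refine ⟨fun i => ?_, fun x => ?_, fun f hf x y h => ?_⟩
    · obtain ⟨x, hx⟩ := Quotient.exists_rep (π.symm i)
      exact ⟨x, (congrArg π hx).trans (π.apply_symm_apply i)⟩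
    · refine congrArg π (Quotient.sound (s := Perm.SameCycle.setoid φ) ?_)
      exact (show φ.SameCycle x (φ x) from ⟨1, by simp⟩).symm
    · exact apply_eq_of_sameCycle hf (Quotient.exact (s := Perm.SameCycle.setoid φ) (π.injective h))⟩
  left_inv _ := rfl
  right_inv π := by
    ext a
    obtain ⟨x, rfl⟩ := Quotient.exists_rep a
    rfl

open Classical in
/-- There are `s!` labellings if the number of cycles is `s`, and none otherwise. -/
theorem card_isLabelling [Fintype D] [DecidableEq D] (φ : Perm D) :
    (Finset.univ.filter fun ℓ : D → Fin s => IsLabelling φ ℓ).card =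
      if s = cyc φ then s.factorial else 0 := by
  have : Fintype (Quotient (Perm.SameCycle.setoid φ)) := Fintype.ofFinite _
  rw [← Fintype.card_subtype, Fintype.card_congr (labellingEquiv φ)]
  split_ifs with h
  · have hc : Fintype.card (Quotient (Perm.SameCycle.setoid φ)) = s := by
      rw [h, cyc, Nat.card_eq_fintype_card]
    rw [Fintype.card_equiv (Fintype.equivFinOfCardEq hc), hc]
  · rw [Fintype.card_eq_zero_iff]
    refine ⟨fun π => h ?_⟩
    rw [cyc, Nat.card_congr π, Nat.card_eq_fintype_card, Fintype.card_fin]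

open Classical in
/-- Invariant functions are functions of the labels. -/
theorem sum_isLabelling [Fintype D] [DecidableEq D] (φ : Perm D) {K : Type} [Fintype K]
    [DecidableEq K] (Ψ : (D → K) → ℂ) :
    (∑ ℓ : D → Fin s, if IsLabelling φ ℓ then ∑ i : Fin s → K, Ψ (i ∘ ℓ) else 0) =
      (if s = cyc φ then (s.factorial : ℂ) else 0) *
        ∑ f : D → K, if ∀ x, f (φ x) = f x then Ψ f else 0 := by
  have h1 : ∀ ℓ : D → Fin s, IsLabelling φ ℓ → ∑ i : Fin s → K, Ψ (i ∘ ℓ) =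
      ∑ f : D → K, if ∀ x, f (φ x) = f x then Ψ f else 0 := by
    intro ℓ hℓ
    rw [← Finset.sum_filter]
    refine Finset.sum_bij (fun i _ => i ∘ ℓ) ?_ ?_ ?_ fun _ _ => rfl
    · intro i _
      exact Finset.mem_filter.2 ⟨Finset.mem_univ _, fun x => congrArg i (hℓ.2.1 x)⟩
    · intro i _ i' _ h
      exact hℓ.1.injective_comp_right h
    · intro f hf
      refine ⟨fun j => f (hℓ.1 j).choose, Finset.mem_univ _, ?_⟩
      funext x
      have h2 := hℓ.2.2 (fun y => f y = f x)
        (fun y => by rw [(Finset.mem_filter.1 hf).2 y]) _ x (hℓ.1 (ℓ x)).choose_spec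
      exact h2.mpr rfl
  rw [← Finset.sum_filter, Finset.sum_congr rfl fun ℓ hℓ => h1 ℓ (Finset.mem_filter.1 hℓ).2,
    Finset.sum_const, card_isLabelling, nsmul_eq_mul]
  split_ifs <;> simp

variable {N : ℕ}

/-- Wick contraction identifies the indices along the cycles of `σ * e`, i.e. along the faces. -/
theorem faceSum_eq [Fintype D] [DecidableEq D] (W : Sym2 (Fin N) → ℂ) (σ e : Perm D) :
    faceSum W σ e = ∑ f : D → Fin N, if ∀ x, f ((σ * e) x) = f x then edgeProd Finset.univ e W f
      else 0 := by
  unfold faceSum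
  refine Finset.sum_congr rfl fun f _ => ?_
  rw [Finset.prod_ite_zero]
  simp only [Finset.mem_univ, true_imp_iff, Finset.prod_const_one, ite_mul, one_mul, zero_mul,
    Perm.mul_apply, eq_comm]

theorem faceSum_mul [Fintype D] [DecidableEq D] (a : ℂ) (W : Sym2 (Fin N) → ℂ) (σ : Perm D)
    {e : Perm D} (he : e ∈ pairings Finset.univ) :
    faceSum (fun q => a * W q) σ e = a ^ (Fintype.card D / 2) * faceSum W σ e := by
  have h := two_mul_card_edges he
  rw [Finset.card_univ] at h
  simp only [faceSum, edgeProd, Finset.prod_mul_distrib, Finset.prod_const]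
  rw [← h, Nat.mul_div_cancel _ two_pos, Finset.mul_sum]
  exact Finset.sum_congr rfl fun f _ => mul_left_comm _ _ _

theorem mem_shapeSet_iff {n g : ℕ} {σ e : Perm (Fin n)} {ℓ : Fin n → Fin s} :
    (σ, e, ℓ) ∈ shapeSet s g n ↔ (e ∈ pairings Finset.univ ∧ PermConnected σ e ∧ CyclesGeThree σ) ∧
      cyc σ + s + 2 * g = n / 2 + 2 ∧ IsLabelling (σ * e) ℓ := by
  rw [mem_shapeSet]
  constructor
  · rintro ⟨h, h3⟩
    refine ⟨⟨h.pairing, h.conn, h3⟩, ?_, h.surj, h.inv, h.sep⟩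
    have := h.genus
    rwa [Fintype.card_fin] at this
  · rintro ⟨⟨h1, h2, h3⟩, h4, h5, h6, h7⟩
    refine ⟨⟨h1, h2, h5, h6, h7, ?_⟩, h3⟩
    rw [Fintype.card_fin]
    exact h4

/-- The pairs `(g, s)` which contribute to the coefficient of `t ^ m` in the free energy. -/
def typeSet (m : ℕ) : Finset (ℕ × ℕ) :=
  (Finset.range (m + 3) ×ˢ Finset.range (m + 3)).filter
    (fun q : ℕ × ℕ => 1 ≤ q.2 ∧ 2 < 2 * q.1 + q.2 ∧ 2 * (2 * q.1 + q.2) = m + 4)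

theorem mem_typeSet {m g s : ℕ} (hm : m ≠ 0) :
    (g, s) ∈ typeSet m ↔ 1 ≤ s ∧ 2 * (2 * g + s) = m + 4 := by
  simp only [typeSet, Finset.mem_filter, Finset.mem_product, Finset.mem_range]
  omega

open Classical in
/-- A connected fatgraph contributes to exactly one pair `(g, s)`: `s` is its number of faces, and `g` its
genus. The factors `N / 2` of the vertices and `2 / N` of the edges combine to the Euler characteristic
`V - E = 2 - 2 g - s`, and the factor `1 / s!` compensates the labellings of the faces. -/
theorem fatgraphWeight_eq_sum (hN : 1 ≤ N) (W : Sym2 (Fin N) → ℂ) {n m : ℕ} (hm : m ≠ 0)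
    (σ e : Perm (Fin n)) :
    (if n = m + 2 * cyc σ ∧ PermConnected σ e then
      fatgraphWeight (fun q => 2 / (N : ℂ) * W q) (Fin n) σ e else 0) =
      ∑ q ∈ typeSet m, ((N : ℂ) / 2) ^ (2 - 2 * (q.1 : ℤ) - (q.2 : ℤ)) * (1 / (q.2.factorial : ℂ)) *
        ∑ ℓ : Fin n → Fin q.2, if (σ, e, ℓ) ∈ shapeSet q.2 q.1 n then
          ∑ i : Fin q.2 → Fin N, edgeProd Finset.univ e W (i ∘ ℓ) else 0 := by
  by_cases h : e ∈ pairings Finset.univ ∧ PermConnected σ e ∧ CyclesGeThree σ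
  swap
  · rw [Finset.sum_eq_zero]
    · by_cases h1 : n = m + 2 * cyc σ ∧ PermConnected σ e
      · rw [if_pos h1, fatgraphWeight,
          if_neg fun h2 : CyclesGeThree σ ∧ e ∈ pairings Finset.univ => h ⟨h2.2, h1.2, h2.1⟩]
      · rw [if_neg h1]
    · intro q _
      rw [Finset.sum_eq_zero, mul_zero]
      exact fun ℓ _ => if_neg fun h2 => h (mem_shapeSet_iff.1 h2).1
  rcases Nat.eq_zero_or_pos n with rfl | hn
  · rw [if_neg (by omega), Finset.sum_eq_zero]
    intro q hq
    rw [Finset.sum_eq_zero, mul_zero]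
    refine fun ℓ _ => if_neg fun h2 => ?_
    obtain ⟨x, -⟩ := (mem_shapeSet_iff.1 h2).2.2.1 ⟨0, ((mem_typeSet hm).1 hq).1⟩
    exact x.elim0
  have : NeZero n := ⟨hn.ne'⟩
  obtain ⟨g, hg⟩ := exists_genus h.1 h.2.1
  rw [Fintype.card_fin] at hg
  have hpos : 1 ≤ cyc (σ * e) := by
    rw [cyc, Nat.one_le_iff_ne_zero, ← Nat.pos_iff_ne_zero]
    have : Nonempty (Quotient (Perm.SameCycle.setoid (σ * e))) := ⟨Quotient.mk _ 0⟩
    exact Nat.card_pos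
  have heven := cyc_pairing h.1
  rw [Fintype.card_fin] at heven
  have hN0 : (N : ℂ) / 2 ≠ 0 := div_ne_zero (by exact_mod_cast (by omega : N ≠ 0)) two_ne_zero
  have h1 : ∀ q ∈ typeSet m,
      ((N : ℂ) / 2) ^ (2 - 2 * (q.1 : ℤ) - (q.2 : ℤ)) * (1 / (q.2.factorial : ℂ)) *
        (∑ ℓ : Fin n → Fin q.2, if (σ, e, ℓ) ∈ shapeSet q.2 q.1 n then
          ∑ i : Fin q.2 → Fin N, edgeProd Finset.univ e W (i ∘ ℓ) else 0) =
      if q = (g, cyc (σ * e)) then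
        ((N : ℂ) / 2) ^ (2 - 2 * (g : ℤ) - (cyc (σ * e) : ℤ)) * faceSum W σ e else 0 := by
    rintro ⟨g', s'⟩ -
    simp only [mem_shapeSet_iff, h, true_and, and_self]
    by_cases hq : cyc σ + s' + 2 * g' = n / 2 + 2
    · simp only [hq, true_and]
      rw [sum_isLabelling (σ * e) fun f => edgeProd Finset.univ e W f, ← faceSum_eq]
      by_cases hs : s' = cyc (σ * e)
      · have hg' : g' = g := by omega
        subst hs hg'
        have hf : ((cyc (σ * e)).factorial : ℂ) ≠ 0 := by exact_mod_cast Nat.factorial_ne_zero _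
        rw [if_pos rfl, if_pos rfl]
        field_simp
      · rw [if_neg hs, if_neg fun h => hs (Prod.ext_iff.1 h).2, zero_mul, mul_zero]
    · rw [if_neg]
      · simp [hq]
      · intro h
        have h' := Prod.ext_iff.1 h
        simp only at h'
        exact hq (by rw [h'.1, h'.2]; exact hg)
  have hmem := mem_typeSet hm (g := g) (s := cyc (σ * e))
  rw [Finset.sum_congr rfl h1, Finset.sum_ite_eq']
  by_cases hnm : n = m + 2 * cyc σ
  · rw [if_pos ⟨hnm, h.2.1⟩, if_pos (hmem.2 ⟨hpos, by omega⟩), fatgraphWeight, if_pos ⟨h.2.2, h.1⟩,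
      faceSum_mul _ _ _ h.1, ← mul_assoc, Fintype.card_fin]
    congr 1
    have h2 : 2 / (N : ℂ) = ((N : ℂ) / 2)⁻¹ := by rw [inv_div]
    rw [h2, inv_pow, ← zpow_natCast, ← zpow_natCast, ← zpow_neg, ← zpow_add₀ hN0]
    congr 1
    omega
  · rw [if_neg fun h => hnm h.1, if_neg fun h => hnm (by have := hmem.1 h; omega)]

/-- The eigenvalue attached to a half-edge is that of the label of its face. -/
theorem edgeProd_expWeight_comp [Fintype D] [DecidableEq D] (l : Fin N → ℂ) (i : Fin s → Fin N)
    (e : Perm D) (ℓ : D → Fin s) :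
    edgeProd Finset.univ e (expWeight fun j => l (i j)) ℓ =
      edgeProd Finset.univ e (expWeight l) (i ∘ ℓ) := by
  unfold edgeProd
  refine Finset.prod_congr rfl fun q _ => ?_
  induction q using Sym2.ind with
  | _ x y => rfl

/-- The free energy is the generating series of connected fatgraphs. -/
theorem coeff_kpFreeEnergy (hN : 1 ≤ N) (l : Fin N → ℝ) {m : ℕ} (hm : m ≠ 0) :
    PowerSeries.coeff m (kpFreeEnergy N l) = ∑ n ∈ Finset.range (3 * m + 1),
      connSum (fatgraphWeight fun q => 2 / (N : ℂ) * expWeight (fun i => (l i : ℂ)) q) n m := by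
  classical
  have hN0 : (N : ℂ) ≠ 0 := by exact_mod_cast (by omega : N ≠ 0)
  simp only [connSum, fatgraphWeight_eq_sum hN _ hm]
  rw [kpFreeEnergy, PowerSeries.coeff_mk]
  have h1 : ∀ n, ∑ σ : Perm (Fin n), ∑ e : Perm (Fin n), ∑ q ∈ typeSet m,
      ((N : ℂ) / 2) ^ (2 - 2 * (q.1 : ℤ) - (q.2 : ℤ)) * (1 / (q.2.factorial : ℂ)) *
        (∑ ℓ : Fin n → Fin q.2, if (σ, e, ℓ) ∈ shapeSet q.2 q.1 n then
          ∑ i : Fin q.2 → Fin N, edgeProd Finset.univ e (expWeight fun i => (l i : ℂ)) (i ∘ ℓ)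
            else 0) =
      ∑ q ∈ typeSet m, ((N : ℂ) / 2) ^ (2 - 2 * (q.1 : ℤ) - (q.2 : ℤ)) *
        (1 / (q.2.factorial : ℂ)) * ∑ i : Fin q.2 → Fin N, ∑ M ∈ shapeSet q.2 q.1 n,
          edgeProd Finset.univ M.2.1 (expWeight fun j => (l (i j) : ℂ)) M.2.2 := by
    intro n
    rw [Finset.sum_congr rfl fun σ _ => Finset.sum_comm, Finset.sum_comm]
    refine Finset.sum_congr rfl fun q _ => ?_
    simp only [← Finset.mul_sum]
    congr 1
    have h2 : ∀ (i : Fin q.2 → Fin N) (M : Triple q.2 (Fin n)),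
        edgeProd Finset.univ M.2.1 (expWeight fun j => (l (i j) : ℂ)) M.2.2 =
          edgeProd Finset.univ M.2.1 (expWeight fun j => (l j : ℂ)) (i ∘ M.2.2) := fun i M =>
      edgeProd_expWeight_comp (fun j => (l j : ℂ)) i M.2.1 M.2.2
    rw [Finset.sum_congr rfl fun i _ => Finset.sum_congr rfl fun M _ => h2 i M]
    rw [Finset.sum_comm (s := (Finset.univ : Finset (Fin q.2 → Fin N)))]
    conv_rhs => rw [← Finset.univ_inter (shapeSet q.2 q.1 n), ← Finset.sum_ite_mem]
    rw [Fintype.sum_prod_type]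
    refine Finset.sum_congr rfl fun σ _ => ?_
    rw [Fintype.sum_prod_type]
  simp only [h1, Finset.mul_sum (typeSet m)]
  rw [Finset.sum_comm]
  refine Finset.sum_congr rfl fun q hq => ?_
  obtain ⟨g, s⟩ := q
  have hq' := (mem_typeSet hm).1 hq
  have hK : 6 * (2 * g + s - 2) < 3 * m + 1 := by omega
  simp only [kpTerm, shapeSum_eq_sum hq'.1 _ hK]
  rw [Finset.sum_comm]
  simp only [← Finset.mul_sum]
  have h2 : (N : ℂ) ^ (2 - 2 * (g : ℤ)) * (1 / 2 : ℂ) ^ (2 - 2 * (g : ℤ) - (s : ℤ)) *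
      (1 / ((N : ℂ) ^ s * (s.factorial : ℂ))) =
      ((N : ℂ) / 2) ^ (2 - 2 * (g : ℤ) - (s : ℤ)) * (1 / (s.factorial : ℂ)) := by
    rw [div_eq_mul_one_div (N : ℂ) 2, mul_zpow, zpow_sub₀ hN0 _ (s : ℤ), zpow_natCast]
    field_simp
  rw [← mul_assoc, h2, Finset.mul_sum]
  exact Finset.sum_congr rfl fun n _ => mul_left_comm _ _ _

theorem kpIntegral_eq_exp (hN : 1 ≤ N) {l : Fin N → ℝ} (hl : ∀ i, 0 < l i) :
    kpIntegral N l = (PowerSeries.exp ℂ).subst (kpFreeEnergy N l) := by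
  rw [kpIntegral_eq hN hl, mk_pairSum_eq_exp (fatgraphWeight_isMultiplicative _)]
  congr 1
  ext m
  rw [PowerSeries.coeff_mk]
  split_ifs with h
  · subst h
    rw [kpFreeEnergy, PowerSeries.coeff_mk, Finset.sum_eq_zero]
    intro q hq
    have := (Finset.mem_filter.1 hq).2
    omega
  · rw [coeff_kpFreeEnergy hN l h]

end

theorem mainTheorem2 :
    (∀ s : ℕ, 1 ≤ s → ∀ k : Fin s → ℕ, ∃! p : Polynomial ℂ, IsGenusExpansion k p) ∧
    (∀ g s : ℕ, 1 ≤ s → 2 < 2 * g + s →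
      Finite (Shape g s) ∧
      ∀ l : Fin s → ℂ,
        (∀ i, 0 < (l i).re ∧ 2 < ‖Complex.exp (l i) + Complex.exp (-l i)‖) →
        HasSum
          (fun k : Fin s → ℕ =>
            (∏ i, logCoeff (Complex.exp (l i) + Complex.exp (-l i)) (k i)) * genusMean g k)
          ((-1) ^ s * shapeSum g s l)) ∧
    ∀ N : ℕ, 1 ≤ N → ∀ l : Fin N → ℝ, (∀ i, 0 < l i) →
      kpIntegral N l = (PowerSeries.exp ℂ).subst (kpFreeEnergy N l) := by
  refine ⟨fun s hs k => existsUnique_genusExpansion hs k, fun g s hs hg => ⟨finite_shape hs,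
    fun l hl => ?_⟩, fun N hN l hl => kpIntegral_eq_exp hN hl⟩
  rw [← shapeGen_eq_shapeSum hs l]
  exact hasSum_genusMean hs hg hl
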